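/- Let $p=k/m$ with $k,m$ coprime positive integers, $m$ odd, and $0<p<4$; for real $t$ put $t^{p+1}=(t^{1/m})^{k+m}$ with $t^{1/m}$ the real $m$-th root. Let $\varepsilon\in\{1,-1\}$ and let $\alpha,c$ be real numbers with $\alpha\varepsilon<0$ and $c\alpha<0$. Let $\mathscr H$ be the Hilbert transform in $x$, $\mathscr Hu(x,y)=\mathrm{p.v.}\,\frac1\pi\int_{\mathbb R}\frac{u(z,y)}{x-z}\,dz$, and let $\mathscr Z$ be the closure of $C_0^\infty(\mathbb R^2)$ for the norm $\|\varphi\|_{\mathscr Z}^2=\|\varphi\|_{L^2(\mathbb R^2)}^2+\|\varphi_y\|_{L^2(\mathbb R^2)}^2+\|D_x^{1/2}\varphi\|_{L^2(\mathbb R^2)}^2$, where $D_x^{1/2}$ is the Fourier multiplier with symbol $|\xi_1|^{1/2}$. Let $\varphi$ be a solitary wave, that is, a real-valued $\varphi\in\mathscr Z$ satisfying $$-c\varphi+\frac1{p+1}\varphi^{p+1}+\alpha\mathscr H\varphi_x+\varepsilon\varphi_{yy}=0$$ in the sense of distributions on $\mathbb R^2$. Then: (i) $|x|^\ell|y|^\varrho\varphi(x,y)\in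 L^q(\mathbb R^2)$ for all $q\in(1,\infty)$, all $\ell\in[0,1)$ and all $\varrho\ge0$; (ii) $|(x,y)|^\theta\varphi(x,y)\in L^q(\mathbb R^2)$ for all $q\in(1,\infty)$ and all $\theta\in[0,1)$, where $|(x,y)|$ is the Euclidean norm; (iii) $\varphi\in L^1(\mathbb R^2)$. -/

import Mathlib

open MeasureTheory Filter Topology
open scoped ENNReal FourierTransform ContDiff

noncomputable section

/-- The plane `ℝ²` with its Euclidean norm; a point is `(x, y) = (z 0, z 1)`. -/
abbrev Plane : Type := EuclideanSpace ℝ (Fin 2)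

/-- Test functions: real-valued elements of `C₀^∞(ℝ²)`. -/
def IsTestFun (χ : Plane → ℝ) : Prop :=
  ContDiff ℝ ∞ χ ∧ HasCompactSupport χ

/-- The classical partial derivative `∂ₓ f`. -/
def partialX (f : Plane → ℝ) (z : Plane) : ℝ :=
  fderiv ℝ f z (EuclideanSpace.single 0 1)

/-- The classical partial derivative `∂_y f`. -/
def partialY (f : Plane → ℝ) (z : Plane) : ℝ :=
  fderiv ℝ f z (EuclideanSpace.single 1 1)

/-- The Hilbert transform in the variable `x`, as a Cauchy principal value,
`(ℋ f)(x, y) = p.v. (1/π) ∫ f(t, y) / (x - t) dt`.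
It is applied below only to functions in `C₀^∞(ℝ²)`, for which the limit exists. -/
def hilbertX (f : Plane → ℝ) (z : Plane) : ℝ :=
  limUnder (𝓝[>] (0 : ℝ)) fun δ : ℝ =>
    Real.pi⁻¹ * ∫ t in {t : ℝ | δ < |z 0 - t|}, f (!₂[t, z 1]) / (z 0 - t)

/-- The square of the norm
`‖f‖² = ‖f‖²_{L²} + ‖∂_y f‖²_{L²} + ‖D_x^{1/2} f‖²_{L²}` (possibly `∞`) of an `L²` function,
where the two derivatives are computed on the Fourier side. In Mathlib's normalization
`f̂(ξ) = ∫ f(z) e^{-2πi z·ξ} dz`, the operators `∂_y` and `D_x^{1/2}` have the symbols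
`2πi ξ₂` and `|2πξ₁|^{1/2}`. -/
def zNormSq (f : Lp ℂ 2 (volume : Measure Plane)) : ℝ≥0∞ :=
  (∫⁻ z : Plane, ‖f z‖ₑ ^ 2)
    + (∫⁻ ξ : Plane, ENNReal.ofReal ((2 * Real.pi * ξ 1) ^ 2) * ‖(𝓕 f) ξ‖ₑ ^ 2)
    + (∫⁻ ξ : Plane, ENNReal.ofReal |2 * Real.pi * ξ 0| * ‖(𝓕 f) ξ‖ₑ ^ 2)

/-- The class in `L²(ℝ²; ℂ)` of a real-valued square integrable function. -/
def toL2 (φ : Plane → ℝ) (h : MemLp (fun z => (φ z : ℂ)) 2 (volume : Measure Plane)) :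
    Lp ℂ 2 (volume : Measure Plane) :=
  h.toLp _

/-- The energy space `𝒵`, the closure of `C₀^∞(ℝ²)` for the norm whose square is `zNormSq`:
the real-valued `L²` functions that can be approximated in this norm by test functions. -/
def MemZ (φ : Plane → ℝ) : Prop :=
  ∃ h : MemLp (fun z => (φ z : ℂ)) 2 (volume : Measure Plane),
    ∀ r : ℝ≥0∞, 0 < r → ∃ χ : Plane → ℝ, IsTestFun χ ∧
      ∃ hχ : MemLp (fun z => (χ z : ℂ)) 2 (volume : Measure Plane),
        zNormSq (toL2 φ h - toL2 χ hχ) < r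

/-- The real `m`-th root, for odd `m`: `sign(t) |t|^{1/m}`. -/
def oddRoot (m : ℕ) (t : ℝ) : ℝ :=
  (SignType.sign t : ℝ) * |t| ^ ((m : ℝ)⁻¹)

/-- The power `t^{p+1}` of a real number `t`, of either sign, for `p = k/m` with `m` odd:
`t^{p+1} = (t^{1/m})^{k+m}`. -/
def powSucc (k m : ℕ) (t : ℝ) : ℝ :=
  oddRoot m t ^ (k + m)

/-- `φ` is a solitary wave for the data `c, α, ε` and `p = k/m`: it belongs to `𝒵` and
`-c φ + φ^{p+1}/(p+1) + α ℋ φ_x + ε φ_{yy} = 0` holds in the sense of distributions.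
The derivatives and `ℋ` are moved to the test function; since `ℋ` and `∂ₓ` are both
antisymmetric and commute, `⟨ℋ φ_x, χ⟩ = ∫ φ ℋ(χ_x)`. -/
def IsSolitaryWave (c α ε : ℝ) (k m : ℕ) (φ : Plane → ℝ) : Prop :=
  MemZ φ ∧
  LocallyIntegrable (fun z => powSucc k m (φ z)) (volume : Measure Plane) ∧
  ∀ χ : Plane → ℝ, IsTestFun χ →
    ∫ z : Plane, (-c * φ z * χ z
      + 1 / ((k : ℝ) / m + 1) * powSucc k m (φ z) * χ z
      + α * φ z * hilbertX (partialX χ) z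
      + ε * φ z * partialY (partialY χ) z) = 0

end

/-! Multiplying the equation by `-ε` gives `(c' + a ℋ∂ₓ - ∂_y²) φ = G` with `c' = εc > 0`, `a = -εα
> 0` and `|G| ≤ |φ|^(p+1)`. The symbol `c' + b|ξ₁| + (2πξ₂)²`, `b > 0`, is inverted by the kernel `K
= ∫₀^∞ e^{-c't} (Poisson) (Gauss) dt`, which is nonnegative and even. Hence `φ = K ⋆ G`
(`ae_eq_resolventKer_conv`), and `u = |φ|` satisfies `u ≤ K ⋆ u^(p+1)`. Everything else uses only
this inequality, bounds on `K` and an initial `L^q` bound on `u`.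

Kernel: power bounds on the two factors, integrated in `t`, give `K ≤ C |x|^(-β) |y|^(-γ)` whenever
`0 ≤ β ≤ 2`, `γ > 0` and `2β + γ > 1` (`exists_lresolventKer_le_rpow`). Decay in `y` is thus faster
than any power, while decay in `x` stops at `|x|^(-2)`. This is why `ϱ` is arbitrary but `ℓ < 1`:
the weight must leave `K` integrable.

Initial integrability: the energy norm embeds in `L^q` for `2 < q < 6` (`MemZ.memLp`), by a
weak-type estimate at the exponent 6. With `q = 3 + 3p/4`, the condition `p < 4` says both that `q <
6` and that `q/p > 3/2`; the latter puts `K` in the dual of `L^(q/p)`.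

Decay: `u^(p+1)` is read as `V u` with the potential `V = u^p` in `L^(q/p)`. Where `u` is large, or
far from the origin, `K ⋆ V ≤ 1/2` by Hölder, and that part of the right side is absorbed into the
left. This yields boundedness of `u`, then boundedness of `w u` for submultiplicative weights `w`.
Decay makes `u^(p+1)`, hence `u`, integrable, and a last absorption makes `w u` integrable.
Interpolating `w u` between `L¹` and `L^∞` gives all three claims. -/

open scoped SchwartzMap LineDeriv

/-! ### Product integrals on the plane and convolution of nonnegative functions. -/

/-- The coordinates `(x, y)` of a point of the plane preserve Lebesgue measure. -/
theorem measurePreserving_plane_coords :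
    MeasurePreserving (fun z : Plane => (z 0, z 1)) volume volume :=
  (volume_preserving_finTwoArrow ℝ).comp (PiLp.volume_preserving_ofLp (Fin 2))

/-- The coordinates of the plane as a measurable equivalence with `ℝ × ℝ`. -/
def planeCoords : Plane ≃ᵐ ℝ × ℝ :=
  (MeasurableEquiv.toLp 2 (Fin 2 → ℝ)).symm.trans MeasurableEquiv.finTwoArrow

theorem lintegral_plane_mul {F G : ℝ → ℝ≥0∞} (hF : Measurable F) (hG : Measurable G) :
    ∫⁻ z : Plane, F (z 0) * G (z 1) = (∫⁻ x, F x) * ∫⁻ y, G y := by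
  have h := measurePreserving_plane_coords.lintegral_comp
    (f := fun w : ℝ × ℝ => F w.1 * G w.2) (by fun_prop)
  rw [h, Measure.volume_eq_prod, lintegral_prod_mul hF.aemeasurable hG.aemeasurable]

theorem integral_plane_mul (F G : ℝ → ℂ) :
    ∫ z : Plane, F (z 0) * G (z 1) = (∫ x, F x) * ∫ y, G y := by
  have h := measurePreserving_plane_coords.integral_comp
    (planeCoords.measurableEmbedding) (fun w : ℝ × ℝ => F w.1 * G w.2)
  rw [h, Measure.volume_eq_prod, integral_prod_mul]

theorem integrable_plane_mul {F G : ℝ → ℂ} (hF : Integrable F) (hG : Integrable G) :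
    Integrable (fun z : Plane => F (z 0) * G (z 1)) :=
  (measurePreserving_plane_coords.integrable_comp_emb planeCoords.measurableEmbedding
    (g := fun w : ℝ × ℝ => F w.1 * G w.2)).2 (hF.mul_prod hG)

/-- The lower convolution `(k ⋆ f)(z) = ∫ k(z - w) f(w) dw` of nonnegative functions. -/
noncomputable def lconv (k f : Plane → ℝ≥0∞) (z : Plane) : ℝ≥0∞ :=
  ∫⁻ w, k (z - w) * f w

theorem lconv_mono {k k' f f' : Plane → ℝ≥0∞} (hk : k ≤ᵐ[volume] k') (hf : f ≤ᵐ[volume] f')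
    (z : Plane) : lconv k f z ≤ lconv k' f' z := by
  refine lintegral_mono_ae ?_
  have hk' : ∀ᵐ w : Plane, k (z - w) ≤ k' (z - w) :=
    (quasiMeasurePreserving_sub_left volume z).ae hk
  filter_upwards [hk', hf] with w h1 h2 using mul_le_mul' h1 h2

theorem lconv_congr_right {k f f' : Plane → ℝ≥0∞} (hf : f =ᵐ[volume] f') :
    lconv k f = lconv k f' := by
  ext z
  exact le_antisymm (lconv_mono (ae_eq_refl k).le hf.le z)
    (lconv_mono (ae_eq_refl k).le hf.symm.le z)

theorem lconv_add {k f g : Plane → ℝ≥0∞} (hk : Measurable k) (hf : Measurable f) (z : Plane) :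
    lconv k (fun w => f w + g w) z = lconv k f z + lconv k g z := by
  unfold lconv
  rw [← lintegral_add_left (by fun_prop)]
  simp only [mul_add]

theorem lconv_const_mul {k f : Plane → ℝ≥0∞} (hk : Measurable k) (hf : Measurable f)
    (C : ℝ≥0∞) (z : Plane) : lconv k (fun w => C * f w) z = C * lconv k f z := by
  unfold lconv
  rw [← lintegral_const_mul _ (by fun_prop)]
  congr 1; ext w; ring

theorem lconv_le_of_ae_le {k f : Plane → ℝ≥0∞} (hk : Measurable k) {C : ℝ≥0∞}
    (hf : ∀ᵐ w, f w ≤ C) (z : Plane) : lconv k f z ≤ (∫⁻ w, k w) * C := by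
  calc lconv k f z ≤ lconv k (fun _ => C) z := lconv_mono (ae_eq_refl k).le hf z
    _ = (∫⁻ w, k (z - w)) * C := lintegral_mul_const _ (by fun_prop)
    _ = _ := by rw [lintegral_sub_left_eq_self (fun w => k w) z]

/-- Tonelli: convolution with an even kernel is a symmetric operator. The absorption argument uses
it to move `k` onto the potential. -/
theorem lintegral_mul_lconv {k f g : Plane → ℝ≥0∞} (hk : Measurable k) (hf : Measurable f)
    (hg : Measurable g) (heven : ∀ z, k (-z) = k z) :
    ∫⁻ z, g z * lconv k f z = ∫⁻ z, f z * lconv k g z := by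
  unfold lconv
  have h1 : ∀ z, g z * ∫⁻ w, k (z - w) * f w = ∫⁻ w, g z * (k (z - w) * f w) := fun z =>
    (lintegral_const_mul _ (by fun_prop)).symm
  have h2 : ∀ z, f z * ∫⁻ w, k (z - w) * g w = ∫⁻ w, f z * (k (z - w) * g w) := fun z =>
    (lintegral_const_mul _ (by fun_prop)).symm
  simp_rw [h1, h2]
  rw [lintegral_lintegral_swap (by fun_prop)]
  refine lintegral_congr fun w => lintegral_congr fun z => ?_
  rw [← heven (w - z), neg_sub]; ring

theorem lintegral_lconv {k f : Plane → ℝ≥0∞} (hk : Measurable k) (hf : Measurable f) :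
    ∫⁻ z, lconv k f z = (∫⁻ z, k z) * ∫⁻ z, f z := by
  unfold lconv
  rw [lintegral_lintegral_swap (by fun_prop)]
  have : ∀ w : Plane, ∫⁻ z, k (z - w) * f w = (∫⁻ z, k z) * f w := fun w => by
    rw [lintegral_mul_const _ (by fun_prop), lintegral_sub_right_eq_self (fun z => k z) w]
  simp_rw [this]
  rw [lintegral_const_mul _ hf]

/-- Hölder's inequality for the lower convolution. -/
theorem lconv_le_holder {k f : Plane → ℝ≥0∞} (hk : Measurable k) (hf : Measurable f)
    {s t : ℝ} (hst : s.HolderConjugate t) (z : Plane) :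
    lconv k f z ≤ (∫⁻ w, k w ^ s) ^ (1 / s) * (∫⁻ w, f w ^ t) ^ (1 / t) := by
  have h := ENNReal.lintegral_mul_le_Lp_mul_Lq volume hst
    (f := fun w => k (z - w)) (g := f) (by fun_prop) hf.aemeasurable
  simpa only [lintegral_sub_left_eq_self (fun w => k w ^ s) z, lconv, Pi.mul_apply] using h

/-! ### Absorption arguments for `u ≤ k ⋆ u^(p+1)`. -/

theorem ENNReal.le_two_mul_of_le_add_half {X F : ℝ≥0∞} (hX : X ≠ ⊤) (h : X ≤ F + 2⁻¹ * X) :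
    X ≤ 2 * F := by
  have h2 : 2⁻¹ * X + 2⁻¹ * X = X := by
    rw [← add_mul, ENNReal.inv_two_add_inv_two, one_mul]
  have hfin : 2⁻¹ * X ≠ ⊤ := ENNReal.mul_ne_top (by simp) hX
  have h3 : 2⁻¹ * X ≤ F := by
    have : 2⁻¹ * X + 2⁻¹ * X ≤ F + 2⁻¹ * X := by rwa [h2]
    exact (ENNReal.add_le_add_iff_right hfin).1 this
  calc X = 2 * (2⁻¹ * X) := by
        rw [← mul_assoc, ENNReal.mul_inv_cancel (by simp) (by simp), one_mul]
    _ ≤ 2 * F := by gcongr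

/-- An integral inequality `u ≤ M + k ⋆ (V u)` with a small potential `V` makes `u` bounded. -/
theorem ae_le_two_mul_of_le_add_lconv {k V u : Plane → ℝ≥0∞} {M : ℝ≥0∞}
    (hk : Measurable k) (hV : Measurable V) (hu : Measurable u) (heven : ∀ z, k (-z) = k z)
    (hsmall : ∀ z, lconv k V z ≤ 2⁻¹)
    (hfin : ∫⁻ z, V z * u z ≠ ⊤)
    (hle : ∀ᵐ z, u z ≤ M + lconv k (fun w => V w * u w) z) :
    ∀ᵐ z, u z ≤ 2 * M := by
  set v : Plane → ℝ≥0∞ := fun z => u z - 2 * M with hv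
  have hvm : Measurable v := hu.sub measurable_const
  have hVv : Measurable fun z => V z * v z := hV.mul hvm
  -- From `u ≤ v + 2M` the constant part contributes `2M (k ⋆ V) ≤ M`; together with the given `M`
  -- this is exactly the `2M` subtracted in `v`.
  have hvle : ∀ᵐ z, v z ≤ lconv k (fun w => V w * v w) z := by
    filter_upwards [hle] with z hz
    rw [hv, tsub_le_iff_left]
    calc u z ≤ M + lconv k (fun w => V w * u w) z := hz
      _ ≤ M + lconv k (fun w => V w * v w + (2 * M) * V w) z := by
          gcongr
          refine lconv_mono (ae_eq_refl k).le (Eventually.of_forall fun w => ?_) z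
          calc V w * u w ≤ V w * (v w + 2 * M) := by gcongr; exact le_tsub_add
            _ = _ := by ring
      _ = M + (lconv k (fun w => V w * v w) z + (2 * M) * lconv k V z) := by
          rw [lconv_add hk hVv, lconv_const_mul hk hV]
      _ ≤ M + (lconv k (fun w => V w * v w) z + (2 * M) * 2⁻¹) := by
          gcongr; exact hsmall z
      _ = M + (lconv k (fun w => V w * v w) z + M) := by
          rw [mul_comm 2 M, mul_assoc, ENNReal.mul_inv_cancel (by simp) (by simp), mul_one]
      _ = _ := by ring
  -- Pairing with `V` and moving `k` across leaves `k ⋆ V ≤ 1/2` as a factor. Since the integral is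
  -- finite it vanishes, so `V v = 0` a.e. and `v ≤ k ⋆ 0 = 0`.
  have hI : ∫⁻ z, V z * v z ≤ 2⁻¹ * ∫⁻ z, V z * v z := by
    calc ∫⁻ z, V z * v z ≤ ∫⁻ z, V z * lconv k (fun w => V w * v w) z := by
          refine lintegral_mono_ae ?_
          filter_upwards [hvle] with z hz
          gcongr
      _ = ∫⁻ z, V z * v z * lconv k V z := lintegral_mul_lconv hk hVv hV heven
      _ ≤ ∫⁻ z, V z * v z * 2⁻¹ := by gcongr; exact hsmall _
      _ = _ := by rw [lintegral_mul_const _ hVv, mul_comm]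
  have hI' : ∫⁻ z, V z * v z ≠ ⊤ := by
    refine ne_top_of_le_ne_top hfin (lintegral_mono fun z => ?_)
    gcongr
    exact tsub_le_self
  have h0 : ∫⁻ z, V z * v z = 0 := by
    have := ENNReal.le_two_mul_of_le_add_half (F := 0) hI' (by simpa using hI)
    simpa using this
  have h0' := (lintegral_eq_zero_iff hVv).1 h0
  filter_upwards [hvle] with z hz
  have : lconv k (fun w => V w * v w) z = 0 := by
    rw [lconv_congr_right h0']; simp [lconv]
  rw [this] at hz
  exact tsub_eq_zero_iff_le.1 (le_antisymm hz bot_le)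

/-- A bounded solution of `u ≤ M + k ⋆ (V u)` with a small potential `V` is bounded by `2 M`. -/
theorem ae_le_two_mul_of_bounded {k V u : Plane → ℝ≥0∞} {M B : ℝ≥0∞}
    (hk : Measurable k) (hV : Measurable V)
    (hsmall : ∀ z, lconv k V z ≤ 2⁻¹) (hB : B ≠ ⊤) (hbdd : ∀ᵐ z, u z ≤ B)
    (hle : ∀ᵐ z, u z ≤ M + lconv k (fun w => V w * u w) z) :
    ∀ᵐ z, u z ≤ 2 * M := by
  -- Boundedness is known here, so the essential supremum itself is finite and can be absorbed; no
  -- pairing is needed.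
  set S := essSup u volume
  have hS : S ≤ B := essSup_le_of_ae_le B hbdd
  have hSu : ∀ᵐ z, u z ≤ S := ae_le_essSup
  have hS2 : S ≤ M + 2⁻¹ * S := by
    refine essSup_le_of_ae_le _ ?_
    filter_upwards [hle] with z hz
    refine hz.trans ?_
    gcongr
    calc lconv k (fun w => V w * u w) z ≤ lconv k (fun w => S * V w) z := by
          refine lconv_mono (ae_eq_refl k).le ?_ z
          filter_upwards [hSu] with w hw
          rw [mul_comm]; gcongr
      _ = S * lconv k V z := lconv_const_mul hk hV _ _
      _ ≤ S * 2⁻¹ := by gcongr; exact hsmall z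
      _ = _ := mul_comm _ _
  have := ENNReal.le_two_mul_of_le_add_half (ne_top_of_le_ne_top hB hS) hS2
  filter_upwards [hSu] with z hz using hz.trans this

/-- On sets shrinking to a null set, the potential `u ^ p` becomes small for the convolution
with a kernel in the Hölder dual space. -/
theorem exists_forall_lconv_indicator_le_half {k u : Plane → ℝ≥0∞} {p q s : ℝ}
    (hk : Measurable k) (hu : Measurable u) (hp : 0 < p) (hq : 0 < q)
    (hs : s.HolderConjugate (q / p)) (hks : ∫⁻ z, k z ^ s ≠ ⊤) (huq : ∫⁻ z, u z ^ q ≠ ⊤)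
    {S : ℕ → Set Plane} (hSm : ∀ n, MeasurableSet (S n)) (hS : Antitone S)
    (hS0 : volume (⋂ n, S n) = 0) :
    ∀ᶠ n in atTop, ∀ z, lconv k ((S n).indicator fun w => u w ^ p) z ≤ 2⁻¹ := by
  -- The finite measure `u^q dz` tends to zero along `S n`. Hölder with exponents `s` and `q/p`
  -- bounds the convolution by `‖k‖_s μ(S n)^(p/q)`, uniformly in `z`.
  set μ : Measure Plane := volume.withDensity fun z => u z ^ q
  have hμ : Tendsto (fun n => μ (S n)) atTop (𝓝 0) := by
    have h := tendsto_measure_iInter_atTop (μ := μ) (fun n => (hSm n).nullMeasurableSet) hS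
      ⟨0, ne_top_of_le_ne_top huq (by
        rw [withDensity_apply _ (hSm 0)]; exact setLIntegral_le_lintegral _ _)⟩
    rwa [withDensity_absolutelyContinuous _ _ hS0] at h
  set c := (∫⁻ z, k z ^ s) ^ (1 / s)
  have hc : c ≠ ⊤ := ENNReal.rpow_ne_top_of_nonneg (by simpa using hs.nonneg) hks
  have hlim : Tendsto (fun n => c * (μ (S n)) ^ (1 / (q / p))) atTop (𝓝 0) := by
    have h1 := (ENNReal.continuous_rpow_const (y := 1 / (q / p))).tendsto 0 |>.comp hμ
    rw [ENNReal.zero_rpow_of_pos (by positivity)] at h1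
    simpa using ENNReal.Tendsto.const_mul h1 (Or.inr hc)
  filter_upwards [hlim.eventually_le_const (show (0 : ℝ≥0∞) < 2⁻¹ by simp)] with n hn z
  refine (lconv_le_holder hk ((hu.pow_const p).indicator (hSm n)) hs z).trans
    (le_trans (le_of_eq ?_) hn)
  rw [withDensity_apply _ (hSm n), ← lintegral_indicator (hSm n)]
  congr 3
  ext w
  by_cases hw : w ∈ S n
  · simp only [Set.indicator_of_mem hw]
    rw [← ENNReal.rpow_mul, mul_div_cancel₀ _ hp.ne']
  · simp only [Set.indicator_of_notMem hw]
    rw [ENNReal.zero_rpow_of_pos (by positivity)]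

theorem ENNReal.rpow_add_one_eq_mul {p : ℝ} (hp : 0 ≤ p) (x : ℝ≥0∞) :
    x ^ (p + 1) = x ^ p * x := by
  rw [ENNReal.rpow_add_of_nonneg _ _ hp zero_le_one, ENNReal.rpow_one]

/-- Subcritical subsolutions of the convolution equation `u = k ⋆ u ^ (p + 1)` are bounded. -/
theorem exists_ae_le_of_le_lconv_rpow {k u : Plane → ℝ≥0∞} {p q s : ℝ}
    (hk : Measurable k) (hu : Measurable u) (heven : ∀ z, k (-z) = k z) (hp : 0 < p)
    (hpq : p + 1 ≤ q) (hs : s.HolderConjugate (q / p)) (hk1 : ∫⁻ z, k z ≠ ⊤)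
    (hks : ∫⁻ z, k z ^ s ≠ ⊤) (huq : ∫⁻ z, u z ^ q ≠ ⊤)
    (hle : ∀ᵐ z, u z ≤ lconv k (fun w => u w ^ (p + 1)) z) :
    ∃ B : ℝ≥0∞, B ≠ ⊤ ∧ ∀ᵐ z, u z ≤ B := by
  have hq : 0 < q := by linarith
  have hSm : ∀ n : ℕ, MeasurableSet {z | (n : ℝ≥0∞) < u z} := fun n =>
    measurableSet_lt measurable_const hu
  have hS0 : volume (⋂ n : ℕ, {z | (n : ℝ≥0∞) < u z}) = 0 := by
    have h := ae_lt_top (hu.pow_const q) huq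
    refine measure_mono_null (fun z hz => ?_) h
    simp only [Set.mem_iInter, Set.mem_ofPred_eq] at hz
    have : u z = ⊤ := by
      by_contra hne
      obtain ⟨n, hn⟩ := ENNReal.exists_nat_gt hne
      exact absurd (hz n) hn.le.not_gt
    simp [this, ENNReal.top_rpow_of_pos hq]
  -- Besides smallness of the potential, `n ≥ 1` is required so that `u^(p+1) ≤ u^q` on `{u > n}`,
  -- which makes the integral of `V u` finite.
  obtain ⟨n, hn, hn1⟩ := ((exists_forall_lconv_indicator_le_half hk hu hp hq hs hks huq hSm
    (fun a b hab z hz => show (a : ℝ≥0∞) < u z from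
      lt_of_le_of_lt (Nat.cast_le.2 hab) (show (b : ℝ≥0∞) < u z from hz)) hS0).and
    (eventually_ge_atTop 1)).exists
  set V : Plane → ℝ≥0∞ := {z | (n : ℝ≥0∞) < u z}.indicator fun w => u w ^ p with hV
  have hVm : Measurable V := (hu.pow_const p).indicator (hSm n)
  have hn1' : (1 : ℝ≥0∞) ≤ n := by exact_mod_cast hn1
  refine ⟨2 * ((∫⁻ z, k z) * (n : ℝ≥0∞) ^ (p + 1)), ENNReal.mul_ne_top (by simp)
    (ENNReal.mul_ne_top hk1 (ENNReal.rpow_ne_top_of_nonneg (by linarith) (by simp))),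
    ae_le_two_mul_of_le_add_lconv hk hVm hu heven hn ?_ ?_⟩
  · refine ne_top_of_le_ne_top huq (lintegral_mono fun z => ?_)
    by_cases hz : z ∈ {z | (n : ℝ≥0∞) < u z}
    · rw [hV, Set.indicator_of_mem hz, ← ENNReal.rpow_add_one_eq_mul hp.le]
      exact ENNReal.rpow_le_rpow_of_exponent_le (hn1'.trans (le_of_lt hz)) hpq
    · rw [hV, Set.indicator_of_notMem hz]; simp
  · filter_upwards [hle] with z hz
    have hsplit : (fun w => u w ^ (p + 1)) = fun w =>
        {z | (n : ℝ≥0∞) < u z}ᶜ.indicator (fun w => u w ^ (p + 1)) w + V w * u w := by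
      ext w
      by_cases hw : w ∈ {z | (n : ℝ≥0∞) < u z}
      · rw [hV, Set.indicator_of_mem hw, Set.indicator_of_notMem (by simpa using hw),
          zero_add, ENNReal.rpow_add_one_eq_mul hp.le]
      · rw [hV, Set.indicator_of_notMem hw, Set.indicator_of_mem (by simpa using hw)]; simp
    rw [hsplit, lconv_add hk ((hu.pow_const _).indicator (hSm n).compl)] at hz
    refine hz.trans (add_le_add_left (lconv_le_of_ae_le hk (Eventually.of_forall fun w => ?_) z) _)
    by_cases hw : w ∈ {z | (n : ℝ≥0∞) < u z}
    · rw [Set.indicator_of_notMem (by simpa using hw)]; exact bot_le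
    · rw [Set.indicator_of_mem (by simpa using hw)]
      exact ENNReal.rpow_le_rpow (by simpa using hw) (by linarith)

/-- Truncating a submultiplicative weight keeps submultiplicativity with the untruncated weight on
the kernel. Truncated quantities are finite, so absorption applies to them with a bound independent
of `N`. -/
theorem min_natCast_le_mul_min {a b c : ℝ≥0∞} (h : a ≤ b * c) (hb : 1 ≤ b) (N : ℕ) :
    min a N ≤ b * min c N := by
  rcases le_total c N with hc | hc
  · rw [min_eq_left hc]; exact (min_le_left _ _).trans h
  · rw [min_eq_right hc]
    exact (min_le_right _ _).trans (le_mul_of_one_le_left bot_le hb)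

theorem le_of_forall_min_natCast_mul_le {a b C : ℝ≥0∞} (ha : a ≠ ⊤)
    (h : ∀ N : ℕ, min a N * b ≤ C) : a * b ≤ C := by
  obtain ⟨N, hN⟩ := ENNReal.exists_nat_gt ha
  simpa [min_eq_left hN.le] using h N

/-- Decay in the supremum norm with a submultiplicative weight `w` for which `w k` is still an
admissible kernel. -/
theorem exists_ae_weight_mul_le {k u w : Plane → ℝ≥0∞} {p q s : ℝ} {B : ℝ≥0∞}
    (hk : Measurable k) (hu : Measurable u) (hw : Measurable w) (hp : 0 < p)
    (hpq : p + 1 ≤ q) (hs : s.HolderConjugate (q / p))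
    (hw1 : ∀ z, 1 ≤ w z) (hwtop : ∀ z, w z ≠ ⊤) (hsub : ∀ z z', w z ≤ w (z - z') * w z')
    (hwloc : ∀ R : ℕ, ∃ W : ℝ≥0∞, W ≠ ⊤ ∧ ∀ z, ‖z‖ ≤ R → w z ≤ W)
    (hwk1 : ∫⁻ z, w z * k z ≠ ⊤) (hwks : ∫⁻ z, (w z * k z) ^ s ≠ ⊤)
    (huq : ∫⁻ z, u z ^ q ≠ ⊤) (hB : B ≠ ⊤) (huB : ∀ᵐ z, u z ≤ B)
    (hle : ∀ᵐ z, u z ≤ lconv k (fun w => u w ^ (p + 1)) z) :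
    ∃ C : ℝ≥0∞, C ≠ ⊤ ∧ ∀ᵐ z, w z * u z ≤ C := by
  have hq : 0 < q := by linarith
  have hwk : Measurable fun z => w z * k z := hw.mul hk
  have hSm : ∀ n : ℕ, MeasurableSet {z : Plane | (n : ℝ) < ‖z‖} := fun n =>
    measurableSet_lt measurable_const measurable_norm
  have hS0 : volume (⋂ n : ℕ, {z : Plane | (n : ℝ) < ‖z‖}) = 0 := by
    have : (⋂ n : ℕ, {z : Plane | (n : ℝ) < ‖z‖}) = ∅ := by
      ext z
      simp only [Set.mem_iInter, Set.mem_ofPred_eq, Set.mem_empty_iff_false, iff_false, not_forall,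
        not_lt]
      exact exists_nat_ge ‖z‖
    simp [this]
  obtain ⟨n, hn⟩ := (exists_forall_lconv_indicator_le_half hwk hu hp hq hs hwks huq hSm
    (fun a b hab z hz => show (a : ℝ) < ‖z‖ from
      lt_of_le_of_lt (Nat.cast_le.2 hab) (show (b : ℝ) < ‖z‖ from hz)) hS0).exists
  set S : Set Plane := {z : Plane | (n : ℝ) < ‖z‖} with hS
  set V : Plane → ℝ≥0∞ := S.indicator fun w => u w ^ p with hV
  have hVm : Measurable V := (hu.pow_const p).indicator (hSm n)
  obtain ⟨W, hW, hWle⟩ := hwloc n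
  refine ⟨2 * ((∫⁻ z, w z * k z) * (W * B ^ (p + 1))), ENNReal.mul_ne_top (by simp)
    (ENNReal.mul_ne_top hwk1 (ENNReal.mul_ne_top hW
      (ENNReal.rpow_ne_top_of_nonneg (by linarith) hB))), ?_⟩
  have key : ∀ N : ℕ, ∀ᵐ z, min (w z) N * u z ≤
      2 * ((∫⁻ z, w z * k z) * (W * B ^ (p + 1))) := by
    intro N
    refine ae_le_two_mul_of_bounded hwk hVm hn (B := N * B) (ENNReal.mul_ne_top (by simp) hB) ?_ ?_
    · filter_upwards [huB] with z hz
      gcongr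
      exact min_le_right _ _
    · filter_upwards [hle] with z hz
      have h1 : min (w z) N * u z ≤
          lconv (fun z => w z * k z) (fun z' => min (w z') N * u z' ^ (p + 1)) z := by
        calc min (w z) N * u z ≤ min (w z) N * lconv k (fun w => u w ^ (p + 1)) z := by gcongr
          _ = ∫⁻ z', min (w z) N * (k (z - z') * u z' ^ (p + 1)) :=
              (lintegral_const_mul _ (by fun_prop)).symm
          _ ≤ _ := by
              refine lintegral_mono fun z' => ?_
              calc min (w z) N * (k (z - z') * u z' ^ (p + 1))
                  ≤ (w (z - z') * min (w z') N) * (k (z - z') * u z' ^ (p + 1)) := by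
                    gcongr
                    exact min_natCast_le_mul_min (hsub z z') (hw1 _) N
                _ = _ := by ring
      -- Inside the ball of radius `n` the weight is at most `W` and `u` at most `B`, which produces
      -- the constant term; outside it `u^p` is the small potential.
      have hsplit : (fun z' => min (w z') N * u z' ^ (p + 1)) = fun z' =>
          Sᶜ.indicator (fun z' => min (w z') N * u z' ^ (p + 1)) z'
            + V z' * (min (w z') N * u z') := by
        ext z'
        by_cases hz' : z' ∈ S
        · rw [hV, Set.indicator_of_mem hz', Set.indicator_of_notMem (by simpa using hz'),
            zero_add, ENNReal.rpow_add_one_eq_mul hp.le]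
          ring
        · rw [hV, Set.indicator_of_notMem hz', Set.indicator_of_mem (by simpa using hz')]; simp
      have hm : Measurable fun z' => min (w z') (N : ℝ≥0∞) * u z' ^ (p + 1) := by fun_prop
      rw [hsplit, lconv_add hwk (hm.indicator (hSm n).compl)] at h1
      refine h1.trans (add_le_add_left (lconv_le_of_ae_le hwk ?_ z) _)
      filter_upwards [huB] with z' hz'
      by_cases hzS : z' ∈ S
      · rw [Set.indicator_of_notMem (Set.notMem_compl_iff.2 hzS)]; exact bot_le
      · rw [Set.indicator_of_mem (Set.mem_compl hzS)]
        have hp1 : 0 ≤ p + 1 := by linarith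
        gcongr
        exact (min_le_left _ _).trans (hWle z' (not_lt.1 hzS))
  filter_upwards [ae_all_iff.2 key] with z hz using
    le_of_forall_min_natCast_mul_le (hwtop z) hz

/-- Weighted integrability of an integrable subsolution that is small away from bounded sets. -/
theorem lintegral_weight_mul_ne_top {k u w : Plane → ℝ≥0∞} {p : ℝ} {B : ℝ≥0∞}
    (hk : Measurable k) (hu : Measurable u) (hw : Measurable w) (hp : 0 < p)
    (hw1 : ∀ z, 1 ≤ w z) (hwtop : ∀ z, w z ≠ ⊤) (hsub : ∀ z z', w z ≤ w (z - z') * w z')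
    (hwk1 : ∫⁻ z, w z * k z ≠ ⊤) (hu1 : ∫⁻ z, u z ≠ ⊤) (hB : B ≠ ⊤) (huB : ∀ᵐ z, u z ≤ B)
    (hloc : ∀ δ : ℝ≥0∞, 0 < δ → ∃ W : ℝ≥0∞, W ≠ ⊤ ∧ ∀ᵐ z, δ < u z → w z ≤ W)
    (hle : ∀ᵐ z, u z ≤ lconv k (fun w => u w ^ (p + 1)) z) :
    ∫⁻ z, w z * u z ≠ ⊤ := by
  have hwk : Measurable fun z => w z * k z := hw.mul hk
  set κ := ∫⁻ z, w z * k z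
  -- `δ` is the level below which the nonlinearity is absorbed: there `u^(p+1) ≤ δ^p u`, and `κ δ^p
  -- ≤ 1/2`.
  obtain ⟨δ, hδ0, hδ⟩ : ∃ δ : ℝ≥0∞, 0 < δ ∧ κ * δ ^ p ≤ 2⁻¹ := by
    have h1 : Tendsto (fun δ : ℝ≥0∞ => κ * δ ^ p) (𝓝[>] 0) (𝓝 0) := by
      have h := ((ENNReal.continuous_rpow_const (y := p)).tendsto 0).mono_left
        (nhdsWithin_le_nhds (s := Set.Ioi 0))
      rw [ENNReal.zero_rpow_of_pos hp] at h
      simpa using ENNReal.Tendsto.const_mul h (Or.inr hwk1)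
    obtain ⟨δ, h, h'⟩ := ((h1.eventually_le_const (show (0 : ℝ≥0∞) < 2⁻¹ by simp)).and
      self_mem_nhdsWithin).exists
    exact ⟨δ, h', h⟩
  obtain ⟨W, hW, hWle⟩ := hloc δ hδ0
  set D := 2 * (κ * (W * (B ^ p * ∫⁻ z, u z)))
  have hD : D ≠ ⊤ := ENNReal.mul_ne_top (by simp) (ENNReal.mul_ne_top hwk1 (ENNReal.mul_ne_top hW
    (ENNReal.mul_ne_top (ENNReal.rpow_ne_top_of_nonneg hp.le hB) hu1)))
  have key : ∀ N : ℕ, ∫⁻ z, min (w z) N * u z ≤ D := by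
    intro N
    refine ENNReal.le_two_mul_of_le_add_half ?_ ?_
    · refine ne_top_of_le_ne_top (ENNReal.mul_ne_top (ENNReal.natCast_ne_top N) hu1) ?_
      rw [← lintegral_const_mul _ hu]
      refine lintegral_mono fun z => ?_
      gcongr
      exact min_le_right _ _
    · calc ∫⁻ z, min (w z) N * u z
          ≤ ∫⁻ z, lconv (fun z => w z * k z) (fun z' => min (w z') N * u z' ^ (p + 1)) z := by
            refine lintegral_mono_ae ?_
            filter_upwards [hle] with z hz
            calc min (w z) N * u z ≤ min (w z) N * lconv k (fun w => u w ^ (p + 1)) z := by gcongr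
              _ = ∫⁻ z', min (w z) N * (k (z - z') * u z' ^ (p + 1)) :=
                  (lintegral_const_mul _ (by fun_prop)).symm
              _ ≤ _ := by
                  refine lintegral_mono fun z' => ?_
                  calc min (w z) N * (k (z - z') * u z' ^ (p + 1))
                      ≤ (w (z - z') * min (w z') N) * (k (z - z') * u z' ^ (p + 1)) := by
                        gcongr
                        exact min_natCast_le_mul_min (hsub z z') (hw1 _) N
                    _ = _ := by ring
        _ = κ * ∫⁻ z, min (w z) N * u z ^ (p + 1) := lintegral_lconv hwk (by fun_prop)
        -- Where `u > δ` the weight is at most `W`, so integrability of `u` suffices; where `u ≤ δ`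
        -- the term is the one to be absorbed.
        _ ≤ κ * ∫⁻ z, (W * B ^ p * u z + δ ^ p * (min (w z) N * u z)) := by
            gcongr 1
            refine lintegral_mono_ae ?_
            filter_upwards [huB, hWle] with z hz hz'
            rw [ENNReal.rpow_add_one_eq_mul hp.le]
            rcases le_or_gt (u z) δ with h | h
            · refine le_add_left ?_
              calc min (w z) N * (u z ^ p * u z) ≤ min (w z) N * (δ ^ p * u z) := by gcongr
                _ = _ := by ring
            · refine le_add_right ?_
              calc min (w z) N * (u z ^ p * u z) ≤ W * (B ^ p * u z) := by
                    gcongr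
                    exact (min_le_left _ _).trans (hz' h)
                _ = _ := by ring
        _ = κ * (W * (B ^ p * ∫⁻ z, u z)) + κ * δ ^ p * ∫⁻ z, min (w z) N * u z := by
            rw [lintegral_add_left (by fun_prop), lintegral_const_mul _ hu,
              lintegral_const_mul _ (by fun_prop)]
            ring
        _ ≤ _ := by gcongr
  -- Monotone convergence removes the truncation.
  have hmono : ∫⁻ z, w z * u z = ⨆ N : ℕ, ∫⁻ z, min (w z) N * u z := by
    rw [← lintegral_iSup (fun N => by fun_prop)]
    · refine lintegral_congr fun z => le_antisymm ?_ (iSup_le fun N => ?_)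
      · exact le_of_forall_min_natCast_mul_le (hwtop z)
          fun N => le_iSup (fun N : ℕ => min (w z) N * u z) N
      · gcongr; exact min_le_left _ _
    · intro a b hab z
      dsimp only
      gcongr
  rw [hmono]
  exact ne_top_of_le_ne_top hD (iSup_le key)

/-! ### Power profiles and polynomial weights. -/

theorem lintegral_comp_abs (f : ℝ → ℝ≥0∞) :
    ∫⁻ x, f |x| = 2 * ∫⁻ x in Set.Ioi 0, f x := by
  have h1 : ∫⁻ x in Set.Ioi 0, f |x| = ∫⁻ x in Set.Ioi 0, f x :=
    setLIntegral_congr_fun measurableSet_Ioi fun x hx => by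
      rw [abs_of_pos (show (0 : ℝ) < x from hx)]
  have h2 : ∫⁻ x in (Set.Ioi (0 : ℝ))ᶜ, f |x| = ∫⁻ x in Set.Ioi 0, f |x| := by
    rw [Set.compl_Ioi, setLIntegral_congr Iio_ae_eq_Iic.symm,
      ← lintegral_indicator measurableSet_Iio, ← lintegral_indicator measurableSet_Ioi,
      ← lintegral_neg_eq_self]
    refine lintegral_congr fun x => ?_
    by_cases hx : 0 < x
    · rw [Set.indicator_of_mem (show -x ∈ Set.Iio (0 : ℝ) from neg_lt_zero.2 hx),
        Set.indicator_of_mem (show x ∈ Set.Ioi (0 : ℝ) from hx), abs_neg]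
    · rw [Set.indicator_of_notMem (show -x ∉ Set.Iio (0 : ℝ) from fun h => hx (neg_lt_zero.1 h)),
        Set.indicator_of_notMem (show x ∉ Set.Ioi (0 : ℝ) from hx)]
  rw [← lintegral_add_compl _ (measurableSet_Ioi (a := (0 : ℝ))), h2, h1, two_mul]

theorem setLIntegral_ofReal_ne_top {f : ℝ → ℝ} {s : Set ℝ} (h : IntegrableOn f s) :
    ∫⁻ x in s, ENNReal.ofReal (f x) ≠ ⊤ :=
  ne_top_of_le_ne_top h.2.ne (lintegral_mono fun x => by
    rw [← ofReal_norm]; exact ENNReal.ofReal_le_ofReal (le_abs_self _))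

/-- The profile `min(|x|^{-r}, |x|^{-N})`. -/
noncomputable def cutPow (r N x : ℝ) : ℝ≥0∞ := ENNReal.ofReal (min (|x| ^ (-r)) (|x| ^ (-N)))

/-- The one-dimensional weight `(1 + |x|)^ℓ`. -/
noncomputable def lineWeight (ℓ x : ℝ) : ℝ≥0∞ := ENNReal.ofReal ((1 + |x|) ^ ℓ)

@[fun_prop]
theorem measurable_cutPow (r N : ℝ) : Measurable (cutPow r N) := by unfold cutPow; fun_prop

@[fun_prop]
theorem measurable_lineWeight (ℓ : ℝ) : Measurable (lineWeight ℓ) := by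
  unfold lineWeight; fun_prop

/-- The condition `r s < 1` is integrability at the origin, where `|x|^(-r)` is used; `(N - ℓ) s >
1` is integrability at infinity, where `|x|^(-N)` is used and `1 + |x| ≤ 2|x|`. -/
theorem lintegral_lineWeight_mul_cutPow_ne_top {ℓ r N s : ℝ} (hℓ : 0 ≤ ℓ) (hs : 0 < s)
    (hr : r * s < 1) (hN : 1 < (N - ℓ) * s) :
    ∫⁻ x, (lineWeight ℓ x * cutPow r N x) ^ s ≠ ⊤ := by
  have habs : (fun x => (lineWeight ℓ x * cutPow r N x) ^ s) =
      fun x => (fun t => (lineWeight ℓ t * cutPow r N t) ^ s) |x| := by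
    ext x; simp [lineWeight, cutPow]
  rw [habs, lintegral_comp_abs fun t => (lineWeight ℓ t * cutPow r N t) ^ s, ← Set.Ioc_union_Ioi_eq_Ioi (zero_le_one' ℝ),
    lintegral_union measurableSet_Ioi Set.Ioc_disjoint_Ioi_same]
  have hform : ∀ t : ℝ, 0 < t → (lineWeight ℓ t * cutPow r N t) ^ s =
      ENNReal.ofReal (((1 + t) ^ ℓ * min (t ^ (-r)) (t ^ (-N))) ^ s) := by
    intro t ht
    rw [lineWeight, cutPow, abs_of_pos ht, ← ENNReal.ofReal_mul (by positivity),
      ENNReal.ofReal_rpow_of_nonneg (by positivity) hs.le]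
  refine ENNReal.mul_ne_top (by simp) (ENNReal.add_ne_top.2 ⟨?_, ?_⟩)
  · have hi : IntegrableOn (fun t : ℝ => (2 ^ ℓ) ^ s * t ^ (-r * s)) (Set.Ioc 0 1) := by
      have h := intervalIntegral.intervalIntegrable_rpow' (r := -r * s) (by linarith)
        (a := 0) (b := 1)
      exact ((intervalIntegrable_iff_integrableOn_Ioc_of_le zero_le_one).1 h).const_mul _
    refine ne_top_of_le_ne_top (setLIntegral_ofReal_ne_top hi)
      (setLIntegral_mono' measurableSet_Ioc fun t ht => ?_)
    rw [hform t ht.1]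
    refine ENNReal.ofReal_le_ofReal ?_
    have h0 := ht.1
    rw [Real.rpow_mul h0.le, ← Real.mul_rpow (by positivity) (by positivity)]
    gcongr
    · linarith [ht.2]
    · exact min_le_left _ _
  · have hi : IntegrableOn (fun t : ℝ => (2 ^ ℓ) ^ s * t ^ ((ℓ - N) * s)) (Set.Ioi 1) :=
      (integrableOn_Ioi_rpow_of_lt (by linarith) one_pos).const_mul _
    refine ne_top_of_le_ne_top (setLIntegral_ofReal_ne_top hi)
      (setLIntegral_mono' measurableSet_Ioi fun t ht => ?_)
    have h1 : 1 < t := ht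
    have h0 : 0 < t := by linarith
    rw [hform t h0]
    refine ENNReal.ofReal_le_ofReal ?_
    rw [Real.rpow_mul h0.le, ← Real.mul_rpow (by positivity) (by positivity), sub_eq_add_neg,
      Real.rpow_add h0, ← mul_assoc, ← Real.mul_rpow (by positivity) h0.le]
    gcongr
    · linarith
    · exact min_le_right _ _

/-- The weight `(1 + |x|)^ℓ (1 + |y|)^ϱ`. -/
noncomputable def planeWeight (ℓ ϱ : ℝ) (z : Plane) : ℝ≥0∞ :=
  lineWeight ℓ (z 0) * lineWeight ϱ (z 1)

/-- The product majorant `min(|x|^{-r}, |x|^{-2}) min(|y|^{-r}, |y|^{-M})`. -/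
noncomputable def planeCutPow (r M : ℝ) (z : Plane) : ℝ≥0∞ :=
  cutPow r 2 (z 0) * cutPow r M (z 1)

@[fun_prop]
theorem measurable_planeWeight (ℓ ϱ : ℝ) : Measurable (planeWeight ℓ ϱ) := by
  unfold planeWeight; fun_prop

@[fun_prop]
theorem measurable_planeCutPow (r M : ℝ) : Measurable (planeCutPow r M) := by
  unfold planeCutPow; fun_prop

theorem one_le_lineWeight {ℓ : ℝ} (hℓ : 0 ≤ ℓ) (x : ℝ) : 1 ≤ lineWeight ℓ x := by
  rw [lineWeight, ENNReal.one_le_ofReal]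
  exact Real.one_le_rpow (by linarith [abs_nonneg x]) hℓ

theorem one_le_planeWeight {ℓ ϱ : ℝ} (hℓ : 0 ≤ ℓ) (hϱ : 0 ≤ ϱ) (z : Plane) :
    1 ≤ planeWeight ℓ ϱ z :=
  one_le_mul (one_le_lineWeight hℓ _) (one_le_lineWeight hϱ _)

theorem planeWeight_ne_top (ℓ ϱ : ℝ) (z : Plane) : planeWeight ℓ ϱ z ≠ ⊤ :=
  ENNReal.mul_ne_top ENNReal.ofReal_ne_top ENNReal.ofReal_ne_top

/-- This rests on `1 + |x| ≤ (1 + |x - y|)(1 + |y|)`. -/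
theorem lineWeight_le_mul {ℓ : ℝ} (hℓ : 0 ≤ ℓ) (x y : ℝ) :
    lineWeight ℓ x ≤ lineWeight ℓ (x - y) * lineWeight ℓ y := by
  rw [lineWeight, lineWeight, lineWeight, ← ENNReal.ofReal_mul (by positivity),
    ← Real.mul_rpow (by positivity) (by positivity)]
  refine ENNReal.ofReal_le_ofReal (Real.rpow_le_rpow (by positivity) ?_ hℓ)
  have h : |x| ≤ |x - y| + |y| := by simpa using abs_add_le (x - y) y
  nlinarith [abs_nonneg (x - y), abs_nonneg y]

theorem planeWeight_le_mul {ℓ ϱ : ℝ} (hℓ : 0 ≤ ℓ) (hϱ : 0 ≤ ϱ) (z z' : Plane) :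
    planeWeight ℓ ϱ z ≤ planeWeight ℓ ϱ (z - z') * planeWeight ℓ ϱ z' := by
  calc planeWeight ℓ ϱ z
      ≤ (lineWeight ℓ (z 0 - z' 0) * lineWeight ℓ (z' 0))
        * (lineWeight ϱ (z 1 - z' 1) * lineWeight ϱ (z' 1)) :=
        mul_le_mul' (lineWeight_le_mul hℓ _ _) (lineWeight_le_mul hϱ _ _)
    _ = _ := by simp only [planeWeight, PiLp.sub_apply]; ring

theorem lineWeight_le_of_abs_le {ℓ : ℝ} (hℓ : 0 ≤ ℓ) {x R : ℝ} (h : |x| ≤ R) :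
    lineWeight ℓ x ≤ ENNReal.ofReal ((1 + R) ^ ℓ) :=
  ENNReal.ofReal_le_ofReal (Real.rpow_le_rpow (by positivity) (by linarith) hℓ)

theorem planeWeight_le_of_norm_le {ℓ ϱ : ℝ} (hℓ : 0 ≤ ℓ) (hϱ : 0 ≤ ϱ) {z : Plane} {R : ℝ}
    (h : ‖z‖ ≤ R) :
    planeWeight ℓ ϱ z ≤ ENNReal.ofReal ((1 + R) ^ ℓ) * ENNReal.ofReal ((1 + R) ^ ϱ) :=
  mul_le_mul' (lineWeight_le_of_abs_le hℓ ((PiLp.norm_apply_le z 0).trans h))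
    (lineWeight_le_of_abs_le hϱ ((PiLp.norm_apply_le z 1).trans h))

theorem norm_plane_le (z : Plane) : ‖z‖ ≤ |z 0| + |z 1| := by
  rw [EuclideanSpace.norm_eq, Fin.sum_univ_two, Real.norm_eq_abs, Real.norm_eq_abs]
  refine Real.sqrt_le_iff.2 ⟨by positivity, ?_⟩
  nlinarith [abs_nonneg (z 0), abs_nonneg (z 1)]

/-- Weights and profiles are products, so the integral factors. The exponent 2 in the `x` profile is
the source of `ℓ < 1`: at `s = 1` the condition `hN` reads `ℓ < 1`. -/
theorem lintegral_planeWeight_mul_planeCutPow_ne_top {ℓ ϱ r M s : ℝ} (hℓ : 0 ≤ ℓ) (hϱ : 0 ≤ ϱ)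
    (hs : 0 < s) (hr : r * s < 1) (hN : 1 < (2 - ℓ) * s) (hM : 1 < (M - ϱ) * s) :
    ∫⁻ z, (planeWeight ℓ ϱ z * planeCutPow r M z) ^ s ≠ ⊤ := by
  have h : ∀ z : Plane, (planeWeight ℓ ϱ z * planeCutPow r M z) ^ s =
      (fun x => (lineWeight ℓ x * cutPow r 2 x) ^ s) (z 0) *
        (fun x => (lineWeight ϱ x * cutPow r M x) ^ s) (z 1) := fun z => by
    rw [planeWeight, planeCutPow]
    beta_reduce
    rw [← ENNReal.mul_rpow_of_nonneg _ _ hs.le]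
    congr 1; ring
  rw [lintegral_congr h, lintegral_plane_mul (F := fun x => (lineWeight ℓ x * cutPow r 2 x) ^ s)
    (G := fun x => (lineWeight ϱ x * cutPow r M x) ^ s) (by fun_prop) (by fun_prop)]
  exact ENNReal.mul_ne_top (lintegral_lineWeight_mul_cutPow_ne_top hℓ hs hr hN)
    (lintegral_lineWeight_mul_cutPow_ne_top hϱ hs hr hM)

theorem lintegral_planeWeight_neg_ne_top {a : ℝ} (ha : 1 < a) :
    ∫⁻ z, planeWeight (-a) (-a) z ≠ ⊤ := by
  have h : ∫⁻ x : ℝ, lineWeight (-a) x ≠ ⊤ := by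
    have := finite_integral_one_add_norm (E := ℝ) (μ := volume) (r := a) (by simpa using ha)
    simpa only [lineWeight, Real.norm_eq_abs] using this.ne
  unfold planeWeight
  rw [lintegral_plane_mul (by fun_prop) (by fun_prop)]
  exact ENNReal.mul_ne_top h h

theorem lineWeight_mul_neg (ℓ x : ℝ) : lineWeight ℓ x * lineWeight (-ℓ) x = 1 := by
  rw [lineWeight, lineWeight, ← ENNReal.ofReal_mul (by positivity),
    ← Real.rpow_add (by positivity)]
  simp

theorem lineWeight_rpow (ℓ a x : ℝ) (ha : 0 ≤ a) : lineWeight ℓ x ^ a = lineWeight (ℓ * a) x := by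
  rw [lineWeight, lineWeight, ENNReal.ofReal_rpow_of_nonneg (by positivity) ha,
    ← Real.rpow_mul (by positivity)]

/-! ### Decay for abstract kernels. -/

/-- Decay of subcritical subsolutions of `u = k ⋆ u ^ (p + 1)` for kernels controlled by
product profiles. -/
theorem planeWeight_decay {k u : Plane → ℝ≥0∞} {p : ℝ} (hp : 0 < p) (hp4 : p < 4)
    (hk : Measurable k) (hu : Measurable u) (heven : ∀ z, k (-z) = k z)
    (hmaj : ∀ r M : ℝ, 1 / 3 < r → r < 1 → 2 ≤ M →
      ∃ C : ℝ≥0∞, C ≠ ⊤ ∧ ∀ᵐ z, k z ≤ C * planeCutPow r M z)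
    (huq : ∫⁻ z, u z ^ (3 + 3 * p / 4) ≠ ⊤)
    (hle : ∀ᵐ z, u z ≤ lconv k (fun w => u w ^ (p + 1)) z)
    {ℓ ϱ : ℝ} (hℓ : 0 ≤ ℓ) (hℓ1 : ℓ < 1) (hϱ : 0 ≤ ϱ) :
    (∃ C : ℝ≥0∞, C ≠ ⊤ ∧ ∀ᵐ z, planeWeight ℓ ϱ z * u z ≤ C) ∧
      ∫⁻ z, planeWeight ℓ ϱ z * u z ≠ ⊤ := by
  set q : ℝ := 3 + 3 * p / 4 with hq
  have hpq : p + 1 ≤ q := by linarith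
  have hqp : 3 / 2 < q / p := by rw [lt_div_iff₀ hp]; linarith
  have hs : (q / p).conjExponent.HolderConjugate (q / p) :=
    (Real.HolderConjugate.conjExponent (by linarith)).symm
  set s := (q / p).conjExponent with hsdef
  have hs1 : 1 < s := hs.lt
  -- The bound `q/p > 3/2` means `s < 3`. This leaves room for `r` with `r > 1/3`, as the kernel
  -- bound demands, and `r s < 1`, as local `L^s` integrability demands.
  have hs3 : 1 / 3 < 1 / s := by
    have h1 := hs.inv_add_inv_eq_one
    have h2 : (q / p)⁻¹ < 2 / 3 := by
      rw [inv_lt_comm₀ (by linarith) (by norm_num)]; norm_num; linarith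
    rw [one_div s]; linarith
  obtain ⟨r, hr3, hrs⟩ := exists_between hs3
  have hr1 : r < 1 := hrs.trans ((div_lt_one (by linarith)).2 hs1)
  have hrs' : r * s < 1 := (lt_div_iff₀ (by linarith)).1 hrs
  have hkint : ∀ ℓ ϱ t : ℝ, 0 ≤ ℓ → ℓ < 1 → 0 ≤ ϱ → 1 ≤ t → t ≤ s →
      ∫⁻ z, (planeWeight ℓ ϱ z * k z) ^ t ≠ ⊤ := by
    intro ℓ ϱ t h0 h1 h2 ht hts
    -- With `M = ϱ + 2` the weighted `y` profile still decays like `|y|^(-2)`.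
    obtain ⟨C, hC, hCk⟩ := hmaj r (ϱ + 2) hr3 hr1 (by linarith)
    have hle : ∫⁻ z, (planeWeight ℓ ϱ z * k z) ^ t ≤
        ∫⁻ z, C ^ t * (planeWeight ℓ ϱ z * planeCutPow r (ϱ + 2) z) ^ t := by
      refine lintegral_mono_ae ?_
      filter_upwards [hCk] with z hz
      rw [← ENNReal.mul_rpow_of_nonneg _ _ (by linarith)]
      refine ENNReal.rpow_le_rpow ?_ (by linarith)
      calc planeWeight ℓ ϱ z * k z ≤ planeWeight ℓ ϱ z * (C * planeCutPow r (ϱ + 2) z) := by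
            gcongr
        _ = _ := by ring
    refine ne_top_of_le_ne_top ?_ hle
    rw [lintegral_const_mul _ (by fun_prop)]
    refine ENNReal.mul_ne_top (ENNReal.rpow_ne_top_of_nonneg (by linarith) hC)
      (lintegral_planeWeight_mul_planeCutPow_ne_top h0 h2 (by linarith) ?_ ?_ ?_)
    · nlinarith
    · nlinarith
    · ring_nf; linarith
  have hw0 : ∀ z, planeWeight 0 0 z = 1 := fun z => by simp [planeWeight, lineWeight]
  have hk1 : ∫⁻ z, k z ≠ ⊤ := by
    simpa [hw0] using hkint 0 0 1 le_rfl one_pos le_rfl le_rfl hs1.le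
  have hks : ∫⁻ z, k z ^ s ≠ ⊤ := by
    simpa [hw0] using hkint 0 0 s le_rfl one_pos le_rfl hs1.le le_rfl
  obtain ⟨B, hB, huB⟩ := exists_ae_le_of_le_lconv_rpow hk hu heven hp hpq hs hk1 hks huq hle
  have hsup : ∀ ℓ ϱ : ℝ, 0 ≤ ℓ → ℓ < 1 → 0 ≤ ϱ →
      ∃ C : ℝ≥0∞, C ≠ ⊤ ∧ ∀ᵐ z, planeWeight ℓ ϱ z * u z ≤ C := by
    intro ℓ ϱ h0 h1 h2
    refine exists_ae_weight_mul_le hk hu (measurable_planeWeight ℓ ϱ) hp hpq hs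
      (one_le_planeWeight h0 h2) (planeWeight_ne_top ℓ ϱ) (planeWeight_le_mul h0 h2)
      (fun R => ⟨_, ?_, fun z hz => planeWeight_le_of_norm_le h0 h2 hz⟩)
      (by simpa using hkint ℓ ϱ 1 h0 h1 h2 le_rfl hs1.le)
      (hkint ℓ ϱ s h0 h1 h2 hs1.le le_rfl) huq hB huB hle
    exact ENNReal.mul_ne_top ENNReal.ofReal_ne_top ENNReal.ofReal_ne_top
  refine ⟨hsup ℓ ϱ hℓ hℓ1 hϱ, ?_⟩
  have hu1 : ∫⁻ z, u z ≠ ⊤ := by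
    -- The weight exponent `a = 1/(p/2 + 1)` satisfies `a < 1 < a (p + 1)`: it is admissible for the
    -- supremum bound and strong enough to make `u^(p+1)` integrable. Convolving with the integrable
    -- kernel then gives `u` in `L¹`.
    have ha0 : 0 < 1 / (p / 2 + 1) := by positivity
    have ha1 : 1 / (p / 2 + 1) < 1 := by rw [div_lt_one (by linarith)]; linarith
    have hap : 1 < 1 / (p / 2 + 1) * (p + 1) := by
      rw [one_div_mul_eq_div, one_lt_div (by linarith)]; linarith
    set a := 1 / (p / 2 + 1)
    obtain ⟨C, hC, hCu⟩ := hsup a a ha0.le ha1 ha0.le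
    have h1 : ∫⁻ z, u z ^ (p + 1) ≠ ⊤ := by
      refine ne_top_of_le_ne_top (ENNReal.mul_ne_top
        (ENNReal.rpow_ne_top_of_nonneg (show 0 ≤ p + 1 by linarith) hC)
        (lintegral_planeWeight_neg_ne_top hap)) ?_
      rw [← lintegral_const_mul _ (by fun_prop)]
      refine lintegral_mono_ae ?_
      filter_upwards [hCu] with z hz
      have h2 : u z ≤ C * planeWeight (-a) (-a) z := by
        calc u z = (lineWeight a (z 0) * lineWeight (-a) (z 0)) *
              (lineWeight a (z 1) * lineWeight (-a) (z 1)) * u z := by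
              rw [lineWeight_mul_neg, lineWeight_mul_neg, one_mul, one_mul]
          _ = planeWeight a a z * u z * planeWeight (-a) (-a) z := by
              simp only [planeWeight]; ring
          _ ≤ _ := by gcongr
      calc u z ^ (p + 1) ≤ (C * planeWeight (-a) (-a) z) ^ (p + 1) :=
            ENNReal.rpow_le_rpow h2 (by linarith)
        _ = _ := by
            rw [planeWeight, planeWeight, ENNReal.mul_rpow_of_nonneg _ _ (by linarith),
              ENNReal.mul_rpow_of_nonneg _ _ (by linarith), lineWeight_rpow _ _ _ (by linarith),
              lineWeight_rpow _ _ _ (by linarith), neg_mul]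
    refine ne_top_of_le_ne_top (ENNReal.mul_ne_top hk1 h1) ?_
    rw [← lintegral_lconv hk (by fun_prop)]
    exact lintegral_mono_ae hle
  refine lintegral_weight_mul_ne_top hk hu (measurable_planeWeight ℓ ϱ) hp
      (one_le_planeWeight hℓ hϱ) (planeWeight_ne_top ℓ ϱ) (planeWeight_le_mul hℓ hϱ)
      (by simpa using hkint ℓ ϱ 1 hℓ hℓ1 hϱ le_rfl hs1.le) hu1 hB huB (fun δ hδ => ?_) hle
  -- The square-root weights force `‖z‖ ≤ (C/δ)²` wherever `u > δ`, so superlevel sets are bounded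
  -- up to a null set and any polynomial weight is bounded on them.
  obtain ⟨C, hC, hCu⟩ := hsup (1 / 2) (1 / 2) (by norm_num) (by norm_num) (by norm_num)
  have hCδ : C / δ ≠ ⊤ := ENNReal.div_ne_top hC hδ.ne'
  refine ⟨ENNReal.ofReal ((1 + (C / δ).toReal ^ 2) ^ ℓ) *
    ENNReal.ofReal ((1 + (C / δ).toReal ^ 2) ^ ϱ),
    ENNReal.mul_ne_top ENNReal.ofReal_ne_top ENNReal.ofReal_ne_top, ?_⟩
  · filter_upwards [hCu] with z hz hδz
    refine planeWeight_le_of_norm_le (R := (C / δ).toReal ^ 2) hℓ hϱ ?_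
    have h1 : planeWeight (1 / 2) (1 / 2) z ≤ C / δ := by
      rw [ENNReal.le_div_iff_mul_le (Or.inl hδ.ne') (Or.inr hC)]
      exact le_trans (by gcongr) hz
    have h2 : (1 + |z 0|) ^ (1 / 2 : ℝ) * (1 + |z 1|) ^ (1 / 2 : ℝ) ≤ (C / δ).toReal := by
      rw [planeWeight, lineWeight, lineWeight, ← ENNReal.ofReal_mul (by positivity)] at h1
      exact (ENNReal.ofReal_le_iff_le_toReal hCδ).1 h1
    rw [← Real.mul_rpow (by positivity) (by positivity), ← Real.sqrt_eq_rpow] at h2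
    have h3 := (Real.sqrt_le_iff.1 h2).2
    nlinarith [norm_plane_le z, abs_nonneg (z 0), abs_nonneg (z 1)]

/-! ### The Poisson–Gauss semigroup and its resolvent kernel. -/

/-- The Poisson kernel, the Fourier transform of `exp(-s|ξ|)`. -/
noncomputable def poissonKer (s x : ℝ) : ℝ := 2 * s / (s ^ 2 + (2 * Real.pi * x) ^ 2)

/-- The Gauss kernel, the Fourier transform of `exp(-t (2πξ)²)`. -/
noncomputable def gaussKer (t y : ℝ) : ℝ :=
  (Real.sqrt (4 * Real.pi * t))⁻¹ * Real.exp (-y ^ 2 / (4 * t))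

theorem poissonKer_nonneg {s : ℝ} (hs : 0 ≤ s) (x : ℝ) : 0 ≤ poissonKer s x := by
  unfold poissonKer; positivity

theorem gaussKer_nonneg (t y : ℝ) : 0 ≤ gaussKer t y := by
  unfold gaussKer; positivity

theorem integrable_poissonKer {s : ℝ} (hs : 0 < s) : Integrable (poissonKer s) := by
  have h := (integrable_inv_one_add_sq.comp_mul_left'
    (show 2 * Real.pi / s ≠ 0 by positivity)).const_mul (2 / s)
  refine h.congr (Eventually.of_forall fun x => ?_)
  simp only [poissonKer]
  field_simp

theorem integrable_gaussKer {t : ℝ} (ht : 0 < t) : Integrable (gaussKer t) := by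
  have h := (integrable_exp_neg_mul_sq (show 0 < 1 / (4 * t) by positivity)).const_mul
    (Real.sqrt (4 * Real.pi * t))⁻¹
  refine h.congr (Eventually.of_forall fun x => ?_)
  simp only [gaussKer]
  congr 2
  field_simp

theorem integrable_exp_neg_mul_abs {s : ℝ} (hs : 0 < s) :
    Integrable fun ξ : ℝ => Real.exp (-s * |ξ|) := by
  rw [← integrableOn_univ, ← Set.Iic_union_Ioi (a := (0 : ℝ)), integrableOn_union]
  constructor
  · refine (integrableOn_exp_mul_Iic hs 0).congr_fun (fun x hx => ?_) measurableSet_Iic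
    simp [abs_of_nonpos (show x ≤ 0 from hx)]
  · refine (integrableOn_exp_mul_Ioi (neg_lt_zero.2 hs) 0).congr_fun (fun x hx => ?_)
      measurableSet_Ioi
    simp [abs_of_pos (show 0 < x from hx)]

theorem fourier_exp_neg_mul_abs {s : ℝ} (hs : 0 < s) :
    𝓕 (fun ξ : ℝ => (Real.exp (-s * |ξ|) : ℂ)) = fun x => (poissonKer s x : ℂ) := by
  ext x
  rw [Real.fourier_real_eq_integral_exp_smul]
  have hint : Integrable fun v : ℝ => Complex.exp (↑(-2 * Real.pi * v * x) * Complex.I) •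
      (Real.exp (-s * |v|) : ℂ) := by
    refine ((integrable_exp_neg_mul_abs hs).ofReal (𝕜 := ℂ)).bdd_mul (c := 1) (by fun_prop)
      (Eventually.of_forall fun v => ?_)
    rw [Complex.norm_exp_ofReal_mul_I]
  rw [← integral_add_compl (measurableSet_Iic (a := (0 : ℝ))) hint, Set.compl_Iic]
  have h1 : ∫ v in Set.Iic (0 : ℝ), Complex.exp (↑(-2 * Real.pi * v * x) * Complex.I) •
      (Real.exp (-s * |v|) : ℂ) = 1 / (s - 2 * Real.pi * x * Complex.I) := by
    have h := integral_exp_mul_complex_Iic (a := s - 2 * Real.pi * x * Complex.I)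
      (by simpa using hs) 0
    simp only [Complex.ofReal_zero, mul_zero, Complex.exp_zero] at h
    rw [← h]
    refine setIntegral_congr_fun measurableSet_Iic fun v hv => ?_
    simp only [smul_eq_mul]
    rw [abs_of_nonpos (show v ≤ 0 from hv), Complex.ofReal_exp, ← Complex.exp_add]
    congr 1; push_cast; ring
  have h2 : ∫ v in Set.Ioi (0 : ℝ), Complex.exp (↑(-2 * Real.pi * v * x) * Complex.I) •
      (Real.exp (-s * |v|) : ℂ) = 1 / (s + 2 * Real.pi * x * Complex.I) := by
    have h := integral_exp_mul_complex_Ioi (a := -(s + 2 * Real.pi * x * Complex.I))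
      (by simpa using hs) 0
    simp only [Complex.ofReal_zero, mul_zero, Complex.exp_zero, neg_div_neg_eq] at h
    rw [← h]
    refine setIntegral_congr_fun measurableSet_Ioi fun v hv => ?_
    simp only [smul_eq_mul]
    rw [abs_of_pos (show 0 < v from hv), Complex.ofReal_exp, ← Complex.exp_add]
    congr 1; push_cast; ring
  rw [h1, h2, poissonKer]
  have e1 : (s : ℂ) - 2 * Real.pi * x * Complex.I ≠ 0 := fun h => by
    have := congrArg Complex.re h; simp at this; exact hs.ne' this
  have e2 : (s : ℂ) + 2 * Real.pi * x * Complex.I ≠ 0 := fun h => by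
    have := congrArg Complex.re h; simp at this; exact hs.ne' this
  have e3 : (s : ℂ) ^ 2 + (2 * Real.pi * x) ^ 2 =
      (s - 2 * Real.pi * x * Complex.I) * (s + 2 * Real.pi * x * Complex.I) := by
    ring_nf; rw [Complex.I_sq]; ring
  push_cast
  rw [e3, div_add_div _ _ e1 e2]
  congr 1; ring

/-- Fourier inversion applied to `fourier_exp_neg_mul_abs`; evenness turns the inverse transform
into the transform. -/
theorem fourier_poissonKer {s : ℝ} (hs : 0 < s) :
    𝓕 (fun x : ℝ => (poissonKer s x : ℂ)) = fun ξ => (Real.exp (-s * |ξ|) : ℂ) := by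
  have hc : Continuous fun ξ : ℝ => (Real.exp (-s * |ξ|) : ℂ) := by fun_prop
  have h := hc.fourierInv_fourier_eq ((integrable_exp_neg_mul_abs hs).ofReal (𝕜 := ℂ)) (by
    rw [fourier_exp_neg_mul_abs hs]; exact (integrable_poissonKer hs).ofReal (𝕜 := ℂ))
  rw [fourier_exp_neg_mul_abs hs] at h
  ext ξ
  have h2 := congrFun h (-ξ)
  rw [Real.fourierInv_eq_fourier_neg, neg_neg, abs_neg] at h2
  exact h2

theorem fourier_gaussKer {t : ℝ} (ht : 0 < t) :
    𝓕 (fun y : ℝ => (gaussKer t y : ℂ)) =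
      fun ξ => (Real.exp (-t * (2 * Real.pi * ξ) ^ 2) : ℂ) := by
  have hb : 0 < ((1 / (4 * Real.pi * t) : ℝ) : ℂ).re := by
    rw [Complex.ofReal_re]; positivity
  have h := fourier_gaussian_pi hb
  have hg : (fun y : ℝ => (gaussKer t y : ℂ)) = fun y : ℝ =>
      ((Real.sqrt (4 * Real.pi * t))⁻¹ : ℂ) •
        Complex.exp (-Real.pi * ((1 / (4 * Real.pi * t) : ℝ) : ℂ) * y ^ 2) := by
    ext y
    rw [gaussKer, smul_eq_mul]
    push_cast
    congr 2
    have : (Real.pi : ℂ) ≠ 0 := by exact_mod_cast Real.pi_ne_zero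
    have : (t : ℂ) ≠ 0 := by exact_mod_cast ht.ne'
    field_simp
  have hsq : ((1 / (4 * Real.pi * t) : ℝ) : ℂ) ^ (1 / 2 : ℂ) =
      ((Real.sqrt (4 * Real.pi * t))⁻¹ : ℂ) := by
    rw [show (1 / 2 : ℂ) = ((1 / 2 : ℝ) : ℂ) by push_cast; rfl,
      ← Complex.ofReal_cpow (by positivity), ← Real.sqrt_eq_rpow, one_div, Real.sqrt_inv]
    push_cast; rfl
  ext ξ
  have h3 : 𝓕 (fun y : ℝ => (gaussKer t y : ℂ)) ξ = ((Real.sqrt (4 * Real.pi * t))⁻¹ : ℂ) •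
      𝓕 (fun y : ℝ => Complex.exp (-Real.pi * ((1 / (4 * Real.pi * t) : ℝ) : ℂ) * y ^ 2)) ξ := by
    rw [hg]
    simp only [Real.fourier_eq]
    rw [← integral_smul]
    congr 1; ext v
    rw [smul_comm]
  rw [h3, h, hsq]
  have hne : ((Real.sqrt (4 * Real.pi * t))⁻¹ : ℂ) ≠ 0 := by
    have : Real.sqrt (4 * Real.pi * t) ≠ 0 := by positivity
    exact inv_ne_zero (by exact_mod_cast this)
  beta_reduce
  rw [smul_eq_mul, ← mul_assoc, mul_one_div_cancel hne, one_mul]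
  push_cast
  congr 1
  have : (Real.pi : ℂ) ≠ 0 := by exact_mod_cast Real.pi_ne_zero
  have : (t : ℂ) ≠ 0 := by exact_mod_cast ht.ne'
  field_simp
  ring

theorem fourier_plane_mul (F G : ℝ → ℂ) (ξ : Plane) :
    𝓕 (fun z : Plane => F (z 0) * G (z 1)) ξ = 𝓕 F (ξ 0) * 𝓕 G (ξ 1) := by
  rw [Real.fourier_eq', Real.fourier_real_eq_integral_exp_smul,
    Real.fourier_real_eq_integral_exp_smul, ← integral_plane_mul]
  congr 1; ext z
  have : inner ℝ z ξ = z 0 * ξ 0 + z 1 * ξ 1 := by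
    rw [PiLp.inner_apply, Fin.sum_univ_two]; simp [mul_comm]
  rw [this]
  simp only [smul_eq_mul]
  rw [show ((-2 * Real.pi * (z 0 * ξ 0 + z 1 * ξ 1) : ℝ) : ℂ) * Complex.I =
    ((-2 * Real.pi * z 0 * ξ 0 : ℝ) : ℂ) * Complex.I
      + ((-2 * Real.pi * z 1 * ξ 1 : ℝ) : ℂ) * Complex.I by push_cast; ring, Complex.exp_add]
  ring

/-- The kernel of the semigroup with symbol `exp(-t (b|ξ₁| + (2πξ₂)²))`. -/
noncomputable def heatKer (b t : ℝ) (z : Plane) : ℝ := poissonKer (t * b) (z 0) * gaussKer t (z 1)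

theorem heatKer_nonneg {b t : ℝ} (hb : 0 ≤ b) (ht : 0 ≤ t) (z : Plane) : 0 ≤ heatKer b t z :=
  mul_nonneg (poissonKer_nonneg (by positivity) _) (gaussKer_nonneg _ _)

theorem heatKer_neg (b t : ℝ) (z : Plane) : heatKer b t (-z) = heatKer b t z := by
  simp [heatKer, poissonKer, gaussKer]

@[fun_prop]
theorem measurable_heatKer (b : ℝ) : Measurable fun q : Plane × ℝ => heatKer b q.2 q.1 := by
  unfold heatKer poissonKer gaussKer; fun_prop

theorem integrable_heatKer {b t : ℝ} (hb : 0 < b) (ht : 0 < t) : Integrable (heatKer b t) := by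
  have h := integrable_plane_mul ((integrable_poissonKer (mul_pos ht hb)).ofReal (𝕜 := ℂ))
    ((integrable_gaussKer ht).ofReal (𝕜 := ℂ))
  refine h.re.congr (Eventually.of_forall fun z => ?_)
  simp [heatKer]

theorem fourier_heatKer {b t : ℝ} (hb : 0 < b) (ht : 0 < t) (ξ : Plane) :
    𝓕 (fun z => (heatKer b t z : ℂ)) ξ =
      (Real.exp (-t * (b * |ξ 0| + (2 * Real.pi * ξ 1) ^ 2)) : ℂ) := by
  have h := fourier_plane_mul (fun x => (poissonKer (t * b) x : ℂ)) (fun y => (gaussKer t y : ℂ)) ξ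
  rw [fourier_poissonKer (mul_pos ht hb), fourier_gaussKer ht] at h
  rw [show (fun z : Plane => (heatKer b t z : ℂ)) = fun z : Plane =>
    (poissonKer (t * b) (z 0) : ℂ) * (gaussKer t (z 1) : ℂ) by ext z; simp [heatKer], h,
    ← Complex.ofReal_mul, ← Real.exp_add]
  congr 2; ring

/-- The integral is the Fourier transform at `ξ = 0`. -/
theorem integral_heatKer {b t : ℝ} (hb : 0 < b) (ht : 0 < t) : ∫ z, heatKer b t z = 1 := by
  have h := fourier_heatKer hb ht 0
  rw [Real.fourier_eq'] at h
  simp only [inner_zero_right, mul_zero, Complex.ofReal_zero, zero_mul, Complex.exp_zero,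
    one_smul, PiLp.zero_apply, abs_zero] at h
  rw [integral_complex_ofReal] at h
  simpa using h

/-- The resolvent kernel `∫₀^∞ exp(-c t) p_t dt`, whose Fourier transform is
`1 / (c + b|ξ₁| + (2πξ₂)²)`. -/
noncomputable def resolventKer (c b : ℝ) (z : Plane) : ℝ :=
  ∫ t in Set.Ioi 0, Real.exp (-c * t) * heatKer b t z

/-- The resolvent kernel as a lower integral. -/
noncomputable def lresolventKer (c b : ℝ) (z : Plane) : ℝ≥0∞ :=
  ∫⁻ t in Set.Ioi 0, ENNReal.ofReal (Real.exp (-c * t) * heatKer b t z)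

theorem measurable_lresolventKer (c b : ℝ) : Measurable (lresolventKer c b) := by
  unfold lresolventKer
  exact Measurable.lintegral_prod_right'
    (f := fun q : Plane × ℝ => ENNReal.ofReal (Real.exp (-c * q.2) * heatKer b q.2 q.1))
    (by fun_prop)

theorem lresolventKer_neg (c b : ℝ) (z : Plane) : lresolventKer c b (-z) = lresolventKer c b z := by
  simp [lresolventKer, heatKer_neg]

/-- An inequality, because at a point where the `t`-integral diverges the Bochner integral takes the
default value 0 while the lower integral is `⊤`. -/
theorem enorm_resolventKer_le {b : ℝ} (hb : 0 ≤ b) (c : ℝ) (z : Plane) :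
    ‖resolventKer c b z‖ₑ ≤ lresolventKer c b z := by
  refine (enorm_integral_le_lintegral_enorm _).trans (le_of_eq ?_)
  refine setLIntegral_congr_fun measurableSet_Ioi fun t ht => ?_
  exact Real.enorm_of_nonneg (mul_nonneg (Real.exp_nonneg _) (heatKer_nonneg hb (le_of_lt ht) z))

theorem integrable_exp_mul_heatKer {c b : ℝ} (hc : 0 < c) (hb : 0 < b) :
    Integrable (fun q : Plane × ℝ => Real.exp (-c * q.2) * heatKer b q.2 q.1)
      (volume.prod (volume.restrict (Set.Ioi 0))) := by
  have hm : Measurable fun q : Plane × ℝ => Real.exp (-c * q.2) * heatKer b q.2 q.1 := by fun_prop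
  rw [integrable_prod_iff' hm.aestronglyMeasurable]
  constructor
  · filter_upwards [ae_restrict_mem measurableSet_Ioi] with t ht
    exact (integrable_heatKer hb ht).const_mul _
  · refine (integrableOn_exp_mul_Ioi (neg_lt_zero.2 hc) 0).congr_fun (fun t ht => ?_)
      measurableSet_Ioi
    have h : ∀ z, ‖Real.exp (-c * t) * heatKer b t z‖ = Real.exp (-c * t) * heatKer b t z :=
      fun z => Real.norm_of_nonneg
        (mul_nonneg (Real.exp_nonneg _) (heatKer_nonneg hb.le (le_of_lt ht) z))
    simp_rw [h]
    rw [integral_const_mul, integral_heatKer hb ht, mul_one]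

theorem integrable_resolventKer {c b : ℝ} (hc : 0 < c) (hb : 0 < b) :
    Integrable (resolventKer c b) :=
  (integrable_exp_mul_heatKer hc hb).integral_prod_left

/-- The symbol `c + b|ξ₁| + (2πξ₂)²`. -/
noncomputable def resolventSymbol (c b : ℝ) (ξ : Plane) : ℝ :=
  c + b * |ξ 0| + (2 * Real.pi * ξ 1) ^ 2

theorem resolventSymbol_pos {c b : ℝ} (hc : 0 < c) (hb : 0 ≤ b) (ξ : Plane) :
    0 < resolventSymbol c b ξ := by unfold resolventSymbol; positivity

/-- Fubini exchanges the transform with the `t`-integral, and `∫₀^∞ e^{-σt} dt = 1/σ`. -/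
theorem fourier_resolventKer {c b : ℝ} (hc : 0 < c) (hb : 0 < b) (ξ : Plane) :
    𝓕 (fun z => (resolventKer c b z : ℂ)) ξ = ((resolventSymbol c b ξ)⁻¹ : ℝ) := by
  have hI := (integrable_exp_mul_heatKer hc hb).ofReal (𝕜 := ℂ)
  have hI2 : Integrable (fun q : Plane × ℝ =>
      Complex.exp (↑(-2 * Real.pi * inner ℝ q.1 ξ) * Complex.I) •
        (((Real.exp (-c * q.2) * heatKer b q.2 q.1 : ℝ)) : ℂ))
      (volume.prod (volume.restrict (Set.Ioi 0))) := by
    refine hI.bdd_mul (c := 1) (by fun_prop) (Eventually.of_forall fun v => ?_)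
    rw [Complex.norm_exp_ofReal_mul_I]
  rw [Real.fourier_eq']
  have h1 : ∀ z : Plane, Complex.exp (↑(-2 * Real.pi * inner ℝ z ξ) * Complex.I) •
      (resolventKer c b z : ℂ) = ∫ t in Set.Ioi 0,
      Complex.exp (↑(-2 * Real.pi * inner ℝ z ξ) * Complex.I) •
        ((Real.exp (-c * t) * heatKer b t z : ℝ) : ℂ) := fun z => by
    rw [integral_smul, resolventKer, ← integral_complex_ofReal]
  simp_rw [h1]
  rw [integral_integral_swap hI2]
  have h2 : ∀ t ∈ Set.Ioi (0 : ℝ), (∫ z : Plane,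
      Complex.exp (↑(-2 * Real.pi * inner ℝ z ξ) * Complex.I) •
        ((Real.exp (-c * t) * heatKer b t z : ℝ) : ℂ)) =
      ((Real.exp (-resolventSymbol c b ξ * t) : ℝ) : ℂ) := by
    intro t ht
    have h3 := fourier_heatKer hb ht ξ
    rw [Real.fourier_eq'] at h3
    have h4 : ∀ z : Plane, Complex.exp (↑(-2 * Real.pi * inner ℝ z ξ) * Complex.I) •
        ((Real.exp (-c * t) * heatKer b t z : ℝ) : ℂ) = ((Real.exp (-c * t) : ℝ) : ℂ) *
        (Complex.exp (↑(-2 * Real.pi * inner ℝ z ξ) * Complex.I) • (heatKer b t z : ℂ)) := by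
      intro z; push_cast; simp only [smul_eq_mul]; ring
    simp_rw [h4]
    rw [integral_const_mul, h3, ← Complex.ofReal_mul, ← Real.exp_add]
    congr 2; simp only [resolventSymbol]; ring
  rw [setIntegral_congr_fun measurableSet_Ioi h2, integral_complex_ofReal,
    integral_exp_mul_Ioi (neg_lt_zero.2 (resolventSymbol_pos hc hb.le ξ))]
  simp [neg_div_neg_eq]

/-! ### Pointwise bounds on the resolvent kernel. -/

/-- The denominator dominates `max(s, |x|)²`, hence `s^(2-β) |x|^β`; this needs both exponents
nonnegative. -/
theorem poissonKer_le_rpow {s β x : ℝ} (hs : 0 < s) (hx : x ≠ 0) (hβ : 0 ≤ β) (hβ2 : β ≤ 2) :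
    poissonKer s x ≤ 2 * s ^ (β - 1) * |x| ^ (-β) := by
  have hx' : 0 < |x| := abs_pos.2 hx
  have hm : s ^ (2 - β) * |x| ^ β ≤ s ^ 2 + (2 * Real.pi * x) ^ 2 := by
    have hm0 : 0 < max s |x| := lt_max_of_lt_left hs
    calc s ^ (2 - β) * |x| ^ β ≤ max s |x| ^ (2 - β) * max s |x| ^ β := by
          gcongr
          · exact le_max_left _ _
          · exact le_max_right _ _
      _ = max s |x| ^ 2 := by
          rw [← Real.rpow_add hm0]; norm_num
      _ ≤ s ^ 2 + |x| ^ 2 := by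
          rcases le_total s |x| with h | h
          · rw [max_eq_right h]; nlinarith [sq_nonneg s]
          · rw [max_eq_left h]; nlinarith [sq_nonneg |x|]
      _ ≤ _ := by
          rw [sq_abs, mul_pow]
          have : 1 ≤ (2 * Real.pi) ^ 2 := by nlinarith [Real.pi_gt_three]
          nlinarith [sq_nonneg x]
  rw [poissonKer, div_le_iff₀ (by positivity)]
  calc 2 * s = 2 * s ^ (β - 1) * |x| ^ (-β) * (s ^ (2 - β) * |x| ^ β) := by
        have h1 : s ^ (β - 1) * s ^ (2 - β) = s := by
          rw [← Real.rpow_add hs]; ring_nf; exact Real.rpow_one s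
        have h2 : |x| ^ (-β) * |x| ^ β = 1 := by rw [← Real.rpow_add hx']; simp
        calc 2 * s = 2 * (s ^ (β - 1) * s ^ (2 - β)) * (|x| ^ (-β) * |x| ^ β) := by
              rw [h1, h2, mul_one]
          _ = _ := by ring
    _ ≤ _ := by gcongr

theorem exp_neg_le_rpow {N u : ℝ} (hN : 0 < N) (hu : 0 < u) :
    Real.exp (-u) ≤ N ^ N * u ^ (-N) := by
  have h : (u / N) ^ N ≤ Real.exp u := by
    calc (u / N) ^ N ≤ Real.exp (u / N) ^ N := by
          gcongr
          linarith [Real.add_one_le_exp (u / N)]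
      _ = Real.exp u := by rw [← Real.exp_mul, div_mul_cancel₀ _ hN.ne']
  rw [Real.exp_neg, Real.rpow_neg hu.le, ← div_eq_mul_inv, inv_le_comm₀ (Real.exp_pos _)
    (by positivity), inv_div, ← Real.div_rpow hu.le hN.le]
  exact h

theorem gaussKer_le_rpow {t γ y : ℝ} (ht : 0 < t) (hy : y ≠ 0) (hγ : 0 < γ) :
    gaussKer t y ≤ ((γ / 2) ^ (γ / 2) * 4 ^ (γ / 2)) * t ^ (γ / 2 - 1 / 2) * |y| ^ (-γ) := by
  have hy' : 0 < |y| := abs_pos.2 hy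
  have h1 : (Real.sqrt (4 * Real.pi * t))⁻¹ ≤ t ^ (-(1 / 2) : ℝ) := by
    rw [Real.rpow_neg ht.le, ← Real.sqrt_eq_rpow]
    refine inv_anti₀ (Real.sqrt_pos.2 ht) (Real.sqrt_le_sqrt ?_)
    nlinarith [Real.pi_gt_three]
  have h2 := exp_neg_le_rpow (half_pos hγ) (show 0 < |y| ^ 2 / (4 * t) by positivity)
  have h3 : (|y| ^ 2 / (4 * t)) ^ (-(γ / 2)) = 4 ^ (γ / 2) * t ^ (γ / 2) * |y| ^ (-γ) := by
    rw [Real.rpow_neg (by positivity), ← Real.inv_rpow (by positivity), inv_div,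
      Real.div_rpow (by positivity) (by positivity), Real.mul_rpow (by norm_num) ht.le,
      div_eq_mul_inv, ← Real.rpow_natCast, ← Real.rpow_mul hy'.le, ← Real.rpow_neg hy'.le]
    congr 2; push_cast; ring
  rw [gaussKer, ← sq_abs, neg_div]
  calc _ ≤ t ^ (-(1 / 2) : ℝ) * ((γ / 2) ^ (γ / 2) * (|y| ^ 2 / (4 * t)) ^ (-(γ / 2))) := by
        gcongr
    _ = (γ / 2) ^ (γ / 2) * 4 ^ (γ / 2) * (t ^ (γ / 2) * t ^ (-(1 / 2) : ℝ)) * |y| ^ (-γ) := by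
        rw [h3]; ring
    _ = _ := by rw [← Real.rpow_add ht, ← sub_eq_add_neg]

/-- Power bounds for the resolvent kernel. -/
theorem exists_lresolventKer_le_rpow {c b β γ : ℝ} (hc : 0 < c) (hb : 0 < b) (hβ : 0 ≤ β)
    (hβ2 : β ≤ 2) (hγ : 0 < γ) (hβγ : 1 < 2 * β + γ) :
    ∃ C : ℝ≥0∞, C ≠ ⊤ ∧ ∀ z : Plane, z 0 ≠ 0 → z 1 ≠ 0 →
      lresolventKer c b z ≤ C * (ENNReal.ofReal (|z 0| ^ (-β)) * ENNReal.ofReal (|z 1| ^ (-γ))) := by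
  set A : ℝ := 2 * b ^ (β - 1) * ((γ / 2) ^ (γ / 2) * 4 ^ (γ / 2))
  -- The Poisson bound contributes `t^(β-1)` and the Gauss bound `t^(γ/2-1/2)`. Integrability at `t
  -- = 0` is `2β + γ > 1`; the factor `e^{-ct}` handles infinity.
  have hi : IntegrableOn (fun t : ℝ => A * (t ^ (β + γ / 2 - 3 / 2) * Real.exp (-c * t ^ (1 : ℝ))))
      (Set.Ioi 0) :=
    (integrableOn_rpow_mul_exp_neg_mul_rpow (by linarith) one_pos hc).const_mul _
  refine ⟨_, setLIntegral_ofReal_ne_top hi, fun z h0 h1 => ?_⟩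
  rw [← lintegral_mul_const' _ _ (ENNReal.mul_ne_top ENNReal.ofReal_ne_top ENNReal.ofReal_ne_top),
    lresolventKer]
  refine setLIntegral_mono' measurableSet_Ioi fun t ht => ?_
  have ht0 : 0 < t := ht
  rw [← ENNReal.ofReal_mul (by positivity), ← ENNReal.ofReal_mul (by positivity)]
  refine ENNReal.ofReal_le_ofReal ?_
  have e1 := poissonKer_le_rpow (mul_pos ht0 hb) h0 hβ hβ2
  have e2 := gaussKer_le_rpow ht0 h1 hγ
  have e3 : t ^ (β - 1) * t ^ (γ / 2 - 1 / 2) = t ^ (β + γ / 2 - 3 / 2) := by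
    rw [← Real.rpow_add ht0]; congr 1; ring
  calc Real.exp (-c * t) * heatKer b t z
      ≤ Real.exp (-c * t) * ((2 * (t * b) ^ (β - 1) * |z 0| ^ (-β)) *
        (((γ / 2) ^ (γ / 2) * 4 ^ (γ / 2)) * t ^ (γ / 2 - 1 / 2) * |z 1| ^ (-γ))) := by
        rw [heatKer]
        gcongr
        exact gaussKer_nonneg _ _
    _ = _ := by
        rw [Real.rpow_one, ← e3, Real.mul_rpow ht0.le hb.le]
        ring

/-- The axes must be excluded: the convention `0 ^ (-r) = 0` for `r ≠ 0` makes the power profiles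
vanish there. -/
theorem ae_plane_ne_zero : ∀ᵐ z : Plane, z 0 ≠ 0 ∧ z 1 ≠ 0 := by
  have hq := measurePreserving_plane_coords.quasiMeasurePreserving
  have h0 : ∀ᵐ x : ℝ, x ≠ 0 := Measure.ae_ne volume 0
  filter_upwards [hq.ae (Measure.quasiMeasurePreserving_fst.ae h0),
    hq.ae (Measure.quasiMeasurePreserving_snd.ae h0)] with z h h' using ⟨h, h'⟩

/-- Each minimum selects one exponent, so the four bounds with `β` in `{r, 2}` and `γ` in `{r, M}`
suffice. The most restrictive pair is `(r, r)`, which needs `3r > 1`. -/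
theorem exists_lresolventKer_le_planeCutPow {c b r M : ℝ} (hc : 0 < c) (hb : 0 < b)
    (hr : 1 / 3 < r) (hr1 : r < 1) (hM : 2 ≤ M) :
    ∃ C : ℝ≥0∞, C ≠ ⊤ ∧ ∀ᵐ z, lresolventKer c b z ≤ C * planeCutPow r M z := by
  obtain ⟨C1, h1, H1⟩ := exists_lresolventKer_le_rpow (c := c) (b := b) (β := r) (γ := r) hc hb
    (by linarith) (by linarith) (by linarith) (by linarith)
  obtain ⟨C2, h2, H2⟩ := exists_lresolventKer_le_rpow (c := c) (b := b) (β := r) (γ := M) hc hb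
    (by linarith) (by linarith) (by linarith) (by linarith)
  obtain ⟨C3, h3, H3⟩ := exists_lresolventKer_le_rpow (c := c) (b := b) (β := 2) (γ := r) hc hb
    (by linarith) (by linarith) (by linarith) (by linarith)
  obtain ⟨C4, h4, H4⟩ := exists_lresolventKer_le_rpow (c := c) (b := b) (β := 2) (γ := M) hc hb
    (by linarith) (by linarith) (by linarith) (by linarith)
  refine ⟨C1 + C2 + C3 + C4, by simp [h1, h2, h3, h4], ?_⟩
  filter_upwards [ae_plane_ne_zero] with z hz
  have hC1 : C1 ≤ C1 + C2 + C3 + C4 := by rw [add_assoc, add_assoc]; exact le_self_add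
  have hC2 : C2 ≤ C1 + C2 + C3 + C4 := by
    rw [add_assoc C1, add_assoc C1, add_assoc C2]; exact le_add_left le_self_add
  have hC3 : C3 ≤ C1 + C2 + C3 + C4 := by rw [add_assoc (C1 + C2)]; exact le_add_left le_self_add
  have hC4 : C4 ≤ C1 + C2 + C3 + C4 := le_add_self
  rw [planeCutPow, cutPow, cutPow]
  rcases min_choice (|z 0| ^ (-r)) (|z 0| ^ (-2 : ℝ)) with h | h <;>
    rcases min_choice (|z 1| ^ (-r)) (|z 1| ^ (-M)) with h' | h' <;> rw [h, h']
  · exact (H1 z hz.1 hz.2).trans (by gcongr)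
  · exact (H2 z hz.1 hz.2).trans (by gcongr)
  · exact (H3 z hz.1 hz.2).trans (by gcongr)
  · exact (H4 z hz.1 hz.2).trans (by gcongr)

/-! ### The operator `ℋ∂ₓ` as a singular integral of second differences. -/

/-- The unit vector in the direction `x`. -/
noncomputable abbrev unitX : Plane := EuclideanSpace.single 0 1

/-- The symmetric second difference `2 f(z) - f(z + s e₁) - f(z - s e₁)`. -/
noncomputable def secondDiffX (f : Plane → ℝ) (z : Plane) (s : ℝ) : ℝ :=
  2 * f z - f (z + s • unitX) - f (z - s • unitX)

/-- The operator `|D_x|` as a singular integral of second differences. -/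
noncomputable def absDerivX (f : Plane → ℝ) (z : Plane) : ℝ :=
  Real.pi⁻¹ * ∫ s in Set.Ioi 0, secondDiffX f z s / s ^ 2

theorem secondDiffX_comp_sub (f : Plane → ℝ) (w z : Plane) (s : ℝ) :
    secondDiffX (fun z => f (z - w)) z s = secondDiffX f (z - w) s := by
  simp only [secondDiffX]
  rw [show z + s • unitX - w = z - w + s • unitX by abel,
    show z - s • unitX - w = z - w - s • unitX by abel]

theorem absDerivX_comp_sub (f : Plane → ℝ) (w z : Plane) :
    absDerivX (fun z => f (z - w)) z = absDerivX f (z - w) := by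
  simp only [absDerivX, secondDiffX_comp_sub]

theorem partialY_comp_sub (f : Plane → ℝ) (w z : Plane) :
    partialY (fun z => f (z - w)) z = partialY f (z - w) := by
  simp only [partialY, fderiv_comp_sub]

theorem IsTestFun.comp_sub {f : Plane → ℝ} (hf : IsTestFun f) (w : Plane) :
    IsTestFun fun z => f (z - w) :=
  ⟨hf.1.comp (contDiff_id.sub contDiff_const),
    hf.2.comp_homeomorph (Homeomorph.subRight w)⟩

theorem IsTestFun.partialX {f : Plane → ℝ} (hf : IsTestFun f) : IsTestFun (partialX f) :=
  ⟨(hf.1.fderiv_right (m := ∞) (by simp)).clm_apply contDiff_const, hf.2.fderiv_apply ℝ _⟩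

theorem IsTestFun.partialY {f : Plane → ℝ} (hf : IsTestFun f) : IsTestFun (partialY f) :=
  ⟨(hf.1.fderiv_right (m := ∞) (by simp)).clm_apply contDiff_const, hf.2.fderiv_apply ℝ _⟩

theorem IsTestFun.continuous {f : Plane → ℝ} (hf : IsTestFun f) : Continuous f := hf.1.continuous

theorem IsTestFun.integrable {f : Plane → ℝ} (hf : IsTestFun f) : Integrable f :=
  hf.continuous.integrable_of_hasCompactSupport hf.2

theorem IsTestFun.exists_bound {f : Plane → ℝ} (hf : IsTestFun f) : ∃ C, ∀ z, |f z| ≤ C :=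
  hf.2.exists_bound_of_continuous hf.continuous

theorem IsTestFun.hasDerivAt_add {f : Plane → ℝ} (hf : IsTestFun f) (z : Plane) (s : ℝ) :
    HasDerivAt (fun s : ℝ => f (z + s • unitX)) (_root_.partialX f (z + s • unitX)) s := by
  have h1 : HasDerivAt (fun s : ℝ => z + s • unitX) unitX s := by
    simpa using ((hasDerivAt_id s).smul_const unitX).const_add z
  exact ((hf.1.differentiable (by simp)) (z + s • unitX)).hasFDerivAt.comp_hasDerivAt s h1

theorem IsTestFun.hasDerivAt_sub {f : Plane → ℝ} (hf : IsTestFun f) (z : Plane) (s : ℝ) :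
    HasDerivAt (fun s : ℝ => f (z - s • unitX)) (-_root_.partialX f (z - s • unitX)) s := by
  have h1 : HasDerivAt (fun s : ℝ => z - s • unitX) (-unitX) s := by
    simpa using ((hasDerivAt_id s).smul_const unitX).const_sub z
  have := ((hf.1.differentiable (by simp)) (z - s • unitX)).hasFDerivAt.comp_hasDerivAt s h1
  refine this.congr_deriv ?_
  rw [map_neg]; rfl

theorem IsTestFun.hasDerivAt_secondDiffX {f : Plane → ℝ} (hf : IsTestFun f) (z : Plane) (s : ℝ) :
    HasDerivAt (secondDiffX f z)
      (_root_.partialX f (z - s • unitX) - _root_.partialX f (z + s • unitX)) s := by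
  have := ((hf.hasDerivAt_add z s).const_sub (2 * f z)).sub (hf.hasDerivAt_sub z s)
  refine this.congr_deriv ?_
  ring

theorem secondDiffX_zero (f : Plane → ℝ) (z : Plane) : secondDiffX f z 0 = 0 := by
  simp [secondDiffX]; ring

/-- Second differences of a test function are `O(min(1, s²))`. -/
theorem IsTestFun.exists_abs_secondDiffX_le {f : Plane → ℝ} (hf : IsTestFun f) :
    ∃ C, 0 ≤ C ∧ ∀ z s, |secondDiffX f z s| ≤ C ∧ |secondDiffX f z s| ≤ C * s ^ 2 := by
  obtain ⟨M, hM⟩ := hf.exists_bound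
  obtain ⟨K, hK⟩ := hf.partialX.1.lipschitzWith_of_hasCompactSupport hf.partialX.2 (by simp)
  have hM0 : 0 ≤ M := (abs_nonneg _).trans (hM 0)
  refine ⟨4 * M + 2 * K, by positivity, fun z s => ⟨?_, ?_⟩⟩
  · have h1 := abs_le.1 (hM z)
    have h2 := abs_le.1 (hM (z + s • unitX))
    have h3 := abs_le.1 (hM (z - s • unitX))
    have h4 : (0 : ℝ) ≤ K := K.2
    rw [secondDiffX, abs_le]
    constructor <;> linarith
  -- The derivative in `s` is a first difference of `∂ₓf` over a step `2t`, so the Lipschitz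
  -- constant of `∂ₓf` and the mean value inequality give the order `s²`.
  · have hb : ∀ t ∈ Set.uIcc 0 s, ‖_root_.partialX f (z - t • unitX)
        - _root_.partialX f (z + t • unitX)‖ ≤ 2 * K * |s| := by
      intro t ht
      have h1 := hK.norm_sub_le (z - t • unitX) (z + t • unitX)
      refine h1.trans ?_
      have h2 : z - t • unitX - (z + t • unitX) = (-(2 * t)) • unitX := by
        rw [neg_smul, mul_smul, two_smul]; abel
      rw [h2, norm_smul, PiLp.norm_single, norm_one, mul_one, norm_neg, norm_mul, Real.norm_two,
        Real.norm_eq_abs]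
      have h3 : |t| ≤ |s| := by simpa using Set.abs_sub_left_of_mem_uIcc ht
      nlinarith [K.2]
    have h := (convex_uIcc 0 s).norm_image_sub_le_of_norm_hasDerivWithin_le
      (fun t _ => (hf.hasDerivAt_secondDiffX z t).hasDerivWithinAt) hb
      Set.left_mem_uIcc Set.right_mem_uIcc
    rw [secondDiffX_zero, sub_zero, sub_zero, Real.norm_eq_abs, Real.norm_eq_abs] at h
    refine h.trans ?_
    rw [mul_assoc, abs_mul_abs_self, ← sq]
    gcongr
    linarith

theorem IsTestFun.continuous_secondDiffX {f : Plane → ℝ} (hf : IsTestFun f) :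
    Continuous fun q : Plane × ℝ => secondDiffX f q.1 q.2 := by
  have := hf.continuous
  unfold secondDiffX
  fun_prop

/-- The integrable profile `min(1, s⁻²)` on the half line. -/
theorem integrableOn_min_one_rpow : IntegrableOn (fun s : ℝ => min 1 (s ^ (-2 : ℝ)))
    (Set.Ioi 0) := by
  rw [← Set.Ioc_union_Ioi_eq_Ioi (zero_le_one' ℝ), integrableOn_union]
  have hm : Measurable fun s : ℝ => min 1 (s ^ (-2 : ℝ)) := by fun_prop
  constructor
  · refine Integrable.mono' (g := fun _ => (1 : ℝ)) (by simp) hm.aestronglyMeasurable ?_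
    filter_upwards [ae_restrict_mem measurableSet_Ioc] with s hs
    rw [Real.norm_of_nonneg (le_min zero_le_one (Real.rpow_nonneg hs.1.le _))]
    exact min_le_left _ _
  · refine Integrable.mono' (integrableOn_Ioi_rpow_of_lt (a := -2) (by norm_num) one_pos)
      hm.aestronglyMeasurable ?_
    filter_upwards [ae_restrict_mem measurableSet_Ioi] with s hs
    have h1 : (1 : ℝ) < s := hs
    rw [Real.norm_of_nonneg (le_min zero_le_one (Real.rpow_nonneg (by linarith) _))]
    exact min_le_right _ _

theorem abs_div_sq_le_min {x C s : ℝ} (hs : 0 < s) (h1 : |x| ≤ C) (h2 : |x| ≤ C * s ^ 2) :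
    |x / s ^ 2| ≤ C * min 1 (s ^ (-2 : ℝ)) := by
  have hC : 0 ≤ C := (abs_nonneg x).trans h1
  have hs2 : 0 < s ^ 2 := by positivity
  rw [mul_min_of_nonneg _ _ hC, abs_div, abs_of_pos hs2, Real.rpow_neg hs.le]
  norm_cast
  refine le_min ?_ ?_
  · rw [div_le_iff₀ hs2]; linarith
  · rw [← div_eq_mul_inv]; gcongr

theorem IsTestFun.integrableOn_secondDiffX {f : Plane → ℝ} (hf : IsTestFun f) (z : Plane) :
    IntegrableOn (fun s => secondDiffX f z s / s ^ 2) (Set.Ioi 0) := by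
  obtain ⟨C, hC, h⟩ := hf.exists_abs_secondDiffX_le
  refine Integrable.mono' (integrableOn_min_one_rpow.const_mul C) ?_ ?_
  · have : Continuous fun s => secondDiffX f z s :=
      hf.continuous_secondDiffX.comp (by fun_prop : Continuous fun s : ℝ => (z, s))
    exact (this.measurable.div (by fun_prop)).aestronglyMeasurable
  · filter_upwards [ae_restrict_mem measurableSet_Ioi] with s hs
    exact abs_div_sq_le_min hs (h z s).1 (h z s).2

theorem IsTestFun.integrable_line {f : Plane → ℝ} (hf : IsTestFun f) (z : Plane) :
    Integrable fun s : ℝ => f (z + s • unitX) := by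
  have hcl : Topology.IsClosedEmbedding fun s : ℝ => z + s • unitX := by
    refine Isometry.isClosedEmbedding (Isometry.of_dist_eq fun s t => ?_)
    rw [dist_add_left, dist_eq_norm, ← sub_smul, norm_smul, PiLp.norm_single, norm_one, mul_one,
      Real.dist_eq, Real.norm_eq_abs]
  exact (hf.continuous.comp hcl.continuous).integrable_of_hasCompactSupport
    (hf.2.comp_isClosedEmbedding hcl)

/-- For test functions `ℋ ∂ₓ` is given by an absolutely convergent integral. -/
theorem IsTestFun.hilbertX_partialX {f : Plane → ℝ} (hf : IsTestFun f) (z : Plane) :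
    hilbertX (_root_.partialX f) z = absDerivX f z := by
  set g : ℝ → ℝ := fun s => _root_.partialX f (z - s • unitX) with hg
  have hgi : Integrable g := by
    simpa [hg, sub_eq_add_neg] using (hf.partialX.integrable_line z).comp_neg
  -- Substituting `t = x - s`, folding the two half-lines together and integrating by parts. The
  -- boundary term at `δ` is `O(δ)` because second differences are `O(δ²)`.
  have htrunc : ∀ δ : ℝ, 0 < δ →
      ∫ t in {t : ℝ | δ < |z 0 - t|}, _root_.partialX f (!₂[t, z 1]) / (z 0 - t) =
      (∫ s in Set.Ioi δ, secondDiffX f z s / s ^ 2) - secondDiffX f z δ / δ := by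
    intro δ hδ
    have hmS : MeasurableSet {s : ℝ | δ < |s|} := measurableSet_lt measurable_const (by fun_prop)
    have h1 : ∫ t in {t : ℝ | δ < |z 0 - t|}, _root_.partialX f (!₂[t, z 1]) / (z 0 - t) =
        ∫ s in {s : ℝ | δ < |s|}, g s / s := by
      rw [← integral_indicator hmS, ← integral_indicator
        (measurableSet_lt measurable_const (by fun_prop)), ← integral_sub_left_eq_self _ volume (z 0)]
      congr 1; ext t
      simp only [Set.indicator, Set.mem_ofPred_eq]
      have : z - t • unitX = !₂[z 0 - t, z 1] := by
        ext i; fin_cases i <;> simp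
      simp only [hg, this, sub_sub_cancel]
    have hdiv : ∀ S : Set ℝ, MeasurableSet S → (∀ s ∈ S, δ ≤ |s|) →
        ∀ h : ℝ → ℝ, Integrable h → IntegrableOn (fun s => h s / s) S := by
      intro S hS hSδ h hh
      simp_rw [div_eq_mul_inv]
      refine hh.integrableOn.mul_bdd (c := δ⁻¹) (by fun_prop) ?_
      filter_upwards [ae_restrict_mem hS] with s hs
      rw [norm_inv, Real.norm_eq_abs]
      exact inv_anti₀ hδ (hSδ s hs)
    have hset : {s : ℝ | δ < |s|} = Set.Ioi δ ∪ Set.Iio (-δ) := by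
      ext s; simp only [Set.mem_ofPred_eq, lt_abs, Set.mem_union, Set.mem_Ioi, Set.mem_Iio]
      constructor <;> rintro (h | h) <;> [left; right; left; right] <;> linarith
    have hI1 : IntegrableOn (fun s => g s / s) (Set.Ioi δ) :=
      hdiv _ measurableSet_Ioi (fun s hs => (le_of_lt hs).trans (le_abs_self s)) g hgi
    have hI2 : IntegrableOn (fun s => g s / s) (Set.Iio (-δ)) :=
      hdiv _ measurableSet_Iio (fun s hs => by
        have : s < -δ := hs
        exact le_trans (by linarith) (neg_le_abs s)) g hgi
    have hI3 : IntegrableOn (fun s => g (-s) / s) (Set.Ioi δ) :=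
      hdiv _ measurableSet_Ioi (fun s hs => (le_of_lt hs).trans (le_abs_self s)) _ hgi.comp_neg
    have h2 : ∫ s in {s : ℝ | δ < |s|}, g s / s = ∫ s in Set.Ioi δ, (g s - g (-s)) / s := by
      have hdisj : Disjoint (Set.Ioi δ) (Set.Iio (-δ)) := Set.disjoint_left.2 fun s hs hs' => by
        have h1 : δ < s := hs
        have h2 : s < -δ := hs'
        linarith
      rw [hset, setIntegral_union hdisj measurableSet_Iio hI1 hI2, ← integral_Iic_eq_integral_Iio,
        ← integral_comp_neg_Ioi, ← integral_add hI1 (by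
          simp only [div_neg]; exact hI3.neg)]
      congr 1; ext s; rw [div_neg]; ring
    have hI4 : IntegrableOn (fun s => (g s - g (-s)) / s) (Set.Ioi δ) := by
      refine (hI1.sub hI3).congr (Eventually.of_forall fun s => ?_)
      simp only [Pi.sub_apply]; ring
    have hI5 : IntegrableOn (fun s => secondDiffX f z s / s ^ 2) (Set.Ioi δ) :=
      (hf.integrableOn_secondDiffX z).mono_set (Set.Ioi_subset_Ioi hδ.le)
    obtain ⟨C, hC, hb⟩ := hf.exists_abs_secondDiffX_le
    have hlim : Tendsto (fun s => secondDiffX f z s / s) atTop (𝓝 0) := by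
      refine squeeze_zero_norm' (a := fun s => C / s) ?_ (tendsto_const_nhds.div_atTop tendsto_id)
      filter_upwards [eventually_gt_atTop 0] with s hs
      rw [norm_div, Real.norm_of_nonneg hs.le, Real.norm_eq_abs]
      exact div_le_div_of_nonneg_right (hb z s).1 hs.le
    have hder : ∀ s ∈ Set.Ici δ, HasDerivAt (fun s => secondDiffX f z s / s)
        ((g s - g (-s)) / s - secondDiffX f z s / s ^ 2) s := by
      intro s hs
      have hs0 : s ≠ 0 := (hδ.trans_le hs).ne'
      refine ((hf.hasDerivAt_secondDiffX z s).div (hasDerivAt_id s) hs0).congr_deriv ?_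
      simp only [hg, neg_smul, sub_neg_eq_add, id]
      field_simp
    have h3 := integral_Ioi_of_hasDerivAt_of_tendsto' hder (hI4.sub hI5) hlim
    rw [integral_sub hI4 hI5] at h3
    rw [h1, h2]
    linarith
  have hlim0 : Tendsto (fun δ => secondDiffX f z δ / δ) (𝓝[>] 0) (𝓝 0) := by
    obtain ⟨C, hC, hb⟩ := hf.exists_abs_secondDiffX_le
    have hid : Tendsto (fun δ : ℝ => C * δ) (𝓝[>] 0) (𝓝 0) := by
      have : Tendsto (fun δ : ℝ => C * δ) (𝓝 0) (𝓝 (C * 0)) := tendsto_id.const_mul C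
      rw [mul_zero] at this
      exact this.mono_left nhdsWithin_le_nhds
    refine squeeze_zero_norm' ?_ hid
    filter_upwards [self_mem_nhdsWithin] with δ hδ
    have hδ0 : 0 < δ := hδ
    rw [norm_div, Real.norm_of_nonneg hδ0.le, Real.norm_eq_abs, div_le_iff₀ hδ0]
    exact (hb z δ).2.trans (le_of_eq (by ring))
  have hlim1 : Tendsto (fun δ => ∫ s in Set.Ioi δ, secondDiffX f z s / s ^ 2) (𝓝[>] 0)
      (𝓝 (∫ s in Set.Ioi 0, secondDiffX f z s / s ^ 2)) := by
    have hcov := aecover_Ioi_of_Ioi (μ := volume) (A := (0 : ℝ)) (a := fun δ : ℝ => δ)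
      (l := 𝓝[>] 0) (tendsto_id.mono_left nhdsWithin_le_nhds)
    refine (hcov.integral_tendsto_of_countably_generated
      (hf.integrableOn_secondDiffX z)).congr' ?_
    filter_upwards [self_mem_nhdsWithin] with δ hδ
    rw [Measure.restrict_restrict measurableSet_Ioi, Set.inter_eq_left.2
      (Set.Ioi_subset_Ioi (le_of_lt hδ))]
  refine Tendsto.limUnder_eq (((hlim1.sub hlim0).const_mul Real.pi⁻¹).congr' ?_ |>.trans (by
    rw [sub_zero]; rfl))
  filter_upwards [self_mem_nhdsWithin] with δ hδ
  rw [htrunc δ hδ]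

/-! ### Fourier multiplier of the second-difference operator. -/

theorem abs_two_sub_two_cos_le (θ : ℝ) :
    |2 - 2 * Real.cos θ| ≤ 4 ∧ |2 - 2 * Real.cos θ| ≤ θ ^ 2 := by
  have h1 := Real.cos_le_one θ
  have h2 := Real.neg_one_le_cos θ
  have h3 := Real.one_sub_sq_div_two_le_cos (x := θ)
  rw [abs_of_nonneg (by linarith)]
  constructor <;> linarith

/-- The quotient `(2 - 2 cos(2πsx)) / s²`, the second difference of a character over `s²`. -/
noncomputable def cosQuot (x s : ℝ) : ℝ := (2 - 2 * Real.cos (2 * Real.pi * s * x)) / s ^ 2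

theorem Measurable.cosQuot {α : Type*} [MeasurableSpace α] {f g : α → ℝ} (hf : Measurable f)
    (hg : Measurable g) : Measurable fun a => cosQuot (f a) (g a) := by
  unfold _root_.cosQuot; fun_prop

theorem cosQuot_nonneg (x s : ℝ) : 0 ≤ cosQuot x s :=
  div_nonneg (by linarith [Real.cos_le_one (2 * Real.pi * s * x)]) (sq_nonneg s)

theorem integrableOn_cosQuot (x : ℝ) : IntegrableOn (cosQuot x) (Set.Ioi 0) := by
  refine Integrable.mono' (integrableOn_min_one_rpow.const_mul (4 + (2 * Real.pi * x) ^ 2))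
    (measurable_const.cosQuot measurable_id).aestronglyMeasurable ?_
  filter_upwards [ae_restrict_mem measurableSet_Ioi] with s hs
  have h := abs_two_sub_two_cos_le (2 * Real.pi * s * x)
  refine abs_div_sq_le_min hs (h.1.trans (by nlinarith [sq_nonneg (2 * Real.pi * x)]))
    (h.2.trans ?_)
  nlinarith [sq_nonneg s, sq_nonneg (2 * Real.pi * x)]

/-- The constant by which the second-difference operator acts on `exp(2πi x)`. -/
noncomputable def absDerivConst : ℝ := Real.pi⁻¹ * ∫ s in Set.Ioi 0, cosQuot 1 s

theorem absDerivConst_pos : 0 < absDerivConst := by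
  refine mul_pos (inv_pos.2 Real.pi_pos) ?_
  rw [setIntegral_pos_iff_support_of_nonneg_ae
    (Eventually.of_forall fun s => cosQuot_nonneg 1 s) (integrableOn_cosQuot 1)]
  -- The integrand is positive on `(0, 1)`, where `cos(2πs) ≠ 1`. Only the sign of the constant is
  -- needed, so its value is not computed.
  refine lt_of_lt_of_le ?_ (measure_mono (show Set.Ioo (0 : ℝ) 1 ⊆ _ from ?_))
  · simp
  · intro s hs
    refine ⟨?_, hs.1⟩
    have hs0 := hs.1
    have hne : Real.cos (2 * Real.pi * s) ≠ 1 := by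
      intro h
      rw [Real.cos_eq_one_iff_of_lt_of_lt (by nlinarith [Real.pi_pos])
        (by nlinarith [Real.pi_pos, hs.2])] at h
      have : 0 < 2 * Real.pi * s := by positivity
      linarith
    have hs2 : s ^ 2 ≠ 0 := by positivity
    rw [Function.mem_support, cosQuot, mul_one]
    exact div_ne_zero (fun h => hne (by linarith)) hs2

/-- Scaling `s ↦ |x| s`: the quotient is homogeneous of degree 2 and the measure accounts for one
power of `|x|`. -/
theorem integral_cosQuot (x : ℝ) :
    Real.pi⁻¹ * ∫ s in Set.Ioi 0, cosQuot x s = absDerivConst * |x| := by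
  rcases eq_or_ne x 0 with rfl | hx
  · simp [cosQuot]
  have hx' : 0 < |x| := abs_pos.2 hx
  have h := integral_comp_mul_left_Ioi (cosQuot 1) 0 hx'
  rw [mul_zero, smul_eq_mul] at h
  have h2 : ∀ s : ℝ, cosQuot x s = |x| ^ 2 * cosQuot 1 (|x| * s) := by
    intro s
    have : Real.cos (2 * Real.pi * s * x) = Real.cos (2 * Real.pi * (|x| * s) * 1) := by
      rw [show 2 * Real.pi * (|x| * s) * 1 = (2 * Real.pi * s) * |x| by ring]
      rcases abs_choice x with h | h <;> rw [h]
      rw [mul_neg, Real.cos_neg]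
    rw [cosQuot, cosQuot, this]
    rcases eq_or_ne s 0 with rfl | hs
    · simp
    · field_simp
  simp_rw [h2]
  rw [integral_const_mul, h, absDerivConst]
  field_simp

/-- A test function as a complex Schwartz function. -/
noncomputable def IsTestFun.toSchwartz {f : Plane → ℝ} (hf : IsTestFun f) : 𝓢(Plane, ℂ) :=
  (hf.2.comp_left (g := fun x : ℝ => (x : ℂ)) Complex.ofReal_zero).toSchwartzMap
    (Complex.ofRealCLM.contDiff.comp hf.1)

theorem IsTestFun.toSchwartz_apply {f : Plane → ℝ} (hf : IsTestFun f) (z : Plane) :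
    hf.toSchwartz z = (f z : ℂ) := rfl

/-- The character `exp(2πi ⟨ξ, z⟩)`. -/
noncomputable def planeChar (ξ z : Plane) : ℂ :=
  Complex.exp (↑(2 * Real.pi * inner ℝ ξ z) * Complex.I)

@[fun_prop]
theorem continuous_planeChar : Continuous fun q : Plane × Plane => planeChar q.1 q.2 := by
  unfold planeChar; fun_prop

theorem norm_planeChar (ξ z : Plane) : ‖planeChar ξ z‖ = 1 := Complex.norm_exp_ofReal_mul_I _

theorem planeChar_add (ξ z w : Plane) : planeChar ξ (z + w) = planeChar ξ z * planeChar ξ w := by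
  rw [planeChar, planeChar, planeChar, ← Complex.exp_add, inner_add_right]
  congr 1; push_cast; ring

theorem planeChar_smul_unitX (ξ : Plane) (s : ℝ) :
    planeChar ξ (s • unitX) = Complex.exp (((2 * Real.pi * s * ξ 0 : ℝ) : ℂ) * Complex.I) := by
  have : inner ℝ ξ (s • unitX) = s * ξ 0 := by
    rw [inner_smul_right, EuclideanSpace.inner_single_right]; simp
  rw [planeChar, this]
  congr 2; push_cast; ring

theorem fourierInv_eq_integral_planeChar (h : Plane → ℂ) (z : Plane) :
    𝓕⁻ h z = ∫ ξ, planeChar ξ z * h ξ := by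
  rw [Real.fourierInv_eq']; rfl

theorem IsTestFun.eq_integral_planeChar {f : Plane → ℝ} (hf : IsTestFun f) (z : Plane) :
    (f z : ℂ) = ∫ ξ, planeChar ξ z * 𝓕 hf.toSchwartz ξ := by
  rw [← fourierInv_eq_integral_planeChar, ← SchwartzMap.fourierInv_coe,
    FourierTransform.fourierInv_fourier_eq, hf.toSchwartz_apply]

theorem integrable_planeChar_mul {h : Plane → ℂ} (hh : Integrable h) (z : Plane) :
    Integrable fun ξ => planeChar ξ z * h ξ := by
  have hc : Continuous fun ξ => planeChar ξ z :=
    continuous_planeChar.comp (by fun_prop : Continuous fun ξ : Plane => (ξ, z))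
  exact hh.bdd_mul (c := 1) hc.aestronglyMeasurable
    (Eventually.of_forall fun ξ => (norm_planeChar ξ z).le)

theorem IsTestFun.secondDiffX_eq_integral {f : Plane → ℝ} (hf : IsTestFun f) (z : Plane) (s : ℝ) :
    (secondDiffX f z s : ℂ) = ∫ ξ, ((2 - 2 * Real.cos (2 * Real.pi * s * ξ 0) : ℝ) : ℂ) *
      (planeChar ξ z * 𝓕 hf.toSchwartz ξ) := by
  have hi := fun z => integrable_planeChar_mul (𝓕 hf.toSchwartz).integrable z
  have hi2 : Integrable fun ξ => 2 * (planeChar ξ z * 𝓕 hf.toSchwartz ξ) -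
      planeChar ξ (z + s • unitX) * 𝓕 hf.toSchwartz ξ := ((hi z).const_mul 2).sub (hi _)
  rw [secondDiffX]
  push_cast
  rw [hf.eq_integral_planeChar z, hf.eq_integral_planeChar (z + s • unitX),
    hf.eq_integral_planeChar (z - s • unitX), ← integral_const_mul,
    ← integral_sub ((hi z).const_mul 2) (hi _), ← integral_sub hi2 (hi _)]
  congr 1; ext ξ
  rw [sub_eq_add_neg z, ← neg_smul, planeChar_add, planeChar_add, planeChar_smul_unitX,
    planeChar_smul_unitX, Complex.exp_mul_I, Complex.exp_mul_I]
  rw [show 2 * Real.pi * -s * ξ 0 = -(2 * Real.pi * s * ξ 0) by ring]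
  push_cast
  rw [Complex.cos_neg, Complex.sin_neg]
  ring

theorem integrable_cosQuot_mul {h : Plane → ℂ} (hh : Continuous h)
    (hmul : Integrable fun ξ : Plane => |ξ 0| * ‖h ξ‖) (z : Plane) :
    Integrable (fun q : Plane × ℝ => ((cosQuot (q.1 0) q.2 : ℝ) : ℂ) *
      (planeChar q.1 z * h q.1)) (volume.prod (volume.restrict (Set.Ioi 0))) := by
  have hm : AEStronglyMeasurable (fun q : Plane × ℝ => ((cosQuot (q.1 0) q.2 : ℝ) : ℂ) *
      (planeChar q.1 z * h q.1)) (volume.prod (volume.restrict (Set.Ioi 0))) := by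
    have h2 : Continuous fun ξ => planeChar ξ z :=
      continuous_planeChar.comp (by fun_prop : Continuous fun ξ : Plane => (ξ, z))
    have h3 : Measurable fun q : Plane × ℝ => ((cosQuot (q.1 0) q.2 : ℝ) : ℂ) :=
      (Measurable.cosQuot (by fun_prop) (by fun_prop)).complex_ofReal
    have h4 : Measurable fun q : Plane × ℝ => planeChar q.1 z * h q.1 :=
      (h2.mul hh).measurable.comp measurable_fst
    exact (h3.mul h4).aestronglyMeasurable
  rw [integrable_prod_iff hm]
  constructor
  · refine Eventually.of_forall fun ξ => ?_
    have h1 : Integrable (fun s => ((cosQuot (ξ 0) s : ℝ) : ℂ))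
      (volume.restrict (Set.Ioi 0)) := (integrableOn_cosQuot (ξ 0)).ofReal
    exact h1.mul_const (planeChar ξ z * h ξ)
  · refine (hmul.const_mul (Real.pi * absDerivConst)).congr (Eventually.of_forall fun ξ => ?_)
    have e : ∀ s : ℝ, ‖((cosQuot (ξ 0) s : ℝ) : ℂ) * (planeChar ξ z * h ξ)‖ =
        cosQuot (ξ 0) s * ‖h ξ‖ := by
      intro s
      rw [norm_mul, norm_mul, norm_planeChar, one_mul, Complex.norm_real,
        Real.norm_of_nonneg (cosQuot_nonneg _ _)]
    simp only [e]
    rw [integral_mul_const]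
    have := integral_cosQuot (ξ 0)
    rw [inv_mul_eq_iff_eq_mul₀ Real.pi_ne_zero] at this
    rw [this]; ring

/-- A second difference multiplies the character by `2 - 2cos(2πsξ₁)`; integrating against `ds/s²`
and exchanging the integrals produces `|ξ₁|`. Fubini is justified by the integrability of `|ξ₁|
|f̂|`. -/
theorem IsTestFun.absDerivX_eq_integral {f : Plane → ℝ} (hf : IsTestFun f) (z : Plane) :
    (absDerivX f z : ℂ) = ∫ ξ, planeChar ξ z *
      (((absDerivConst * |ξ 0| : ℝ) : ℂ) * 𝓕 hf.toSchwartz ξ) := by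
  set h := 𝓕 hf.toSchwartz
  have hξ : ∀ ξ : Plane, |ξ 0| ≤ ‖ξ‖ := fun ξ => PiLp.norm_apply_le ξ 0
  have hmul : Integrable fun ξ : Plane => |ξ 0| * ‖h ξ‖ := by
    refine Integrable.mono' (h.integrable_pow_mul volume 1) ?_ (Eventually.of_forall fun ξ => ?_)
    · have : Continuous fun ξ => h ξ := h.continuous
      exact (by fun_prop : Continuous fun ξ : Plane => |ξ 0| * ‖h ξ‖).aestronglyMeasurable
    · rw [Real.norm_of_nonneg (by positivity), pow_one]
      gcongr; exact hξ ξ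
  have hint : Integrable (fun q : Plane × ℝ => ((cosQuot (q.1 0) q.2 : ℝ) : ℂ) *
      (planeChar q.1 z * h q.1)) (volume.prod (volume.restrict (Set.Ioi 0))) :=
    integrable_cosQuot_mul h.continuous hmul z
  have e1 : ∀ s : ℝ, ((secondDiffX f z s / s ^ 2 : ℝ) : ℂ) =
      ∫ ξ, ((cosQuot (ξ 0) s : ℝ) : ℂ) * (planeChar ξ z * h ξ) := by
    intro s
    rw [Complex.ofReal_div, hf.secondDiffX_eq_integral, ← integral_div]
    congr 1; ext ξ; rw [cosQuot]; push_cast; ring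
  rw [absDerivX, Complex.ofReal_mul, ← integral_complex_ofReal]
  simp_rw [e1]
  rw [← integral_integral_swap (f := fun (ξ : Plane) (s : ℝ) =>
    ((cosQuot (ξ 0) s : ℝ) : ℂ) * (planeChar ξ z * h ξ)) hint, ← integral_const_mul]
  congr 1; ext ξ
  rw [integral_mul_const, integral_complex_ofReal, ← integral_cosQuot]
  push_cast; ring

theorem IsTestFun.toSchwartz_partialY {f : Plane → ℝ} (hf : IsTestFun f) :
    hf.partialY.toSchwartz = ∂_{(EuclideanSpace.single 1 1 : Plane)} hf.toSchwartz := by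
  ext z
  rw [SchwartzMap.lineDerivOp_apply_eq_fderiv, IsTestFun.toSchwartz_apply]
  have h : HasFDerivAt (fun z => (f z : ℂ)) (Complex.ofRealCLM.comp (fderiv ℝ f z)) z :=
    Complex.ofRealCLM.hasFDerivAt.comp z
      ((hf.1.differentiable (by simp)) z).hasFDerivAt
  have h2 : fderiv ℝ (hf.toSchwartz : Plane → ℂ) z = Complex.ofRealCLM.comp (fderiv ℝ f z) :=
    h.fderiv
  rw [h2]; rfl

theorem IsTestFun.fourier_partialY {f : Plane → ℝ} (hf : IsTestFun f) (ξ : Plane) :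
    𝓕 hf.partialY.toSchwartz ξ = (2 * Real.pi * ξ 1 * Complex.I) * 𝓕 hf.toSchwartz ξ := by
  rw [hf.toSchwartz_partialY, SchwartzMap.fourier_lineDerivOp_eq, smul_apply,
    SchwartzMap.smulLeftCLM_apply_apply (by fun_prop), EuclideanSpace.inner_single_right]
  simp only [smul_eq_mul, Complex.real_smul]
  simp
  ring

/-! ### The linear operator and its inversion on test functions. -/

/-- The operator `c + a ℋ∂ₓ - ∂_y²` on test functions. -/
noncomputable def solitonOp (c a : ℝ) (f : Plane → ℝ) (z : Plane) : ℝ :=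
  c * f z + a * absDerivX f z - partialY (partialY f) z

theorem SchwartzMap.integrable_resolventSymbol_mul (c b : ℝ) (h : 𝓢(Plane, ℂ)) :
    Integrable fun ξ => (resolventSymbol c b ξ : ℂ) * h ξ := by
  have h0 := (h.integrable_pow_mul volume 0).const_mul |c|
  have h1 := (h.integrable_pow_mul volume 1).const_mul |b|
  have h2 := (h.integrable_pow_mul volume 2).const_mul ((2 * Real.pi) ^ 2)
  refine ((h0.add h1).add h2).mono' ?_ (Eventually.of_forall fun ξ => ?_)
  · have e1 : Continuous fun ξ => h ξ := h.continuous
    have e2 : Continuous fun ξ => resolventSymbol c b ξ := by unfold resolventSymbol; fun_prop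
    exact (by fun_prop : Continuous fun ξ => (resolventSymbol c b ξ : ℂ) * h ξ).aestronglyMeasurable
  · rw [norm_mul, Complex.norm_real, Real.norm_eq_abs]
    have e0 : |ξ 0| ≤ ‖ξ‖ := PiLp.norm_apply_le ξ 0
    have e1 : |ξ 1| ≤ ‖ξ‖ := PiLp.norm_apply_le ξ 1
    have e2 : |resolventSymbol c b ξ| ≤ |c| + |b| * ‖ξ‖ + (2 * Real.pi) ^ 2 * ‖ξ‖ ^ 2 := by
      rw [resolventSymbol]
      refine (abs_add_le _ _).trans (add_le_add ((abs_add_le _ _).trans (add_le_add le_rfl ?_)) ?_)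
      · rw [abs_mul, abs_abs]; gcongr
      · rw [abs_of_nonneg (sq_nonneg _), mul_pow, ← sq_abs (ξ 1)]; gcongr
    simp only [Pi.add_apply]
    calc _ ≤ (|c| + |b| * ‖ξ‖ + (2 * Real.pi) ^ 2 * ‖ξ‖ ^ 2) * ‖h ξ‖ := by gcongr
      _ = _ := by ring

theorem IsTestFun.solitonOp_eq_integral {f : Plane → ℝ} (hf : IsTestFun f) (c a : ℝ) (z : Plane) :
    (solitonOp c a f z : ℂ) = ∫ ξ, planeChar ξ z *
      ((resolventSymbol c (a * absDerivConst) ξ : ℂ) * 𝓕 hf.toSchwartz ξ) := by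
  have hi0 := integrable_planeChar_mul (𝓕 hf.toSchwartz).integrable z
  have hi1 : Integrable fun ξ => planeChar ξ z *
      (((absDerivConst * |ξ 0| : ℝ) : ℂ) * 𝓕 hf.toSchwartz ξ) := by
    refine integrable_planeChar_mul ?_ z
    -- The multiplier of `absDerivX` is the difference of the symbols with `b = absDerivConst` and
    -- `b = 0`.
    refine ((SchwartzMap.integrable_resolventSymbol_mul 0 absDerivConst (𝓕 hf.toSchwartz)).sub
      (SchwartzMap.integrable_resolventSymbol_mul 0 0 (𝓕 hf.toSchwartz))).congr
      (Eventually.of_forall fun ξ => ?_)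
    simp only [Pi.sub_apply, resolventSymbol]
    push_cast; ring
  have hi2 := integrable_planeChar_mul (𝓕 hf.partialY.partialY.toSchwartz).integrable z
  have hi01 : Integrable fun ξ => (c : ℂ) * (planeChar ξ z * 𝓕 hf.toSchwartz ξ) +
      (a : ℂ) * (planeChar ξ z * (((absDerivConst * |ξ 0| : ℝ) : ℂ) * 𝓕 hf.toSchwartz ξ)) :=
    (hi0.const_mul _).add (hi1.const_mul _)
  rw [solitonOp]
  push_cast
  rw [hf.eq_integral_planeChar z, hf.absDerivX_eq_integral z,
    hf.partialY.partialY.eq_integral_planeChar z, ← integral_const_mul, ← integral_const_mul,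
    ← integral_add (hi0.const_mul _) (hi1.const_mul _),
    ← integral_sub hi01 hi2]
  congr 1; ext ξ
  rw [hf.partialY.fourier_partialY, hf.fourier_partialY, resolventSymbol]
  push_cast
  ring_nf
  rw [Complex.I_sq]
  ring

theorem IsTestFun.exists_abs_solitonOp_le {f : Plane → ℝ} (hf : IsTestFun f) (c a : ℝ) :
    ∃ C, ∀ z, |solitonOp c a f z| ≤ C := by
  refine ⟨∫ ξ, ‖(resolventSymbol c (a * absDerivConst) ξ : ℂ) * 𝓕 hf.toSchwartz ξ‖, fun z => ?_⟩
  rw [← Real.norm_eq_abs, ← Complex.norm_real, hf.solitonOp_eq_integral]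
  refine (norm_integral_le_integral_norm _).trans (le_of_eq ?_)
  congr 1; ext ξ
  rw [norm_mul, norm_planeChar, one_mul]

/-- The resolvent kernel inverts the operator. -/
theorem IsTestFun.integral_resolventKer_mul_solitonOp {f : Plane → ℝ} (hf : IsTestFun f)
    {c a : ℝ} (hc : 0 < c) (ha : 0 < a) (z : Plane) :
    ∫ w, resolventKer c (a * absDerivConst) w * solitonOp c a f (z - w) = f z := by
  have hb : 0 < a * absDerivConst := mul_pos ha absDerivConst_pos
  set b := a * absDerivConst with hbdef
  set h := 𝓕 hf.toSchwartz
  have hK := (integrable_resolventKer hc hb).ofReal (𝕜 := ℂ)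
  have hσ := SchwartzMap.integrable_resolventSymbol_mul c b h
  have hint : Integrable (fun q : Plane × Plane => planeChar q.2 (z - q.1) *
      ((resolventKer c b q.1 : ℂ) * ((resolventSymbol c b q.2 : ℂ) * h q.2)))
      (volume.prod volume) := by
    refine (hK.mul_prod hσ).bdd_mul (c := 1) ?_ (Eventually.of_forall fun q =>
      (norm_planeChar _ _).le)
    exact (continuous_planeChar.comp (by fun_prop : Continuous fun q : Plane × Plane =>
      (q.2, z - q.1))).aestronglyMeasurable
  have hchar : ∀ w ξ : Plane, planeChar ξ (z - w) = planeChar ξ z *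
      Complex.exp (↑(-2 * Real.pi * inner ℝ w ξ) * Complex.I) := by
    intro w ξ
    rw [sub_eq_add_neg, planeChar_add]
    congr 1
    rw [planeChar, inner_neg_right, real_inner_comm]
    congr 2; push_cast; ring
  have : ((∫ w, resolventKer c b w * solitonOp c a f (z - w) : ℝ) : ℂ) = (f z : ℂ) := by
    rw [← integral_complex_ofReal]
    have e1 : ∀ w, ((resolventKer c b w * solitonOp c a f (z - w) : ℝ) : ℂ) =
        ∫ ξ, planeChar ξ (z - w) *
          ((resolventKer c b w : ℂ) * ((resolventSymbol c b ξ : ℂ) * h ξ)) := by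
      intro w
      rw [Complex.ofReal_mul, hf.solitonOp_eq_integral, ← integral_const_mul, ← hbdef]
      congr 1; ext ξ; ring
    simp_rw [e1]
    rw [integral_integral_swap hint, hf.eq_integral_planeChar z]
    congr 1; ext ξ
    have e2 : ∀ w, planeChar ξ (z - w) *
          ((resolventKer c b w : ℂ) * ((resolventSymbol c b ξ : ℂ) * h ξ)) =
        (planeChar ξ z * ((resolventSymbol c b ξ : ℂ) * h ξ)) *
          (Complex.exp (↑(-2 * Real.pi * inner ℝ w ξ) * Complex.I) • (resolventKer c b w : ℂ)) := by
      intro w; rw [hchar, smul_eq_mul]; ring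
    simp_rw [e2]
    -- After Fubini the `w`-integral is the transform of the kernel, which cancels the symbol and
    -- leaves Fourier inversion for `f`.
    have hF := fourier_resolventKer hc hb ξ
    rw [Real.fourier_eq'] at hF
    rw [integral_const_mul, hF]
    have hne : (resolventSymbol c b ξ : ℂ) ≠ 0 := by
      exact_mod_cast (resolventSymbol_pos hc hb.le ξ).ne'
    push_cast
    field_simp
    rfl
  exact_mod_cast this

/-- For `s ≤ 1` the second difference lives in a fixed ball and is pointwise `O(s²)`; for `s ≥ 1`
its `L¹` norm is at most four times that of `f`. This puts `absDerivX f` in `L¹`, although it has no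
compact support in general. -/
theorem IsTestFun.exists_integral_abs_secondDiffX_le {f : Plane → ℝ} (hf : IsTestFun f) :
    ∃ A, ∀ s, 0 < s → (∫ z, |secondDiffX f z s|) ≤ A ∧ (∫ z, |secondDiffX f z s|) ≤ A * s ^ 2 := by
  obtain ⟨C, hC, hb⟩ := hf.exists_abs_secondDiffX_le
  obtain ⟨R, hR0, hR⟩ := hf.2.isCompact.isBounded.subset_closedBall_lt 0 0
  set N := ∫ z, |f z|
  have hN : 0 ≤ N := integral_nonneg fun z => abs_nonneg _
  set W := (volume (Metric.closedBall (0 : Plane) (R + 1))).toReal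
  have hW : 0 ≤ W := ENNReal.toReal_nonneg
  have hsecond : ∀ s, Integrable fun z => secondDiffX f z s := fun s =>
    ((hf.integrable.const_mul 2).sub (hf.integrable.comp_add_right _)).sub
      (hf.integrable.comp_sub_right _)
  have h1 : ∀ s, (∫ z, |secondDiffX f z s|) ≤ 4 * N := by
    intro s
    have e1 : ∫ z, |f (z + s • unitX)| = N := integral_add_right_eq_self (fun z => |f z|) _
    have e2 : ∫ z, |f (z - s • unitX)| = N := integral_sub_right_eq_self (fun z => |f z|) _
    have i1 : Integrable fun z => 2 * |f z| + |f (z + s • unitX)| :=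
      (hf.integrable.abs.const_mul 2).add (hf.integrable.comp_add_right _).abs
    have i2 : Integrable fun z => |f (z - s • unitX)| := (hf.integrable.comp_sub_right _).abs
    calc (∫ z, |secondDiffX f z s|)
        ≤ ∫ z, (2 * |f z| + |f (z + s • unitX)| + |f (z - s • unitX)|) := by
          refine integral_mono (hsecond s).abs (i1.add i2) fun z => ?_
          simp only [secondDiffX]
          refine (abs_sub _ _).trans (add_le_add ((abs_sub _ _).trans ?_) le_rfl)
          rw [abs_mul, abs_two]
      _ = 4 * N := by
          rw [integral_add i1 i2, integral_add (hf.integrable.abs.const_mul 2)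
            (hf.integrable.comp_add_right _).abs, integral_const_mul, e1, e2]
          ring
  refine ⟨4 * N + C * W, fun s hs => ⟨(h1 s).trans (by nlinarith), ?_⟩⟩
  rcases le_total s 1 with hs1 | hs1
  · have hsupp : ∀ z ∉ Metric.closedBall (0 : Plane) (R + 1), secondDiffX f z s = 0 := by
      intro z hz
      rw [mem_closedBall_zero_iff, not_le] at hz
      have hu : ‖s • unitX‖ ≤ 1 := by
        rw [norm_smul, PiLp.norm_single, norm_one, mul_one, Real.norm_of_nonneg hs.le]
        exact hs1
      have hzero : ∀ w : Plane, R < ‖w‖ → f w = 0 := fun w hw => by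
        by_contra hne
        have := hR (subset_tsupport f hne)
        rw [mem_closedBall_zero_iff] at this
        linarith
      rw [secondDiffX, hzero z (by linarith), hzero (z + s • unitX) ?_, hzero (z - s • unitX) ?_]
      · ring
      · have := norm_sub_norm_le z (s • unitX); linarith
      · have := norm_sub_le (z + s • unitX) (s • unitX)
        rw [add_sub_cancel_right] at this; linarith
    calc (∫ z, |secondDiffX f z s|)
        = ∫ z in Metric.closedBall (0 : Plane) (R + 1), |secondDiffX f z s| := by
          rw [setIntegral_eq_integral_of_forall_compl_eq_zero fun z hz => by
            rw [hsupp z hz, abs_zero]]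
      _ ≤ ∫ z in Metric.closedBall (0 : Plane) (R + 1), C * s ^ 2 := by
          refine setIntegral_mono (hsecond s).abs.integrableOn ?_ fun z => (hb z s).2
          exact integrableOn_const measure_closedBall_lt_top.ne
      _ = W * (C * s ^ 2) := by rw [setIntegral_const, smul_eq_mul]; rfl
      _ ≤ _ := by nlinarith [sq_nonneg s]
  · have hs2 : 1 ≤ s ^ 2 := by nlinarith
    refine (h1 s).trans ?_
    have : 0 ≤ C * W := by positivity
    nlinarith

theorem IsTestFun.integrable_absDerivX {f : Plane → ℝ} (hf : IsTestFun f) :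
    Integrable (absDerivX f) := by
  have hm : Measurable fun q : Plane × ℝ => secondDiffX f q.1 q.2 / q.2 ^ 2 :=
    hf.continuous_secondDiffX.measurable.div (by fun_prop)
  have hint : Integrable (fun q : Plane × ℝ => secondDiffX f q.1 q.2 / q.2 ^ 2)
      (volume.prod (volume.restrict (Set.Ioi 0))) := by
    rw [integrable_prod_iff' hm.aestronglyMeasurable]
    constructor
    · refine Eventually.of_forall fun s => ?_
      have : Integrable fun z => secondDiffX f z s :=
        ((hf.integrable.const_mul 2).sub (hf.integrable.comp_add_right _)).sub
          (hf.integrable.comp_sub_right _)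
      exact this.div_const (s ^ 2)
    · obtain ⟨A, hA⟩ := hf.exists_integral_abs_secondDiffX_le
      refine Integrable.mono' (integrableOn_min_one_rpow.const_mul A)
        hm.aestronglyMeasurable.norm.prod_swap.integral_prod_right' ?_
      filter_upwards [ae_restrict_mem measurableSet_Ioi] with s hs
      have e : ∀ z, ‖secondDiffX f z s / s ^ 2‖ = |secondDiffX f z s| / s ^ 2 := fun z => by
        rw [Real.norm_eq_abs, abs_div, abs_of_nonneg (sq_nonneg s)]
      simp only [e]
      rw [integral_div]
      have hnn : 0 ≤ ∫ z, |secondDiffX f z s| := integral_nonneg fun z => abs_nonneg _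
      rw [Real.norm_eq_abs]
      exact abs_div_sq_le_min hs ((abs_of_nonneg hnn).le.trans (hA s hs).1)
        ((abs_of_nonneg hnn).le.trans (hA s hs).2)
  exact hint.integral_prod_left.const_mul _

theorem IsTestFun.integrable_solitonOp {f : Plane → ℝ} (hf : IsTestFun f) (c a : ℝ) :
    Integrable (solitonOp c a f) :=
  ((hf.integrable.const_mul c).add (hf.integrable_absDerivX.const_mul a)).sub
    hf.partialY.partialY.integrable

theorem solitonOp_comp_sub (c a : ℝ) (f : Plane → ℝ) (w z : Plane) :
    solitonOp c a (fun z => f (z - w)) z = solitonOp c a f (z - w) := by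
  simp only [solitonOp, absDerivX_comp_sub]
  rw [show partialY (fun z => f (z - w)) = fun z => partialY f (z - w) from
    funext fun z => partialY_comp_sub f w z, partialY_comp_sub]

theorem resolventKer_neg (c b : ℝ) (z : Plane) : resolventKer c b (-z) = resolventKer c b z := by
  simp [resolventKer, heatKer_neg]

/-! ### The representation formula for distributional solutions. -/

/-- Justifies Fubini when `F` is only in `L^∞ + L¹`, the class shared by `φ` and the nonlinearity:
the bounded part uses that `M` is integrable, the part `H` uses a majorant of `M`. -/
theorem integrable_fst_mul_of_le {F H : Plane → ℝ} {M B : Plane × Plane → ℝ}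
    (hF : AEStronglyMeasurable F) (hH0 : ∀ z, 0 ≤ H z) (hFH : ∀ᵐ z, |F z| ≤ 1 + H z)
    (hM : Integrable M (volume.prod volume)) (hMB : ∀ p, |M p| ≤ B p)
    (hHB : Integrable (fun p => H p.1 * B p) (volume.prod volume)) :
    Integrable (fun p : Plane × Plane => F p.1 * M p) (volume.prod volume) := by
  refine (hM.abs.add hHB).mono' (hF.comp_fst.mul hM.aestronglyMeasurable) ?_
  filter_upwards [Measure.quasiMeasurePreserving_fst.ae hFH] with p hp
  rw [norm_mul, Real.norm_eq_abs, Real.norm_eq_abs, Pi.add_apply]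
  nlinarith [mul_le_mul_of_nonneg_right hp (abs_nonneg (M p)),
    mul_le_mul_of_nonneg_left (hMB p) (hH0 p.1)]

theorem integrable_mul_kernel_mul {F H K Θ : Plane → ℝ} (hF : AEStronglyMeasurable F)
    (hH : Integrable H) (hH0 : ∀ z, 0 ≤ H z) (hFH : ∀ᵐ z, |F z| ≤ 1 + H z) (hK : Integrable K)
    (hΘ : Integrable Θ) {C : ℝ} (hC : ∀ z, |Θ z| ≤ C) :
    Integrable (fun p : Plane × Plane => F p.1 * (K p.2 * Θ (p.1 - p.2)))
      (volume.prod volume) := by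
  refine integrable_fst_mul_of_le (B := fun p => C * |K p.2|) hF hH0 hFH
    (hK.convolution_integrand (ContinuousLinearMap.mul ℝ ℝ) hΘ) (fun p => ?_)
    (hH.mul_prod (hK.abs.const_mul C))
  rw [abs_mul, mul_comm]
  gcongr; exact hC _

theorem integrable_mul_kernel_sub {H K : Plane → ℝ} (hH : Integrable H) (hK : Integrable K) :
    Integrable (fun p : Plane × Plane => H p.1 * K (p.2 - p.1)) (volume.prod volume) :=
  (hH.convolution_integrand (ContinuousLinearMap.mul ℝ ℝ) hK).swap

theorem integrable_mul_kernel_sub_mul {F H K ψ : Plane → ℝ} (hF : AEStronglyMeasurable F)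
    (hH : Integrable H) (hH0 : ∀ z, 0 ≤ H z) (hFH : ∀ᵐ z, |F z| ≤ 1 + H z) (hK : Integrable K)
    (hψ : Integrable ψ) {C : ℝ} (hC : ∀ z, |ψ z| ≤ C) :
    Integrable (fun p : Plane × Plane => F p.1 * (ψ p.2 * K (p.2 - p.1)))
      (volume.prod volume) := by
  have hK' : Integrable fun z => K (-z) := hK.comp_neg
  have h1 := hψ.convolution_integrand (ContinuousLinearMap.mul ℝ ℝ) hK' (μ := volume)
  simp only [neg_sub, ContinuousLinearMap.mul_apply'] at h1
  refine integrable_fst_mul_of_le (B := fun p => C * |K (p.2 - p.1)|) hF hH0 hFH h1 (fun p => ?_) ?_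
  · rw [abs_mul]
    gcongr; exact hC _
  · refine ((integrable_mul_kernel_sub hH hK.abs).const_mul C).congr
      (Eventually.of_forall fun p => ?_)
    simp only; ring

/-- Convolving with an integrable kernel a function dominated by `1 + H`, `H` integrable, gives a
locally integrable function. -/
theorem locallyIntegrable_kernel_conv {F H K : Plane → ℝ} (hF : AEStronglyMeasurable F)
    (hH : Integrable H) (hFH : ∀ᵐ z, |F z| ≤ 1 + H z) (hK : Integrable K) :
    LocallyIntegrable fun v => ∫ z, K (v - z) * F z := by
  have hHK := (hH.abs.convolution_integrand (ContinuousLinearMap.mul ℝ ℝ) hK.abs (μ := volume))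
  simp only [ContinuousLinearMap.mul_apply'] at hHK
  have hm : AEStronglyMeasurable (fun p : Plane × Plane => K (p.1 - p.2) * F p.2)
      (volume.prod volume) :=
    (hK.aestronglyMeasurable.comp_quasiMeasurePreserving
      (quasiMeasurePreserving_sub_of_right_invariant volume volume)).mul hF.comp_snd
  have hdom : LocallyIntegrable fun v => (∫ z, |K z|) + ∫ z, |H z| * |K (v - z)| :=
    (locallyIntegrable_const _).add hHK.integral_prod_left.locallyIntegrable
  refine hdom.mono hm.integral_prod_right' ?_
  filter_upwards [hHK.prod_right_ae] with v hv
  have hKv : Integrable fun z => |K (v - z)| := (hK.comp_sub_left v).abs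
  refine (norm_integral_le_of_norm_le (hKv.add hv) ?_).trans ?_
  · filter_upwards [hFH] with z hz
    rw [norm_mul, Real.norm_eq_abs, Real.norm_eq_abs, Pi.add_apply]
    nlinarith [abs_nonneg (K (v - z)), le_abs_self (H z)]
  · rw [integral_add' hKv hv, integral_sub_left_eq_self (fun z => |K z|) volume v]
    exact le_abs_self _

/-- Distributional solutions of `(c + a ℋ∂ₓ - ∂_y²) φ = G` are given by the resolvent kernel. -/
theorem ae_eq_resolventKer_conv {c a : ℝ} (hc : 0 < c) (ha : 0 < a) {φ G H : Plane → ℝ}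
    (hφ : AEStronglyMeasurable φ) (hG : AEStronglyMeasurable G) (hH : Integrable H)
    (hH0 : ∀ z, 0 ≤ H z) (hφH : ∀ᵐ z, |φ z| ≤ 1 + H z) (hGH : ∀ᵐ z, |G z| ≤ 1 + H z)
    (heq : ∀ χ, IsTestFun χ → ∫ z, φ z * solitonOp c a χ z = ∫ z, G z * χ z) :
    φ =ᵐ[volume] fun v => ∫ z, resolventKer c (a * absDerivConst) (v - z) * G z := by
  set K := resolventKer c (a * absDerivConst)
  have hK : Integrable K := integrable_resolventKer hc (mul_pos ha absDerivConst_pos)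
  have hφloc : LocallyIntegrable φ := by
    have hdom : LocallyIntegrable fun z => 1 + H z :=
      (locallyIntegrable_const (1 : ℝ)).add hH.locallyIntegrable
    refine hdom.mono hφ ?_
    filter_upwards [hφH] with z hz using hz.trans (le_abs_self _)
  refine ae_eq_of_integral_contDiff_smul_eq hφloc
    (locallyIntegrable_kernel_conv hG hH hGH hK) fun ψ hψ hψc => ?_
  have ht : IsTestFun ψ := ⟨hψ, hψc⟩
  obtain ⟨C, hC⟩ := ht.exists_bound
  obtain ⟨C', hC'⟩ := ht.exists_abs_solitonOp_le c a
  have hΘ := ht.integrable_solitonOp c a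
  simp only [smul_eq_mul]
  calc ∫ z, ψ z * φ z = ∫ z, ∫ w, φ z * (K w * solitonOp c a ψ (z - w)) := by
        congr 1; ext z
        rw [integral_const_mul, ht.integral_resolventKer_mul_solitonOp hc ha, mul_comm]
    _ = ∫ w, ∫ z, φ z * (K w * solitonOp c a ψ (z - w)) :=
        integral_integral_swap (integrable_mul_kernel_mul hφ hH hH0 hφH hK hΘ hC')
    _ = ∫ w, ∫ z, G z * (K w * ψ (z - w)) := by
        -- The equation is tested only on the translates `ψ(· - w)`, which remain compactly
        -- supported. The average over `w` against `K` comes afterwards, so the non-compactly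
        -- supported `K ⋆ ψ` is not used as a test function.
        congr 1; ext w
        have h := heq _ (ht.comp_sub w)
        simp only [solitonOp_comp_sub] at h
        simp only [mul_left_comm _ (K w)]
        rw [integral_const_mul, integral_const_mul, h]
    _ = ∫ z, ∫ w, G z * (K w * ψ (z - w)) :=
        (integral_integral_swap
          (integrable_mul_kernel_mul hG hH hH0 hGH hK ht.integrable hC)).symm
    _ = ∫ z, ∫ v, G z * (ψ v * K (v - z)) := by
        congr 1; ext z
        -- Substitution `v = z - w`, followed by evenness of the kernel.
        rw [← integral_sub_left_eq_self _ volume z]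
        congr 1; ext v
        rw [sub_sub_cancel, ← neg_sub v z, show K (-(v - z)) = K (v - z) from resolventKer_neg _ _ _]
        ring
    _ = ∫ v, ∫ z, G z * (ψ v * K (v - z)) :=
        integral_integral_swap
          (integrable_mul_kernel_sub_mul hG hH hH0 hGH hK ht.integrable hC)
    _ = ∫ v, ψ v * ∫ z, K (v - z) * G z := by
        congr 1; ext v
        rw [← integral_const_mul]
        congr 1; ext z; ring

/-! ### The anisotropic Sobolev embedding. -/

theorem planeChar_comm (ξ z : Plane) : planeChar ξ z = planeChar z ξ := by
  rw [planeChar, planeChar, real_inner_comm]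

/-- The `L²` inverse Fourier transform of an integrable `L²` function is given by the integral. -/
theorem fourierInv_Lp_ae_eq (h : Lp ℂ 2 (volume : Measure Plane)) (hi : Integrable h) :
    (𝓕⁻ h : Lp ℂ 2 (volume : Measure Plane)) =ᵐ[volume] fun z => ∫ ξ, planeChar ξ z * h ξ := by
  have hcont : Continuous fun z : Plane => ∫ ξ, planeChar ξ z * h ξ := by
    refine continuous_of_dominated (bound := fun ξ => ‖h ξ‖)
      (fun z => (integrable_planeChar_mul hi z).aestronglyMeasurable)
      (fun z => Eventually.of_forall fun ξ => ?_) hi.norm (Eventually.of_forall fun ξ => ?_)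
    · rw [norm_mul, norm_planeChar, one_mul]
    · have : Continuous fun z => planeChar ξ z :=
        continuous_planeChar.comp (by fun_prop : Continuous fun z : Plane => (ξ, z))
      fun_prop
  refine ae_eq_of_integral_contDiff_smul_eq
    ((Lp.memLp _).locallyIntegrable (by norm_num)) hcont.locallyIntegrable fun χ hχ hχc => ?_
  have ht : IsTestFun χ := ⟨hχ, hχc⟩
  -- The `L²` transform agrees with the transform of tempered distributions, so pairing with a test
  -- function moves it onto that function, where it is an integral.
  have h1 : ∫ z, χ z • (𝓕⁻ h : Lp ℂ 2 (volume : Measure Plane)) z =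
      ∫ ξ, (𝓕⁻ ht.toSchwartz) ξ • h ξ := by
    have e := congrArg (fun T : 𝓢'(Plane, ℂ) => T ht.toSchwartz)
      (Lp.fourierInv_toTemperedDistribution_eq h)
    simp only [TemperedDistribution.fourierInv_apply, Lp.toTemperedDistribution_apply] at e
    rw [e]
    rfl
  have hint : Integrable (fun q : Plane × Plane =>
      planeChar q.1 q.2 * (h q.1 * ht.toSchwartz q.2)) (volume.prod volume) :=
    (hi.mul_prod ht.toSchwartz.integrable).bdd_mul (c := 1)
      continuous_planeChar.aestronglyMeasurable (Eventually.of_forall fun q =>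
        (norm_planeChar _ _).le)
  rw [h1]
  calc ∫ ξ, (𝓕⁻ ht.toSchwartz) ξ • h ξ
      = ∫ ξ, ∫ z, planeChar ξ z * (h ξ * ht.toSchwartz z) := by
        congr 1; ext ξ
        rw [SchwartzMap.fourierInv_coe, fourierInv_eq_integral_planeChar, smul_eq_mul, mul_comm,
          ← integral_const_mul]
        congr 1; ext z
        rw [planeChar_comm]; ring
    _ = ∫ z, ∫ ξ, planeChar ξ z * (h ξ * ht.toSchwartz z) := integral_integral_swap hint
    _ = ∫ z, χ z • ∫ ξ, planeChar ξ z * h ξ := by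
        congr 1; ext z
        rw [Complex.real_smul, ← integral_const_mul]
        congr 1; ext ξ
        rw [ht.toSchwartz_apply]; ring

theorem lintegral_enorm_sq_eq (f : Lp ℂ 2 (volume : Measure Plane)) :
    ∫⁻ z, ‖f z‖ₑ ^ 2 = ‖f‖ₑ ^ 2 := by
  rw [Lp.enorm_def]
  have h := eLpNorm_nnreal_pow_eq_lintegral (f := f) (μ := volume) (p := 2) (by norm_num)
  simp only [NNReal.coe_ofNat, ENNReal.coe_ofNat] at h
  exact_mod_cast h.symm

theorem lintegral_enorm_fourierInv_sq (f : Lp ℂ 2 (volume : Measure Plane)) :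
    ∫⁻ z, ‖(𝓕⁻ f : Lp ℂ 2 (volume : Measure Plane)) z‖ₑ ^ 2 = ∫⁻ z, ‖f z‖ₑ ^ 2 := by
  rw [lintegral_enorm_sq_eq, lintegral_enorm_sq_eq]
  have h : ‖(𝓕⁻ f : Lp ℂ 2 (volume : Measure Plane))‖ = ‖f‖ := by
    rw [← Lp.norm_fourier_eq, FourierTransform.fourier_fourierInv_eq]
  rw [← ofReal_norm, ← ofReal_norm, h]

/-- The low frequency region of anisotropic size `A`. -/
def lowFreq (A : ℝ) : Set Plane := {ξ | |ξ 0| ≤ A ^ 2 ∧ |ξ 1| ≤ A}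

theorem measurableSet_lowFreq (A : ℝ) : MeasurableSet (lowFreq A) := by
  have h0 : MeasurableSet {ξ : Plane | |ξ 0| ≤ A ^ 2} :=
    measurableSet_le (by fun_prop) measurable_const
  have h1 : MeasurableSet {ξ : Plane | |ξ 1| ≤ A} :=
    measurableSet_le (by fun_prop) measurable_const
  exact h0.inter h1

/-- The anisotropic weight `|ξ₁| + ξ₂²`. -/
noncomputable def freqWeight (ξ : Plane) : ℝ := |ξ 0| + ξ 1 ^ 2

theorem freqWeight_nonneg (ξ : Plane) : 0 ≤ freqWeight ξ := by unfold freqWeight; positivity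

theorem sq_le_freqWeight {A : ℝ} (hA : 0 < A) {ξ : Plane} (hξ : ξ ∉ lowFreq A) :
    A ^ 2 ≤ freqWeight ξ := by
  rw [freqWeight]
  by_contra hlt
  refine hξ ⟨?_, ?_⟩
  · nlinarith [sq_nonneg (ξ 1)]
  · refine abs_le_of_sq_le_sq ?_ hA.le
    nlinarith [abs_nonneg (ξ 0)]

/-- Weighted AM–GM with weights `3/4` and `1/4`. The product majorizes the inverse frequency weight
by locally integrable powers. -/
theorem one_le_freqWeight_mul {ξ : Plane} (h0 : ξ 0 ≠ 0) (h1 : ξ 1 ≠ 0) :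
    1 ≤ freqWeight ξ * (|ξ 0| ^ (-(3 / 4) : ℝ) * |ξ 1| ^ (-(1 / 2) : ℝ)) := by
  have a0 : 0 < |ξ 0| := abs_pos.2 h0
  have a1 : 0 < |ξ 1| := abs_pos.2 h1
  have h := Real.geom_mean_le_arith_mean2_weighted (w₁ := 3 / 4) (w₂ := 1 / 4) (by norm_num)
    (by norm_num) a0.le (sq_nonneg |ξ 1|) (by norm_num)
  have e : (|ξ 1| ^ 2) ^ (1 / 4 : ℝ) = |ξ 1| ^ (1 / 2 : ℝ) := by
    rw [← Real.rpow_natCast, ← Real.rpow_mul a1.le]; norm_num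
  rw [e] at h
  have h2 : |ξ 0| ^ (3 / 4 : ℝ) * |ξ 1| ^ (1 / 2 : ℝ) ≤ freqWeight ξ := by
    rw [freqWeight, ← sq_abs (ξ 1)]
    nlinarith [sq_nonneg |ξ 1|]
  rw [Real.rpow_neg a0.le, Real.rpow_neg a1.le, ← mul_inv, ← div_eq_mul_inv,
    one_le_div (by positivity)]
  exact h2

theorem setLIntegral_abs_rpow {a R : ℝ} (ha : 0 < a) (hR : 0 ≤ R) :
    ∫⁻ x in {x : ℝ | |x| ≤ R}, ENNReal.ofReal (|x| ^ (a - 1)) =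
      ENNReal.ofReal (2 * R ^ a / a) := by
  have hm : MeasurableSet {x : ℝ | |x| ≤ R} := measurableSet_le (by fun_prop) measurable_const
  have h1 : ∫⁻ x in {x : ℝ | |x| ≤ R}, ENNReal.ofReal (|x| ^ (a - 1)) =
      ∫⁻ x, (fun t => (Set.Iic R).indicator (fun t => ENNReal.ofReal (t ^ (a - 1))) t) |x| := by
    rw [← lintegral_indicator hm]
    rfl
  rw [h1, lintegral_comp_abs fun t => (Set.Iic R).indicator
    (fun t => ENNReal.ofReal (t ^ (a - 1))) t, lintegral_indicator measurableSet_Iic,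
    Measure.restrict_restrict measurableSet_Iic, Set.inter_comm, Set.Ioi_inter_Iic,
    ← ofReal_integral_eq_lintegral_ofReal, ← intervalIntegral.integral_of_le hR,
    integral_rpow (Or.inl (by linarith))]
  · rw [sub_add_cancel, Real.zero_rpow ha.ne', sub_zero, ← ENNReal.ofReal_ofNat 2,
      ← ENNReal.ofReal_mul (by norm_num), mul_div_assoc]
  · exact (intervalIntegrable_iff_integrableOn_Ioc_of_le hR).1
      (intervalIntegral.intervalIntegrable_rpow' (by linarith))
  · filter_upwards [ae_restrict_mem measurableSet_Ioc] with t ht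
    exact Real.rpow_nonneg ht.1.le _

theorem setLIntegral_lowFreq_le {A : ℝ} (hA : 0 < A) :
    ∫⁻ ξ in lowFreq A, ENNReal.ofReal (|ξ 0| ^ (-(3 / 4) : ℝ) * |ξ 1| ^ (-(1 / 2) : ℝ)) =
      ENNReal.ofReal (32 * A) := by
  have hm : ∀ R : ℝ, MeasurableSet {x : ℝ | |x| ≤ R} := fun R =>
    measurableSet_le (by fun_prop) measurable_const
  rw [← lintegral_indicator (measurableSet_lowFreq A)]
  have e : ∀ ξ : Plane, (lowFreq A).indicator
      (fun ξ => ENNReal.ofReal (|ξ 0| ^ (-(3 / 4) : ℝ) * |ξ 1| ^ (-(1 / 2) : ℝ))) ξ =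
      {x : ℝ | |x| ≤ A ^ 2}.indicator (fun x => ENNReal.ofReal (|x| ^ (1 / 4 - 1 : ℝ))) (ξ 0) *
      {x : ℝ | |x| ≤ A}.indicator (fun x => ENNReal.ofReal (|x| ^ (1 / 2 - 1 : ℝ))) (ξ 1) := by
    intro ξ
    rw [show (1 / 4 - 1 : ℝ) = -(3 / 4) by norm_num, show (1 / 2 - 1 : ℝ) = -(1 / 2) by norm_num]
    by_cases h0 : |ξ 0| ≤ A ^ 2 <;> by_cases h1 : |ξ 1| ≤ A <;>
      simp [Set.indicator, lowFreq, h0, h1, ENNReal.ofReal_mul, Real.rpow_nonneg]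
  simp_rw [e]
  rw [lintegral_plane_mul ((by fun_prop : Measurable fun x : ℝ =>
      ENNReal.ofReal (|x| ^ (1 / 4 - 1 : ℝ))).indicator (hm _))
    ((by fun_prop : Measurable fun x : ℝ =>
      ENNReal.ofReal (|x| ^ (1 / 2 - 1 : ℝ))).indicator (hm _)),
    lintegral_indicator (hm _), lintegral_indicator (hm _),
    setLIntegral_abs_rpow (by norm_num) (by positivity),
    setLIntegral_abs_rpow (by norm_num) hA.le, ← ENNReal.ofReal_mul (by positivity)]
  congr 1
  have h1 : (A ^ 2) ^ (1 / 4 : ℝ) = A ^ (1 / 2 : ℝ) := by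
    rw [← Real.rpow_natCast, ← Real.rpow_mul hA.le]; norm_num
  have h2 : A ^ (1 / 2 : ℝ) * A ^ (1 / 2 : ℝ) = A := by
    rw [← Real.rpow_add hA]; norm_num
  rw [h1]
  calc _ = 32 * (A ^ (1 / 2 : ℝ) * A ^ (1 / 2 : ℝ)) := by ring
    _ = _ := by rw [h2]

theorem lintegral_freqWeight_le_zNormSq (f : Lp ℂ 2 (volume : Measure Plane)) :
    ∫⁻ ξ, ENNReal.ofReal (freqWeight ξ) * ‖(𝓕 f : Lp ℂ 2 (volume : Measure Plane)) ξ‖ₑ ^ 2 ≤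
      zNormSq f := by
  set h : Lp ℂ 2 (volume : Measure Plane) := 𝓕 f
  have hm : AEMeasurable (fun ξ => ‖h ξ‖ₑ ^ 2) volume :=
    ((Lp.aestronglyMeasurable h).enorm).pow_const 2
  have hpi : 1 ≤ 2 * Real.pi := by linarith [Real.pi_gt_three]
  calc ∫⁻ ξ, ENNReal.ofReal (freqWeight ξ) * ‖h ξ‖ₑ ^ 2
      ≤ ∫⁻ ξ : Plane, (ENNReal.ofReal ((2 * Real.pi * ξ 1) ^ 2) * ‖h ξ‖ₑ ^ 2
        + ENNReal.ofReal |2 * Real.pi * ξ 0| * ‖h ξ‖ₑ ^ 2) := by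
        refine lintegral_mono fun ξ => ?_
        rw [← add_mul, ← ENNReal.ofReal_add (by positivity) (by positivity)]
        gcongr
        rw [freqWeight, abs_mul, abs_of_pos (by positivity : 0 < 2 * Real.pi), mul_pow]
        have hpi2 : 1 ≤ (2 * Real.pi) ^ 2 := by nlinarith
        linarith [mul_le_mul_of_nonneg_right hpi (abs_nonneg (ξ 0)),
          mul_le_mul_of_nonneg_right hpi2 (sq_nonneg (ξ 1))]
    _ = (∫⁻ ξ : Plane, ENNReal.ofReal ((2 * Real.pi * ξ 1) ^ 2) * ‖h ξ‖ₑ ^ 2)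
        + ∫⁻ ξ : Plane, ENNReal.ofReal |2 * Real.pi * ξ 0| * ‖h ξ‖ₑ ^ 2 :=
        lintegral_add_left' ((by fun_prop : Measurable fun ξ : Plane =>
          ENNReal.ofReal ((2 * Real.pi * ξ 1) ^ 2)).aemeasurable.mul hm) _
    _ ≤ zNormSq f := by
        rw [zNormSq, add_assoc]
        exact le_add_self

/-- Cauchy–Schwarz against the inverse frequency weight, whose majorant has integral `8 A^(1/2) · 4
A^(1/2) = 32 A` over the region. -/
theorem setLIntegral_lowFreq_enorm_le {h : Plane → ℂ} (hh : AEStronglyMeasurable h)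
    (hle : ∫⁻ ξ, ENNReal.ofReal (freqWeight ξ) * ‖h ξ‖ₑ ^ 2 ≤ 1) {A : ℝ} (hA : 0 < A) :
    ∫⁻ ξ in lowFreq A, ‖h ξ‖ₑ ≤ ENNReal.ofReal (Real.sqrt (32 * A)) := by
  set W : Plane → ℝ≥0∞ := fun ξ =>
    ENNReal.ofReal (|ξ 0| ^ (-(3 / 4) : ℝ) * |ξ 1| ^ (-(1 / 2) : ℝ)) with hW
  have hWm : Measurable W := by fun_prop
  have hNm : Measurable fun ξ : Plane => ENNReal.ofReal (freqWeight ξ) := by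
    unfold freqWeight; fun_prop
  have hpt : ∀ᵐ ξ, ‖h ξ‖ₑ ≤ (ENNReal.ofReal (freqWeight ξ) * ‖h ξ‖ₑ ^ 2) ^ (1 / 2 : ℝ) *
      W ξ ^ (1 / 2 : ℝ) := by
    filter_upwards [ae_plane_ne_zero] with ξ hξ
    rw [← ENNReal.mul_rpow_of_nonneg _ _ (by norm_num)]
    have h1 : 1 ≤ ENNReal.ofReal (freqWeight ξ) * W ξ := by
      rw [hW, ← ENNReal.ofReal_mul (freqWeight_nonneg ξ), ENNReal.one_le_ofReal]
      exact one_le_freqWeight_mul hξ.1 hξ.2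
    calc ‖h ξ‖ₑ = (‖h ξ‖ₑ ^ 2) ^ (1 / 2 : ℝ) := by
          rw [← ENNReal.rpow_natCast, ← ENNReal.rpow_mul]; norm_num
      _ ≤ _ := by
          refine ENNReal.rpow_le_rpow ?_ (by norm_num)
          calc ‖h ξ‖ₑ ^ 2 = 1 * ‖h ξ‖ₑ ^ 2 := (one_mul _).symm
            _ ≤ (ENNReal.ofReal (freqWeight ξ) * W ξ) * ‖h ξ‖ₑ ^ 2 := by gcongr
            _ = _ := by ring
  have hm1 : AEMeasurable (fun ξ => ENNReal.ofReal (freqWeight ξ) * ‖h ξ‖ₑ ^ 2) volume :=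
    hNm.aemeasurable.mul (hh.enorm.pow_const 2)
  have hhold := ENNReal.lintegral_mul_le_Lp_mul_Lq (volume.restrict (lowFreq A))
    Real.HolderConjugate.two_two
    (f := fun ξ => (ENNReal.ofReal (freqWeight ξ) * ‖h ξ‖ₑ ^ 2) ^ (1 / 2 : ℝ))
    (g := fun ξ => W ξ ^ (1 / 2 : ℝ))
    (hm1.pow_const _).restrict
    (hWm.pow_const _).aemeasurable
  have e : ∀ x : ℝ≥0∞, (x ^ (1 / 2 : ℝ)) ^ (2 : ℝ) = x := fun x => by
    rw [← ENNReal.rpow_mul]; norm_num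
  simp only [e, Pi.mul_apply] at hhold
  rw [setLIntegral_lowFreq_le hA] at hhold
  calc ∫⁻ ξ in lowFreq A, ‖h ξ‖ₑ ≤ _ := lintegral_mono_ae (ae_restrict_of_ae hpt)
    _ ≤ _ := hhold
    _ ≤ 1 ^ (1 / 2 : ℝ) * ENNReal.ofReal (32 * A) ^ (1 / 2 : ℝ) := by
        gcongr
        exact (setLIntegral_le_lintegral _ _).trans hle
    _ = _ := by
        rw [ENNReal.one_rpow, one_mul, Real.sqrt_eq_rpow,
          ENNReal.ofReal_rpow_of_nonneg (by positivity) (by norm_num)]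

/-- Weak type endpoint of the anisotropic Sobolev embedding. -/
theorem volume_lt_norm_le {f : Lp ℂ 2 (volume : Measure Plane)}
    (hf : zNormSq f ≤ 1) {t : ℝ} (ht : 0 < t) :
    volume {z | t < ‖f z‖} ≤ ENNReal.ofReal (65536 * t ^ (-6 : ℝ)) := by
  set h : Lp ℂ 2 (volume : Measure Plane) := 𝓕 f with hh
  -- Chosen so that `√(32 A) = t/2`: the low frequencies contribute at most `t/2` pointwise, hence
  -- the high frequencies are at least `t/2` where `‖f‖ > t`. Chebyshev then gives `1/(A² (t/2)²) =
  -- 65536 t^(-6)`.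
  set A : ℝ := t ^ 2 / 128 with hAdef
  have hA : 0 < A := by positivity
  have hw := (lintegral_freqWeight_le_zNormSq f).trans hf
  have hmem := Lp.memLp h
  have hlow := hmem.indicator (measurableSet_lowFreq A)
  have hhigh := hmem.indicator (measurableSet_lowFreq A).compl
  set hl : Lp ℂ 2 (volume : Measure Plane) := hlow.toLp _
  set hr : Lp ℂ 2 (volume : Measure Plane) := hhigh.toLp _
  have hsum : h = hl + hr := by
    refine Lp.ext ?_
    filter_upwards [Lp.coeFn_add hl hr, hlow.coeFn_toLp, hhigh.coeFn_toLp] with ξ e1 e2 e3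
    rw [e1, Pi.add_apply, e2, e3, Set.indicator_self_add_compl_apply]
  have hfsum : f = 𝓕⁻ hl + 𝓕⁻ hr := by
    rw [← FourierTransform.fourierInv_add, ← hsum, hh, FourierTransform.fourierInv_fourier_eq]
  have hlint : ∫⁻ ξ, ‖hl ξ‖ₑ ≤ ENNReal.ofReal (t / 2) := by
    have e : ∫⁻ ξ, ‖hl ξ‖ₑ = ∫⁻ ξ in lowFreq A, ‖h ξ‖ₑ := by
      rw [← lintegral_indicator (measurableSet_lowFreq A)]
      refine lintegral_congr_ae ?_
      filter_upwards [hlow.coeFn_toLp] with ξ e2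
      rw [e2, enorm_indicator_eq_indicator_enorm]
    rw [e]
    refine (setLIntegral_lowFreq_enorm_le (Lp.aestronglyMeasurable h) hw hA).trans
      (ENNReal.ofReal_le_ofReal (le_of_eq ?_))
    rw [hAdef, show 32 * (t ^ 2 / 128) = (t / 2) ^ 2 by ring, Real.sqrt_sq (by positivity)]
  have hli : Integrable hl := ⟨Lp.aestronglyMeasurable hl,
    lt_of_le_of_lt hlint ENNReal.ofReal_lt_top⟩
  have hlbound : ∀ᵐ z, ‖(𝓕⁻ hl : Lp ℂ 2 (volume : Measure Plane)) z‖ₑ ≤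
      ENNReal.ofReal (t / 2) := by
    filter_upwards [fourierInv_Lp_ae_eq hl hli] with z hz
    rw [hz]
    refine (enorm_integral_le_lintegral_enorm _).trans (le_trans (le_of_eq ?_) hlint)
    congr 1; ext ξ
    rw [enorm_mul, ← ofReal_norm, norm_planeChar, ENNReal.ofReal_one, one_mul]
  have hrint : ENNReal.ofReal (A ^ 2) * ∫⁻ z, ‖(𝓕⁻ hr : Lp ℂ 2 (volume : Measure Plane)) z‖ₑ ^ 2
      ≤ 1 := by
    rw [lintegral_enorm_fourierInv_sq, ← lintegral_const_mul' _ _ ENNReal.ofReal_ne_top]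
    refine le_trans (lintegral_mono_ae ?_) hw
    filter_upwards [hhigh.coeFn_toLp] with ξ e3
    rw [e3]
    by_cases hξ : ξ ∈ lowFreq A
    · rw [Set.indicator_of_notMem (Set.notMem_compl_iff.2 hξ)]; simp
    · rw [Set.indicator_of_mem (Set.mem_compl hξ)]
      gcongr
      exact sq_le_freqWeight hA hξ
  have hsub : {z | t < ‖f z‖} ≤ᵐ[volume] {z | ENNReal.ofReal (t / 2) ^ 2 ≤
      ‖(𝓕⁻ hr : Lp ℂ 2 (volume : Measure Plane)) z‖ₑ ^ 2} := by
    have hfz : f =ᵐ[volume] fun z => (𝓕⁻ hl : Lp ℂ 2 (volume : Measure Plane)) z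
        + (𝓕⁻ hr : Lp ℂ 2 (volume : Measure Plane)) z := by
      have := Lp.coeFn_add (𝓕⁻ hl : Lp ℂ 2 (volume : Measure Plane)) (𝓕⁻ hr)
      rw [← hfsum] at this
      exact this
    filter_upwards [hfz, hlbound] with z hz hb hlt
    have hlt' : t < ‖f z‖ := hlt
    rw [hz] at hlt'
    rw [← ofReal_norm, ENNReal.ofReal_le_ofReal_iff (by positivity)] at hb
    have h2 : t / 2 ≤ ‖(𝓕⁻ hr : Lp ℂ 2 (volume : Measure Plane)) z‖ := by
      have := norm_add_le ((𝓕⁻ hl : Lp ℂ 2 (volume : Measure Plane)) z)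
        ((𝓕⁻ hr : Lp ℂ 2 (volume : Measure Plane)) z)
      linarith
    change ENNReal.ofReal (t / 2) ^ 2 ≤ _
    rw [← ofReal_norm]
    gcongr
  have hmark := mul_meas_ge_le_lintegral₀
    (((Lp.aestronglyMeasurable (𝓕⁻ hr : Lp ℂ 2 (volume : Measure Plane))).enorm).pow_const 2)
    (ENNReal.ofReal (t / 2) ^ 2)
  have hfin : ENNReal.ofReal (A ^ 2 * (t / 2) ^ 2) * volume {z | t < ‖f z‖} ≤ 1 := by
    rw [ENNReal.ofReal_mul (by positivity), ENNReal.ofReal_pow (by positivity : 0 ≤ t / 2), mul_assoc]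
    refine le_trans ?_ hrint
    gcongr
    exact (mul_le_mul' le_rfl (measure_mono_ae hsub)).trans hmark
  have hpos : 0 < A ^ 2 * (t / 2) ^ 2 := by positivity
  have hval : (A ^ 2 * (t / 2) ^ 2)⁻¹ = 65536 * t ^ (-6 : ℝ) := by
    rw [hAdef, Real.rpow_neg ht.le]
    norm_cast
    field_simp
    norm_num
  rw [← hval, ENNReal.ofReal_inv_of_pos hpos, ← one_div,
    ENNReal.le_div_iff_mul_le (Or.inl (ENNReal.ofReal_pos.2 hpos).ne')
      (Or.inl ENNReal.ofReal_ne_top), mul_comm]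
  exact hfin

/-- The subcritical anisotropic Sobolev embedding. -/
theorem memLp_of_zNormSq_le_one {f : Lp ℂ 2 (volume : Measure Plane)} (hf : zNormSq f ≤ 1)
    {q : ℝ} (hq2 : 2 < q) (hq6 : q < 6) : MemLp f (ENNReal.ofReal q) volume := by
  have hfm := Lp.aestronglyMeasurable f
  refine ⟨hfm, ?_⟩
  have hq0 : 0 < q := by linarith
  rw [eLpNorm_lt_top_iff_lintegral_rpow_enorm_lt_top (by simpa using hq0) ENNReal.ofReal_ne_top,
    ENNReal.toReal_ofReal hq0.le]
  have e : ∀ z, ‖f z‖ₑ ^ q = ENNReal.ofReal (‖f z‖ ^ q) := fun z => by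
    rw [← ofReal_norm, ENNReal.ofReal_rpow_of_nonneg (norm_nonneg _) hq0.le]
  simp_rw [e]
  rw [lintegral_rpow_eq_lintegral_meas_lt_mul volume (Eventually.of_forall fun z => norm_nonneg _)
    hfm.norm.aemeasurable hq0]
  refine ENNReal.mul_lt_top ENNReal.ofReal_lt_top (lt_top_iff_ne_top.2 ?_)
  -- In the layer-cake integral, levels `t ≤ 1` use the `L²` bound `t^(-2)` and need `q > 2`; levels
  -- `t > 1` use the weak-type bound `t^(-6)` and need `q < 6`.
  rw [← Set.Ioc_union_Ioi_eq_Ioi (zero_le_one' ℝ),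
    lintegral_union measurableSet_Ioi Set.Ioc_disjoint_Ioi_same]
  refine ENNReal.add_ne_top.2 ⟨?_, ?_⟩
  · have hi : IntegrableOn (fun t : ℝ => t ^ (q - 3)) (Set.Ioc 0 1) :=
      (intervalIntegrable_iff_integrableOn_Ioc_of_le zero_le_one).1
        (intervalIntegral.intervalIntegrable_rpow' (by linarith))
    refine ne_top_of_le_ne_top (setLIntegral_ofReal_ne_top hi)
      (setLIntegral_mono' measurableSet_Ioc fun t ht => ?_)
    have ht0 := ht.1
    have hL2 : ∫⁻ z, ‖f z‖ₑ ^ 2 ≤ 1 := le_trans (by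
      rw [zNormSq, add_assoc]; exact le_self_add) hf
    have hmark := mul_meas_ge_le_lintegral₀ (hfm.enorm.pow_const 2) (ENNReal.ofReal t ^ 2)
    have hsub : {z | t < ‖f z‖} ⊆ {z | ENNReal.ofReal t ^ 2 ≤ ‖f z‖ₑ ^ 2} := fun z hz => by
      have hz' : t < ‖f z‖ := hz
      change ENNReal.ofReal t ^ 2 ≤ ‖f z‖ₑ ^ 2
      rw [← ofReal_norm]
      gcongr
    have hb : volume {z | t < ‖f z‖} ≤ ENNReal.ofReal (t ^ (-2 : ℝ)) := by
      rw [Real.rpow_neg ht0.le, ENNReal.ofReal_inv_of_pos (by positivity), ← one_div,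
        ENNReal.le_div_iff_mul_le (Or.inl (ENNReal.ofReal_pos.2 (by positivity)).ne')
        (Or.inl ENNReal.ofReal_ne_top), mul_comm, Real.rpow_two, ENNReal.ofReal_pow ht0.le]
      exact ((mul_le_mul' le_rfl (measure_mono hsub)).trans hmark).trans hL2
    calc _ ≤ ENNReal.ofReal (t ^ (-2 : ℝ)) * ENNReal.ofReal (t ^ (q - 1)) := by gcongr
      _ = _ := by
        rw [← ENNReal.ofReal_mul (by positivity), ← Real.rpow_add ht0]
        congr 2; ring
  · have hi : IntegrableOn (fun t : ℝ => 65536 * t ^ (q - 7)) (Set.Ioi 1) :=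
      (integrableOn_Ioi_rpow_of_lt (by linarith) one_pos).const_mul _
    refine ne_top_of_le_ne_top (setLIntegral_ofReal_ne_top hi)
      (setLIntegral_mono' measurableSet_Ioi fun t ht => ?_)
    have ht0 : 0 < t := lt_trans one_pos ht
    calc _ ≤ ENNReal.ofReal (65536 * t ^ (-6 : ℝ)) * ENNReal.ofReal (t ^ (q - 1)) := by
          gcongr
          exact volume_lt_norm_le hf ht0
      _ = _ := by
        rw [← ENNReal.ofReal_mul (by positivity), mul_assoc, ← Real.rpow_add ht0]
        congr 3; ring

theorem MemZ.memLp {φ : Plane → ℝ} (hφ : MemZ φ) {q : ℝ} (hq2 : 2 < q) (hq6 : q < 6) :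
    MemLp φ (ENNReal.ofReal q) volume := by
  obtain ⟨h, happ⟩ := hφ
  -- One test function within distance 1 is enough: the difference falls under the embedding and the
  -- test function lies in every `L^q`.
  obtain ⟨χ, hχ, hχm, hlt⟩ := happ 1 one_pos
  have h1 := memLp_of_zNormSq_le_one hlt.le hq2 hq6
  have h2 : MemLp (fun z => (χ z : ℂ)) (ENNReal.ofReal q) volume :=
    (Complex.continuous_ofReal.comp hχ.continuous).memLp_of_hasCompactSupport
      (hχ.2.comp_left Complex.ofReal_zero)
  have h3 : MemLp (fun z => (φ z : ℂ)) (ENNReal.ofReal q) volume := by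
    refine (h1.add h2).ae_eq ?_
    filter_upwards [Lp.coeFn_sub (toL2 φ h) (toL2 χ hχm), h.coeFn_toLp, hχm.coeFn_toLp]
      with z e1 e2 e3
    rw [Pi.add_apply, e1, Pi.sub_apply, toL2, toL2, e2, e3]
    ring
  simpa using h3.re

/-! ### The nonlinearity, the normalized equation and the conclusion. -/

theorem abs_oddRoot_le (m : ℕ) (t : ℝ) : |oddRoot m t| ≤ |t| ^ ((m : ℝ)⁻¹) := by
  rw [oddRoot, abs_mul, abs_of_nonneg (Real.rpow_nonneg (abs_nonneg t) _)]
  refine mul_le_of_le_one_left (Real.rpow_nonneg (abs_nonneg t) _) ?_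
  rcases lt_trichotomy t 0 with h | h | h <;> simp [h]

theorem abs_powSucc_le {m : ℕ} (hm : 0 < m) (k : ℕ) (t : ℝ) :
    |powSucc k m t| ≤ |t| ^ ((k : ℝ) / m + 1) := by
  have hm' : (m : ℝ) ≠ 0 := by positivity
  rw [powSucc, abs_pow]
  refine (pow_le_pow_left₀ (abs_nonneg _) (abs_oddRoot_le m t) _).trans (le_of_eq ?_)
  rw [← Real.rpow_natCast, ← Real.rpow_mul (abs_nonneg t)]
  congr 1
  push_cast
  field_simp

/-- Used with `s = 1` and `s = p + 1` to dominate both `φ` and the nonlinearity by `1 + |φ|^q`. -/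
theorem rpow_le_one_add_rpow {x s q : ℝ} (hx : 0 ≤ x) (hs : 0 ≤ s) (hsq : s ≤ q) :
    x ^ s ≤ 1 + x ^ q := by
  rcases le_total x 1 with h | h
  · linarith [Real.rpow_le_one hx h hs, Real.rpow_nonneg hx q]
  · linarith [Real.rpow_le_rpow_of_exponent_le h hsq]

theorem integrable_mul_of_abs_le_one_add {F H Θ : Plane → ℝ} (hF : AEStronglyMeasurable F)
    (hH : Integrable H) (hH0 : ∀ z, 0 ≤ H z) (hFH : ∀ᵐ z, |F z| ≤ 1 + H z)
    (hΘ : Integrable Θ) {C : ℝ} (hC : ∀ z, |Θ z| ≤ C) : Integrable fun z => F z * Θ z := by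
  refine (hΘ.abs.add (hH.mul_const C)).mono' (hF.mul hΘ.aestronglyMeasurable) ?_
  filter_upwards [hFH] with z hz
  rw [norm_mul, Real.norm_eq_abs, Real.norm_eq_abs, Pi.add_apply]
  nlinarith [mul_le_mul_of_nonneg_right hz (abs_nonneg (Θ z)),
    mul_le_mul_of_nonneg_left (hC z) (hH0 z)]

/-- The equation of a solitary wave, normalized to `cφ + aΛφ - φ_yy = G` with `c, a > 0`. -/
theorem integral_mul_solitonOp_eq {c α ε p : ℝ} (hε : ε = 1 ∨ ε = -1) {φ P H : Plane → ℝ}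
    (hφ : AEStronglyMeasurable φ) (hP : AEStronglyMeasurable P) (hH : Integrable H)
    (hH0 : ∀ z, 0 ≤ H z) (hφH : ∀ᵐ z, |φ z| ≤ 1 + H z)
    (hPH : ∀ᵐ z, |ε / (p + 1) * P z| ≤ 1 + H z) {χ : Plane → ℝ} (hχ : IsTestFun χ)
    (heq : ∫ z : Plane, (-c * φ z * χ z + 1 / (p + 1) * P z * χ z
      + α * φ z * hilbertX (partialX χ) z + ε * φ z * partialY (partialY χ) z) = 0) :
    ∫ z, φ z * solitonOp (ε * c) (-(ε * α)) χ z = ∫ z, ε / (p + 1) * P z * χ z := by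
  obtain ⟨B, hB⟩ := hχ.exists_bound
  obtain ⟨B', hB'⟩ := hχ.exists_abs_solitonOp_le (ε * c) (-(ε * α))
  have h1 := integrable_mul_of_abs_le_one_add hφ hH hH0 hφH (hχ.integrable_solitonOp _ _) hB'
  have h2 := integrable_mul_of_abs_le_one_add (hP.const_mul (ε / (p + 1))) hH hH0 hPH
    hχ.integrable hB
  have hε2 : ε * ε = 1 := by rcases hε with h | h <;> norm_num [h]
  rw [← sub_eq_zero, ← integral_sub h1 h2, ← mul_zero (-ε), ← heq, ← integral_const_mul]
  congr 1; ext z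
  rw [solitonOp, hχ.hilbertX_partialX]
  -- The integrands differ by the factor `-ε`; only the `∂_y²` term needs `ε² = 1`.
  linear_combination (φ z * partialY (partialY χ) z) * hε2

/-- Interpolation between `L¹` and `L^∞`: `|f|^q ≤ C^(q-1) v`. -/
theorem memLp_of_lintegral_ne_top_of_le {f : Plane → ℝ} {v : Plane → ℝ≥0∞}
    (hf : AEStronglyMeasurable f) (hfv : ∀ᵐ z, ‖f z‖ₑ ≤ v z) {C : ℝ≥0∞} (hC : C ≠ ⊤)
    (hvC : ∀ᵐ z, v z ≤ C) (hv : ∫⁻ z, v z ≠ ⊤) {q : ℝ} (hq : 1 ≤ q) :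
    MemLp f (ENNReal.ofReal q) volume := by
  have hq0 : 0 < q := by linarith
  refine ⟨hf, ?_⟩
  rw [eLpNorm_lt_top_iff_lintegral_rpow_enorm_lt_top (by simpa using hq0) ENNReal.ofReal_ne_top,
    ENNReal.toReal_ofReal hq0.le]
  refine lt_of_le_of_lt (lintegral_mono_ae (g := fun z => C ^ (q - 1) * v z) ?_) ?_
  · filter_upwards [hfv, hvC] with z h1 h2
    calc ‖f z‖ₑ ^ q = ‖f z‖ₑ ^ (q - 1) * ‖f z‖ₑ := by
          conv_lhs => rw [← sub_add_cancel q 1,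
            ENNReal.rpow_add_of_nonneg _ _ (by linarith) zero_le_one, ENNReal.rpow_one]
      _ ≤ C ^ (q - 1) * v z := by
          gcongr
          exact h1.trans h2
  · have hC' := ENNReal.rpow_ne_top_of_nonneg (by linarith : 0 ≤ q - 1) hC
    rw [lintegral_const_mul' _ _ hC']
    exact ENNReal.mul_lt_top hC'.lt_top hv.lt_top

theorem enorm_rpow_mul_rpow_mul_le {ℓ ϱ : ℝ} (hℓ : 0 ≤ ℓ) (hϱ : 0 ≤ ϱ) (z : Plane) (t : ℝ) :
    ‖|z 0| ^ ℓ * |z 1| ^ ϱ * t‖ₑ ≤ planeWeight ℓ ϱ z * ‖t‖ₑ := by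
  rw [enorm_mul, enorm_mul, planeWeight, lineWeight, lineWeight,
    Real.enorm_of_nonneg (by positivity), Real.enorm_of_nonneg (by positivity)]
  gcongr <;> linarith [abs_nonneg (z 0), abs_nonneg (z 1)]

theorem enorm_norm_rpow_mul_le {θ : ℝ} (hθ : 0 ≤ θ) (z : Plane) (t : ℝ) :
    ‖‖z‖ ^ θ * t‖ₑ ≤ planeWeight θ θ z * ‖t‖ₑ := by
  rw [enorm_mul, planeWeight, lineWeight, lineWeight, Real.enorm_of_nonneg (by positivity),
    ← ENNReal.ofReal_mul (by positivity), ← Real.mul_rpow (by positivity) (by positivity)]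
  gcongr
  nlinarith [norm_plane_le z, mul_nonneg (abs_nonneg (z 0)) (abs_nonneg (z 1))]

/-- Weighted decay of solitary waves. -/
theorem IsSolitaryWave.planeWeight_decay {c α ε : ℝ} {k m : ℕ} (hk : 0 < k) (hm : 0 < m)
    (hp : (k : ℝ) / m < 4) (hε : ε = 1 ∨ ε = -1) (hαε : α * ε < 0) (hcα : c * α < 0)
    {φ : Plane → ℝ} (hφ : IsSolitaryWave c α ε k m φ) {ℓ ϱ : ℝ} (hℓ : 0 ≤ ℓ) (hℓ1 : ℓ < 1)
    (hϱ : 0 ≤ ϱ) :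
    (∃ C : ℝ≥0∞, C ≠ ⊤ ∧ ∀ᵐ z, planeWeight ℓ ϱ z * ‖φ z‖ₑ ≤ C) ∧
      ∫⁻ z, planeWeight ℓ ϱ z * ‖φ z‖ₑ ≠ ⊤ := by
  obtain ⟨hZ, hPloc, heq⟩ := hφ
  set p : ℝ := (k : ℝ) / m with hpdef
  have hp0 : 0 < p := by positivity
  -- For `0 < p < 4` this lies in `(3, 6)`, exceeds `p + 1` and satisfies `q/p > 3/2`.
  set q : ℝ := 3 + 3 * p / 4 with hq
  have hq0 : 0 < q := by linarith
  have hLq : MemLp φ (ENNReal.ofReal q) volume := hZ.memLp (by linarith) (by linarith)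
  have hφm := hLq.aestronglyMeasurable
  have hc0 : 0 < ε * c := by rcases hε with h | h <;> subst h <;> nlinarith
  have ha0 : 0 < -(ε * α) := by linarith
  have habsε : |ε| = 1 := by rcases hε with h | h <;> simp [h]
  set H : Plane → ℝ := fun z => |φ z| ^ q
  have hH : Integrable H := by
    have := hLq.integrable_norm_rpow (by simpa using hq0) ENNReal.ofReal_ne_top
    simpa [H, ENNReal.toReal_ofReal hq0.le] using this
  have hH0 : ∀ z, 0 ≤ H z := fun z => Real.rpow_nonneg (abs_nonneg _) _
  have hφH : ∀ z, |φ z| ≤ 1 + H z := fun z => by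
    simpa using rpow_le_one_add_rpow (abs_nonneg (φ z)) zero_le_one (by linarith : 1 ≤ q)
  set G : Plane → ℝ := fun z => ε / (p + 1) * powSucc k m (φ z)
  have hGp : ∀ z, |G z| ≤ |φ z| ^ (p + 1) := fun z => by
    rw [abs_mul, abs_div, habsε, abs_of_pos (by linarith : 0 < p + 1)]
    refine le_trans (mul_le_of_le_one_left (abs_nonneg _) ?_) (abs_powSucc_le hm k (φ z))
    rw [div_le_one (by linarith)]; linarith
  have hGH : ∀ z, |G z| ≤ 1 + H z := fun z => (hGp z).trans
    (rpow_le_one_add_rpow (abs_nonneg (φ z)) (by linarith) (by linarith))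
  have hPm := hPloc.aestronglyMeasurable
  have hrep := ae_eq_resolventKer_conv hc0 ha0 hφm (hPm.const_mul (ε / (p + 1))) hH hH0
    (Eventually.of_forall hφH) (Eventually.of_forall hGH) fun χ hχ =>
      integral_mul_solitonOp_eq hε hφm hPm hH hH0 (Eventually.of_forall hφH)
        (Eventually.of_forall hGH) hχ (heq χ hχ)
  have hb := mul_pos ha0 absDerivConst_pos
  set K := lresolventKer (ε * c) (-(ε * α) * absDerivConst)
  have hφK : ∀ᵐ z, ‖φ z‖ₑ ≤ lconv K (fun w => ‖φ w‖ₑ ^ (p + 1)) z := by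
    filter_upwards [hrep] with z hz
    rw [hz]
    refine (enorm_integral_le_lintegral_enorm _).trans (lintegral_mono fun w => ?_)
    rw [enorm_mul]
    gcongr
    · exact enorm_resolventKer_le hb.le _ _
    · change _ ≤ ‖φ w‖ₑ ^ (p + 1)
      rw [← ofReal_norm, ← ofReal_norm, ENNReal.ofReal_rpow_of_nonneg (norm_nonneg _) (by linarith)]
      exact ENNReal.ofReal_le_ofReal (hGp w)
  -- The abstract decay theorem asks for a measurable function, so a measurable representative of
  -- `‖φ‖ₑ` replaces it; the convolution does not see the change.
  have hum := hφm.enorm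
  have hmk := hum.ae_eq_mk
  have huq : ∫⁻ z, hum.mk _ z ^ q ≠ ⊤ := by
    have h1 := hLq.2
    rw [eLpNorm_lt_top_iff_lintegral_rpow_enorm_lt_top (by simpa using hq0) ENNReal.ofReal_ne_top,
      ENNReal.toReal_ofReal hq0.le] at h1
    refine ne_of_eq_of_ne (lintegral_congr_ae ?_) h1.ne
    filter_upwards [hmk] with z hz
    rw [← hz]
  have hle : ∀ᵐ z, hum.mk _ z ≤ lconv K (fun w => hum.mk _ w ^ (p + 1)) z := by
    rw [lconv_congr_right (f' := fun w => ‖φ w‖ₑ ^ (p + 1))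
      (by filter_upwards [hmk] with w hw; rw [← hw])]
    filter_upwards [hmk, hφK] with z h1 h2
    rwa [← h1]
  obtain ⟨⟨C, hC, h1⟩, h2⟩ := _root_.planeWeight_decay hp0 hp (measurable_lresolventKer _ _)
    hum.measurable_mk (lresolventKer_neg _ _)
    (fun r M hr hr1 hM => exists_lresolventKer_le_planeCutPow hc0 hb hr hr1 hM) huq hle hℓ hℓ1 hϱ
  refine ⟨⟨C, hC, ?_⟩, ne_of_eq_of_ne (lintegral_congr_ae ?_) h2⟩
  · filter_upwards [hmk, h1] with z e e1
    rwa [e]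
  · filter_upwards [hmk] with z e
    rw [e]

theorem theorem4p16 (c α ε : ℝ) (k m : ℕ)
    (hk : 0 < k) (hm : Odd m) (hkm : Nat.Coprime k m) (hp : (k : ℝ) / m < 4)
    (hε : ε = 1 ∨ ε = -1) (hαε : α * ε < 0) (hcα : c * α < 0)
    (φ : Plane → ℝ) (hφ : IsSolitaryWave c α ε k m φ) :
    (∀ q ℓ ϱ : ℝ, 1 < q → 0 ≤ ℓ → ℓ < 1 → 0 ≤ ϱ →
      MemLp (fun z : Plane => |z 0| ^ ℓ * |z 1| ^ ϱ * φ z) (ENNReal.ofReal q) volume) ∧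
    (∀ q θ : ℝ, 1 < q → 0 ≤ θ → θ < 1 →
      MemLp (fun z : Plane => ‖z‖ ^ θ * φ z) (ENNReal.ofReal q) volume) ∧
    MemLp φ 1 volume := by
  have hφm : AEStronglyMeasurable φ volume :=
    (hφ.1.memLp (q := 3) (by norm_num) (by norm_num)).aestronglyMeasurable
  have hdecay : ∀ {ℓ ϱ : ℝ}, 0 ≤ ℓ → ℓ < 1 → 0 ≤ ϱ → _ := fun {ℓ ϱ} h1 h2 h3 =>
    hφ.planeWeight_decay hk hm.pos hp hε hαε hcα (ℓ := ℓ) (ϱ := ϱ) h1 h2 h3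
  refine ⟨fun q ℓ ϱ hq hℓ hℓ1 hϱ => ?_, fun q θ hq hθ hθ1 => ?_, ?_⟩
  · obtain ⟨⟨C, hC, hb⟩, hi⟩ := hdecay hℓ hℓ1 hϱ
    exact memLp_of_lintegral_ne_top_of_le
      ((by fun_prop : Measurable fun z : Plane => |z 0| ^ ℓ * |z 1| ^ ϱ).aestronglyMeasurable.mul
        hφm) (Eventually.of_forall fun z => enorm_rpow_mul_rpow_mul_le hℓ hϱ z (φ z)) hC hb hi hq.le
  · obtain ⟨⟨C, hC, hb⟩, hi⟩ := hdecay hθ hθ1 hθ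
    exact memLp_of_lintegral_ne_top_of_le
      ((by fun_prop : Measurable fun z : Plane => ‖z‖ ^ θ).aestronglyMeasurable.mul hφm)
      (Eventually.of_forall fun z => enorm_norm_rpow_mul_le hθ z (φ z)) hC hb hi hq.le
  · obtain ⟨⟨C, hC, hb⟩, hi⟩ := hdecay le_rfl one_pos le_rfl
    rw [← ENNReal.ofReal_one]
    refine memLp_of_lintegral_ne_top_of_le hφm (Eventually.of_forall fun z => ?_) hC hb hi le_rfl
    simp [planeWeight, lineWeight]
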